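/- There are a randomized algorithm, a polynomial $q$ and a constant $\varepsilon>0$ such that the following holds. The input of the algorithm consists of an undirected graph $G$ with $n$ vertices (given by its adjacency matrix), a path decomposition of $G$ with $p$ bags (given by the incidence matrix of bags and vertices), and integers $k\ge 1$ and $s\ge 1$. Here a path decomposition of $G$ is a sequence $B_1,\dots,B_p$ of sets of vertices (bags) such that every vertex lies in some bag, both ends of every edge lie in a common bag, and the indices of the bags containing a given vertex form an interval; its width is $w=\max_i|B_i|-1$ (for instance $w$ is the pathwidth $\operatorname{pw}(G)$ if the decomposition is optimal). Let $\Delta$ be the maximum degree of $G$. Then: (a) for every outcome of its coin tosses, the algorithm answers Yes or No within time $$(\lfloor \Delta/2\rfloor+1)^{w}\cdot q(n+p+\ell(k))\cdot s,$$ where $\ell(k)$ is the number of binary digits of $k$ (so the middle factor is polynomial in $n$ when $k\le n$ and $p$ is polynomially bounded in $n$); (b) if $G$ is $k$-colorable and has at most $s$ proper $k$-colorings, the answer is Yes with probability at least $\varepsilon$; (c) if $G$ is not $k$-colorable, the answer is always No. Time is measured on a random access machine with fair coin tosses under the logarithmic cost criterion (every operation is charged the bit length of the numbers and addresses involved). 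-/

import Mathlib

/-! ### Path decompositions -/

/-- A path decomposition of `G` with `p` bags, in the order of the path. -/
structure PathDecomposition {V : Type} (G : SimpleGraph V) (p : ℕ) where
  bag : Fin p → Finset V
  /-- every vertex lies in some bag -/
  exists_mem_bag : ∀ v : V, ∃ i, v ∈ bag i
  /-- both ends of every edge lie in a common bag -/
  exists_adj_mem_bag : ∀ u v : V, G.Adj u v → ∃ i, u ∈ bag i ∧ v ∈ bag i
  /-- the bags containing a vertex form an interval -/
  mem_bag_of_between : ∀ (v : V) (i j l : Fin p), i ≤ j → j ≤ l → v ∈ bag i → v ∈ bag l → v ∈ bag j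

/-- The width: the largest size of a bag, minus one (and `0` if there is no nonempty bag). -/
def PathDecomposition.width {V : Type} {G : SimpleGraph V} {p : ℕ}
    (P : PathDecomposition G p) : ℕ :=
  (Finset.univ.sup fun i => (P.bag i).card) - 1

/-! ### A randomized random access machine with logarithmic cost

Programs are structured programs over integer registers and integer arrays with computed
addresses. A program mentions only finitely many registers and arrays. The only source of
randomness is the instruction that tosses a fair coin. Every arithmetic operation, every memory
access and every computed address is charged the bit length of the numbers involved. -/
namespace RandomizedRAM

/-- A memory state, together with the sequence of the outcomes of the coin tosses to come. -/
structure State where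
  reg : ℕ → ℤ
  arr : ℕ → ℤ → ℤ
  coins : ℕ → Bool

/-- Arithmetic expressions; `get a i` is the entry of array number `a` at address `i`. -/
inductive Expr : Type
  | lit (z : ℤ)
  | reg (x : ℕ)
  | get (a : ℕ) (i : Expr)
  | add (e f : Expr)
  | sub (e f : Expr)
  | mul (e f : Expr)

/-- The value of an expression. -/
def Expr.eval (σ : State) : Expr → ℤ
  | .lit z => z
  | .reg x => σ.reg x
  | .get a i => σ.arr a (i.eval σ)
  | .add e f => e.eval σ + f.eval σ
  | .sub e f => e.eval σ - f.eval σ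
  | .mul e f => e.eval σ * f.eval σ

/-- The length of the binary notation of an integer, with its sign. -/
def bitLength (z : ℤ) : ℕ := Nat.size z.natAbs + 1

/-- The cost of evaluating an expression: the total bit length of the values of all its
subexpressions. -/
def Expr.cost (σ : State) : Expr → ℕ
  | .lit z => bitLength z
  | .reg x => bitLength (σ.reg x)
  | .get a i => i.cost σ + bitLength (σ.arr a (i.eval σ))
  | .add e f => e.cost σ + f.cost σ + bitLength (e.eval σ + f.eval σ)
  | .sub e f => e.cost σ + f.cost σ + bitLength (e.eval σ - f.eval σ)
  | .mul e f => e.cost σ + f.cost σ + bitLength (e.eval σ * f.eval σ)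

/-- Programs. The tests of `ite` and `loop` ask whether the value of an expression is positive. -/
inductive Program : Type
  | skip
  /-- register `x` receives the value of `e` -/
  | assign (x : ℕ) (e : Expr)
  /-- the entry of array `a` at address `i` receives the value of `e` -/
  | store (a : ℕ) (i e : Expr)
  /-- register `x` receives `0` or `1` by the toss of a fair coin -/
  | toss (x : ℕ)
  | seq (c d : Program)
  /-- if `e` is positive then `c` else `d` -/
  | ite (e : Expr) (c d : Program)
  /-- while `e` is positive do `c` -/
  | loop (e : Expr) (c : Program)

def State.setReg (σ : State) (x : ℕ) (z : ℤ) : State :=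
  { σ with reg := Function.update σ.reg x z }

def State.setArr (σ : State) (a : ℕ) (i z : ℤ) : State :=
  { σ with arr := Function.update σ.arr a (Function.update (σ.arr a) i z) }

/-- Use up the next coin toss, putting its outcome into register `x`. -/
def State.toss (σ : State) (x : ℕ) : State where
  reg := Function.update σ.reg x (if σ.coins 0 then 1 else 0)
  arr := σ.arr
  coins := fun i => σ.coins (i + 1)

/-- `Exec c σ τ t`: started in state `σ`, the program `c` halts in state `τ` after time `t`. -/
inductive Exec : Program → State → State → ℕ → Prop
  | skip (σ : State) : Exec .skip σ σ 1
  | assign (σ : State) (x : ℕ) (e : Expr) :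
      Exec (.assign x e) σ (σ.setReg x (e.eval σ)) (e.cost σ + 1)
  | store (σ : State) (a : ℕ) (i e : Expr) :
      Exec (.store a i e) σ (σ.setArr a (i.eval σ) (e.eval σ)) (i.cost σ + e.cost σ + 1)
  | toss (σ : State) (x : ℕ) : Exec (.toss x) σ (σ.toss x) 1
  | seq {c d : Program} {σ τ υ : State} {t t' : ℕ} :
      Exec c σ τ t → Exec d τ υ t' → Exec (.seq c d) σ υ (t + t')
  | ite_pos {e : Expr} {c d : Program} {σ τ : State} {t : ℕ} :
      0 < e.eval σ → Exec c σ τ t → Exec (.ite e c d) σ τ (e.cost σ + 1 + t)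
  | ite_neg {e : Expr} {c d : Program} {σ τ : State} {t : ℕ} :
      ¬ 0 < e.eval σ → Exec d σ τ t → Exec (.ite e c d) σ τ (e.cost σ + 1 + t)
  | loop_pos {e : Expr} {c : Program} {σ τ υ : State} {t t' : ℕ} :
      0 < e.eval σ → Exec c σ τ t → Exec (.loop e c) τ υ t' →
      Exec (.loop e c) σ υ (e.cost σ + 1 + t + t')
  | loop_neg {e : Expr} {c : Program} {σ : State} :
      ¬ 0 < e.eval σ → Exec (.loop e c) σ σ (e.cost σ + 1)

/-- For given coin tosses, the final state and the running time are determined. -/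
theorem Exec.deterministic {c : Program} {σ τ : State} {t : ℕ} (h : Exec c σ τ t) :
    ∀ {τ' : State} {t' : ℕ}, Exec c σ τ' t' → τ = τ' ∧ t = t' := by
  induction h with
  | skip => intro τ' t' h'; cases h'; exact ⟨rfl, rfl⟩
  | assign => intro τ' t' h'; cases h'; exact ⟨rfl, rfl⟩
  | store => intro τ' t' h'; cases h'; exact ⟨rfl, rfl⟩
  | toss => intro τ' t' h'; cases h'; exact ⟨rfl, rfl⟩
  | seq _ _ ih₁ ih₂ =>
    intro τ' t' h'
    cases h' with
    | seq a b =>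
      obtain ⟨rfl, rfl⟩ := ih₁ a
      obtain ⟨rfl, rfl⟩ := ih₂ b
      exact ⟨rfl, rfl⟩
  | ite_pos hp _ ih =>
    intro τ' t' h'
    cases h' with
    | ite_pos _ a => obtain ⟨rfl, rfl⟩ := ih a; exact ⟨rfl, rfl⟩
    | ite_neg hn _ => exact absurd hp hn
  | ite_neg hn _ ih =>
    intro τ' t' h'
    cases h' with
    | ite_pos hp _ => exact absurd hp hn
    | ite_neg _ a => obtain ⟨rfl, rfl⟩ := ih a; exact ⟨rfl, rfl⟩
  | loop_pos hp _ _ ih₁ ih₂ =>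
    intro τ' t' h'
    cases h' with
    | loop_pos _ a b =>
      obtain ⟨rfl, rfl⟩ := ih₁ a
      obtain ⟨rfl, rfl⟩ := ih₂ b
      exact ⟨rfl, rfl⟩
    | loop_neg hn => exact absurd hp hn
  | loop_neg hn =>
    intro τ' t' h'
    cases h' with
    | loop_pos hp _ _ => exact absurd hp hn
    | loop_neg _ => exact ⟨rfl, rfl⟩

/-- Started in state `σ`, the program halts within time `T` with `z` in register `0`. -/
def OutputsWithin (c : Program) (σ : State) (z : ℤ) (T : ℕ) : Prop :=
  ∃ (τ : State) (t : ℕ), Exec c σ τ t ∧ τ.reg 0 = z ∧ t ≤ T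

/-- Started in state `σ`, the program halts with `z` in register `0`. -/
def Outputs (c : Program) (σ : State) (z : ℤ) : Prop :=
  ∃ (τ : State) (t : ℕ), Exec c σ τ t ∧ τ.reg 0 = z

/-- The law of an infinite sequence of independent tosses of a fair coin. -/
noncomputable def coinMeasure : MeasureTheory.Measure (ℕ → Bool) :=
  MeasureTheory.Measure.infinitePi fun _ => (PMF.uniformOfFintype Bool).toMeasure

end RandomizedRAM

/-! ### The input of the coloring algorithm -/

/-- The initial memory: registers `0, 1, 2, 3` hold the number `n` of vertices, the number `p` of
bags, the number `k` of colors and the bound `s`; array `0` holds the adjacency matrix of the graph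
and array `1` the incidence matrix of bags and vertices, both row by row. Everything else
is `0`. -/
def coloringInput {n p : ℕ} (G : SimpleGraph (Fin n)) [DecidableRel G.Adj]
    (P : PathDecomposition G p) (k s : ℕ) (coins : ℕ → Bool) : RandomizedRAM.State where
  reg := fun x =>
    if x = 0 then (n : ℤ) else if x = 1 then (p : ℤ) else if x = 2 then (k : ℤ)
    else if x = 3 then (s : ℤ) else 0
  arr := fun a z =>
    if a = 0 then
      (if ∃ u v : Fin n, z = ((u : ℕ) : ℤ) * n + ((v : ℕ) : ℤ) ∧ G.Adj u v then 1 else 0)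
    else if a = 1 then
      (if ∃ (i : Fin p) (v : Fin n), z = ((i : ℕ) : ℤ) * n + ((v : ℕ) : ℤ) ∧ v ∈ P.bag i
        then 1 else 0)
    else 0
  coins := coins

/-! ### Reasoning about programs -/

namespace RandomizedRAM

/-! Identify colors with residues modulo `k`, and residues with `k`-th roots of unity. The product
of the differences `x u - x v` over all edges is nonzero at a vector of roots of unity exactly if
the vector is a proper coloring (`pairProd_ne_zero_iff_isColoring`). Modulo the relations `x w ^ k =
1` this product is a polynomial whose coefficients, indexed by `(ZMod k) ^ n`, are the Fourier
coefficients of the function it defines. The coefficient at `a` is the signed count of the ways to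
pick one end of each edge such that every vertex `w` is picked `a w` times modulo `k`; this is
`demandCoeff a l 0`.

If `G` is not `k`-colorable, the function vanishes and all coefficients are zero, so the answer Yes
is never wrong. If `G` has between `1` and `s` colorings, the uncertainty principle (a nonzero
function and its Fourier transform have supports whose sizes multiply to at least `k ^ n`) yields at
least `k ^ n / s` nonzero coefficients (`pow_le_card_mul_card_coloring`). A nearly uniform random
`a` hits one of them with probability at least `1 / (2 * s)`, and `s` independent trials succeed
with probability at least `1 - exp (-1/2)` (`le_coinMeasure_real_exists_sample_mem`).

One coefficient is computed by a dynamic program that runs through the edges in the order of their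
first bags and keeps a table of signed counts, indexed by the demand still to be met. If `c` edges
at `w` have been handled and `r` remain, then at most `c + 1` demands at `w` are reachable from `a
w`, and at most `r + 1` can still be brought to `0`. As `c + r ≤ Δ`, at most `Δ / 2 + 1` values
survive; there is only one if `c = 0` or `r = 0`, which holds for every vertex outside the current
bag. So a table has at most `(Δ / 2 + 1) ^ (w + 1)` entries (`length_le_of_subset_demandBox`), where
`w` now is the width, and the surplus factor `Δ / 2 + 1 ≤ n` goes into the polynomial.

The remainder implements this on the machine. Two devices keep the cost low: the code of a table key
carries the number of the current step, so that the lookup array never has to be erased; and the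
number of trials is capped at `k ^ n`, so that the bit length of `s` does not enter the cost of a
trial. -/

@[simp] theorem State.setReg_reg (σ : State) (x : ℕ) (z : ℤ) (y : ℕ) :
    (σ.setReg x z).reg y = if y = x then z else σ.reg y := by
  simp [State.setReg, Function.update_apply]

@[simp] theorem State.setReg_arr (σ : State) (x : ℕ) (z : ℤ) : (σ.setReg x z).arr = σ.arr := rfl

@[simp] theorem State.setReg_coins (σ : State) (x : ℕ) (z : ℤ) :
    (σ.setReg x z).coins = σ.coins := rfl

@[simp] theorem State.setArr_reg (σ : State) (a : ℕ) (i z : ℤ) :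
    (σ.setArr a i z).reg = σ.reg := rfl

@[simp] theorem State.setArr_arr (σ : State) (a : ℕ) (i z : ℤ) (b : ℕ) (j : ℤ) :
    (σ.setArr a i z).arr b j = if b = a ∧ j = i then z else σ.arr b j := by
  by_cases h : b = a
  · subst h
    simp [State.setArr, Function.update_apply]
  · simp [State.setArr, h]

@[simp] theorem State.setArr_coins (σ : State) (a : ℕ) (i z : ℤ) :
    (σ.setArr a i z).coins = σ.coins := rfl

@[simp] theorem State.toss_reg (σ : State) (x y : ℕ) :
    (σ.toss x).reg y = if y = x then (if σ.coins 0 then 1 else 0) else σ.reg y := by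
  simp [State.toss, Function.update_apply]

/-- The number of nodes of an expression. -/
def Expr.size : Expr → ℕ
  | .lit _ => 1
  | .reg _ => 1
  | .get _ i => i.size + 1
  | .add e f => e.size + f.size + 1
  | .sub e f => e.size + f.size + 1
  | .mul e f => e.size + f.size + 1

/-- All literals are at most `2` in absolute value. -/
def Expr.smallLits : Expr → Bool
  | .lit z => z.natAbs ≤ 2
  | .reg _ => true
  | .get _ i => i.smallLits
  | .add e f => e.smallLits && f.smallLits
  | .sub e f => e.smallLits && f.smallLits
  | .mul e f => e.smallLits && f.smallLits

/-- Expressions with few nodes and small literals. -/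
def Expr.short (e : Expr) : Bool := e.smallLits && e.size ≤ 40

/-- All entries of the memory are at most `2 ^ X` in absolute value. -/
structure Bounded (X : ℕ) (σ : State) : Prop where
  pos : 1 ≤ X
  reg : ∀ x, |σ.reg x| ≤ 2 ^ X
  arr : ∀ a z, |σ.arr a z| ≤ 2 ^ X

/-! ### Bounds for memory entries and for the cost of expressions -/

theorem Bounded.setReg {X : ℕ} {σ : State} (h : Bounded X σ) (x : ℕ) {z : ℤ}
    (hz : |z| ≤ 2 ^ X) : Bounded X (σ.setReg x z) := by
  refine ⟨h.pos, fun y => ?_, h.arr⟩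
  rw [State.setReg_reg]
  split
  · exact hz
  · exact h.reg y

theorem Bounded.setArr {X : ℕ} {σ : State} (h : Bounded X σ) (a : ℕ) (i : ℤ) {z : ℤ}
    (hz : |z| ≤ 2 ^ X) : Bounded X (σ.setArr a i z) := by
  refine ⟨h.pos, h.reg, fun b j => ?_⟩
  rw [State.setArr_arr]
  split
  · exact hz
  · exact h.arr b j

theorem Bounded.one_le {X : ℕ} {σ : State} (_ : Bounded X σ) : (1 : ℤ) ≤ 2 ^ X :=
  one_le_pow₀ (by norm_num)

theorem Bounded.two_le {X : ℕ} {σ : State} (h : Bounded X σ) : (2 : ℤ) ≤ 2 ^ X :=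
  le_self_pow₀ (by norm_num) (by have := h.pos; omega)

theorem Bounded.toss {X : ℕ} {σ : State} (h : Bounded X σ) (x : ℕ) : Bounded X (σ.toss x) := by
  refine ⟨h.pos, fun y => ?_, h.arr⟩
  rw [State.toss_reg]
  have := h.one_le
  split
  · split
    · simpa using this
    · simp
  · exact h.reg y

theorem Bounded.abs_eval_le {X : ℕ} {σ : State} (h : Bounded X σ) :
    ∀ {e : Expr}, e.smallLits = true → |e.eval σ| ≤ 2 ^ (X * e.size) := by
  -- The node of the operation itself contributes a factor `2 ^ X ≥ 2`, which pays for the doubling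
  -- in a sum.
  have key : ∀ {a b : ℕ}, (2 : ℤ) ^ (X * a) + 2 ^ (X * b) ≤ 2 ^ (X * (a + b + 1)) := by
    intro a b
    have h1 : (2 : ℤ) ^ (X * a) ≤ 2 ^ (X * (a + b)) :=
      pow_le_pow_right₀ (by norm_num) (by gcongr; omega)
    have h2 : (2 : ℤ) ^ (X * b) ≤ 2 ^ (X * (a + b)) :=
      pow_le_pow_right₀ (by norm_num) (by gcongr; omega)
    have h3 : (2 : ℤ) ^ (X * (a + b)) * 2 ≤ 2 ^ (X * (a + b)) * 2 ^ X := by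
      have := h.two_le
      gcongr
    rw [mul_add X (a + b) 1, pow_add, mul_one]
    linarith
  intro e
  induction e with
  | lit z =>
    intro hs
    simp only [Expr.smallLits, decide_eq_true_eq] at hs
    simp only [Expr.eval, Expr.size, mul_one]
    rw [Int.abs_eq_natAbs]
    have := h.two_le
    omega
  | reg x => intro _; simpa [Expr.eval, Expr.size] using h.reg x
  | get a i _ =>
    intro _
    simp only [Expr.eval, Expr.size]
    exact (h.arr a _).trans (pow_le_pow_right₀ (by norm_num) (by nlinarith))
  | add e f ihe ihf =>
    intro hs
    simp only [Expr.smallLits, Bool.and_eq_true] at hs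
    exact (abs_add_le _ _).trans ((add_le_add (ihe hs.1) (ihf hs.2)).trans key)
  | sub e f ihe ihf =>
    intro hs
    simp only [Expr.smallLits, Bool.and_eq_true] at hs
    exact (abs_sub _ _).trans ((add_le_add (ihe hs.1) (ihf hs.2)).trans key)
  | mul e f ihe ihf =>
    intro hs
    simp only [Expr.smallLits, Bool.and_eq_true] at hs
    simp only [Expr.eval, Expr.size, abs_mul]
    refine (mul_le_mul (ihe hs.1) (ihf hs.2) (abs_nonneg _) (by positivity)).trans ?_
    rw [← pow_add]
    exact pow_le_pow_right₀ (by norm_num) (by nlinarith)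

theorem bitLength_le {z : ℤ} {m : ℕ} (h : |z| ≤ 2 ^ m) : bitLength z ≤ m + 2 := by
  unfold bitLength
  have : z.natAbs < 2 ^ (m + 1) := by
    zify
    rw [pow_succ]
    have : (0 : ℤ) < 2 ^ m := by positivity
    linarith
  have := Nat.size_le.2 this
  omega

theorem Bounded.cost_le {X : ℕ} {σ : State} (h : Bounded X σ) :
    ∀ {e : Expr}, e.smallLits = true → e.cost σ ≤ e.size * (X * e.size + 2) := by
  have key : ∀ {a b c d B : ℕ}, a ≤ c * (X * c + 2) → b ≤ d * (X * d + 2) →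
      B ≤ X * (c + d + 1) + 2 → a + b + B ≤ (c + d + 1) * (X * (c + d + 1) + 2) := by
    intro a b c d B h1 h2 h3
    have h4 : c * (X * c + 2) ≤ c * (X * (c + d + 1) + 2) := by gcongr; omega
    have h5 : d * (X * d + 2) ≤ d * (X * (c + d + 1) + 2) := by gcongr; omega
    linarith
  intro e
  induction e with
  | lit z =>
    intro hs
    simpa [Expr.cost, Expr.size, Expr.eval] using bitLength_le (h.abs_eval_le hs)
  | reg x =>
    intro hs
    simpa [Expr.cost, Expr.size, Expr.eval] using bitLength_le (h.abs_eval_le (e := .reg x) rfl)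
  | get a i ih =>
    intro hs
    have h1 := ih hs
    have h2 : bitLength (σ.arr a (i.eval σ)) ≤ X + 2 := bitLength_le (h.arr a _)
    simp only [Expr.cost, Expr.size]
    have h4 : i.size * (X * i.size + 2) ≤ i.size * (X * (i.size + 1) + 2) := by gcongr; omega
    nlinarith
  | add e f ihe ihf =>
    intro hs
    have hb := bitLength_le (h.abs_eval_le hs)
    simp only [Expr.smallLits, Bool.and_eq_true] at hs
    exact key (ihe hs.1) (ihf hs.2) hb
  | sub e f ihe ihf =>
    intro hs
    have hb := bitLength_le (h.abs_eval_le hs)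
    simp only [Expr.smallLits, Bool.and_eq_true] at hs
    exact key (ihe hs.1) (ihf hs.2) hb
  | mul e f ihe ihf =>
    intro hs
    have hb := bitLength_le (h.abs_eval_le hs)
    simp only [Expr.smallLits, Bool.and_eq_true] at hs
    exact key (ihe hs.1) (ihf hs.2) hb

/-- Every expression of the algorithm satisfies the bound of `40` nodes; the longest one,
`firstBagTest`, has `38`. The constant comes from `40 * (40 * X + 2) + 1 ≤ 2000 * X`. -/
theorem Bounded.cost_le_of_short {X : ℕ} {σ : State} (h : Bounded X σ) {e : Expr}
    (hs : e.short = true) : e.cost σ + 1 ≤ 2000 * X := by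
  simp only [Expr.short, Bool.and_eq_true, decide_eq_true_eq] at hs
  have h1 := h.cost_le hs.1
  have h2 : e.size * (X * e.size + 2) ≤ 40 * (X * 40 + 2) := by
    have := hs.2
    gcongr
  have := h.pos
  omega

/-- The registers that a program may change. -/
def Program.writesReg (x : ℕ) : Program → Bool
  | .skip => false
  | .assign y _ => x == y
  | .store _ _ _ => false
  | .toss y => x == y
  | .seq c d => c.writesReg x || d.writesReg x
  | .ite _ c d => c.writesReg x || d.writesReg x
  | .loop _ c => c.writesReg x

/-- The arrays that a program may change. -/
def Program.writesArr (a : ℕ) : Program → Bool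
  | .skip => false
  | .assign _ _ => false
  | .store b _ _ => a == b
  | .toss _ => false
  | .seq c d => c.writesArr a || d.writesArr a
  | .ite _ c d => c.writesArr a || d.writesArr a
  | .loop _ c => c.writesArr a

/-- Whether a program may toss coins. -/
def Program.tosses : Program → Bool
  | .skip => false
  | .assign _ _ => false
  | .store _ _ _ => false
  | .toss _ => true
  | .seq c d => c.tosses || d.tosses
  | .ite _ c d => c.tosses || d.tosses
  | .loop _ c => c.tosses

/-- The parts of the memory that `c` does not mention as targets agree in `σ` and `τ`. -/
structure Frame (c : Program) (σ τ : State) : Prop where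
  reg : ∀ x, c.writesReg x = false → τ.reg x = σ.reg x
  arr : ∀ a, c.writesArr a = false → τ.arr a = σ.arr a
  coins : c.tosses = false → τ.coins = σ.coins

/-! ### Frame conditions -/

theorem Frame.refl (c : Program) (σ : State) : Frame c σ σ :=
  ⟨fun _ _ => rfl, fun _ _ => rfl, fun _ => rfl⟩

theorem Frame.trans {c : Program} {σ τ υ : State} (h : Frame c σ τ) (h' : Frame c τ υ) :
    Frame c σ υ :=
  ⟨fun x hx => (h'.reg x hx).trans (h.reg x hx), fun a ha => (h'.arr a ha).trans (h.arr a ha),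
    fun hc => (h'.coins hc).trans (h.coins hc)⟩

theorem Frame.mono {c d : Program} {σ τ : State} (h : Frame c σ τ)
    (hr : ∀ x, d.writesReg x = false → c.writesReg x = false)
    (ha : ∀ a, d.writesArr a = false → c.writesArr a = false)
    (hc : d.tosses = false → c.tosses = false) : Frame d σ τ :=
  ⟨fun x hx => h.reg x (hr x hx), fun a hx => h.arr a (ha a hx), fun hx => h.coins (hc hx)⟩

/-- The write sets are computed from the syntax. For a concrete program the side conditions
`c.writesReg x = false` therefore hold by `rfl`, and loop invariants need only mention what the loop
changes. -/
theorem Exec.frame {c : Program} {σ τ : State} {t : ℕ} (h : Exec c σ τ t) : Frame c σ τ := by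
  induction h with
  | skip σ => exact Frame.refl _ σ
  | assign σ x e =>
    refine ⟨fun y hy => ?_, fun _ _ => rfl, fun _ => rfl⟩
    simp only [Program.writesReg, beq_eq_false_iff_ne] at hy
    simp [hy]
  | store σ a i e =>
    refine ⟨fun _ _ => rfl, fun b hb => ?_, fun _ => rfl⟩
    simp only [Program.writesArr, beq_eq_false_iff_ne] at hb
    ext j
    simp [hb]
  | toss σ x =>
    refine ⟨fun y hy => ?_, fun _ _ => rfl, fun h => by simp [Program.tosses] at h⟩
    simp only [Program.writesReg, beq_eq_false_iff_ne] at hy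
    simp [hy]
  | seq _ _ h1 h2 =>
    refine (h1.mono ?_ ?_ ?_).trans (h2.mono ?_ ?_ ?_) <;>
      simp +contextual [Program.writesReg, Program.writesArr, Program.tosses]
  | ite_pos _ _ h =>
    refine h.mono ?_ ?_ ?_ <;>
      simp +contextual [Program.writesReg, Program.writesArr, Program.tosses]
  | ite_neg _ _ h =>
    refine h.mono ?_ ?_ ?_ <;>
      simp +contextual [Program.writesReg, Program.writesArr, Program.tosses]
  | loop_pos _ _ _ h1 h2 =>
    refine (h1.mono ?_ ?_ ?_).trans h2 <;>
      simp +contextual [Program.writesReg, Program.writesArr, Program.tosses]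
  | loop_neg _ => exact Frame.refl _ _

/-- Started in `σ`, the program `c` halts after at most `N` elementary steps on numbers of
at most about `X` bits, in a state with entries of at most `X` bits that satisfies `Q`. -/
def Runs (X : ℕ) (c : Program) (σ : State) (N : ℕ) (Q : State → Prop) : Prop :=
  ∃ τ t, Exec c σ τ t ∧ t ≤ N * (4000 * X) ∧ Bounded X τ ∧ Q τ

/-! ### Program rules with step counts -/

theorem Runs.mono {X : ℕ} {c : Program} {σ : State} {N N' : ℕ} {Q Q' : State → Prop}
    (h : Runs X c σ N Q) (hN : N ≤ N')
    (hQ : ∀ τ, Bounded X τ → Frame c σ τ → Q τ → Q' τ) : Runs X c σ N' Q' := by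
  obtain ⟨τ, t, he, ht, hb, hq⟩ := h
  exact ⟨τ, t, he, ht.trans (by gcongr), hb, hQ τ hb he.frame hq⟩

theorem Runs.seq {X : ℕ} {c d : Program} {σ : State} {N N' : ℕ} {Q Q' : State → Prop}
    (h : Runs X c σ N Q)
    (h' : ∀ τ, Bounded X τ → Frame c σ τ → Q τ → Runs X d τ N' Q') :
    Runs X (.seq c d) σ (N + N') Q' := by
  obtain ⟨τ, t, he, ht, hb, hq⟩ := h
  obtain ⟨υ, t', he', ht', hb', hq'⟩ := h' τ hb he.frame hq
  exact ⟨υ, t + t', .seq he he', by rw [add_mul]; omega, hb', hq'⟩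

theorem Runs.skip {X : ℕ} {σ : State} {Q : State → Prop} (hb : Bounded X σ) (hq : Q σ) :
    Runs X .skip σ 1 Q :=
  ⟨σ, 1, .skip σ, by have := hb.pos; omega, hb, hq⟩

theorem Runs.assign {X : ℕ} {σ : State} {x : ℕ} {e : Expr} {Q : State → Prop}
    (hb : Bounded X σ) (hs : e.short = true) (hv : |e.eval σ| ≤ 2 ^ X)
    (hq : Bounded X (σ.setReg x (e.eval σ)) → Q (σ.setReg x (e.eval σ))) :
    Runs X (.assign x e) σ 1 Q :=
  ⟨_, _, .assign σ x e, by have := hb.cost_le_of_short hs; omega, hb.setReg x hv,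
    hq (hb.setReg x hv)⟩

/-- A store evaluates two expressions of cost below `2000 * X` each; this is why a step in `Runs` is
worth `4000 * X`. -/
theorem Runs.store {X : ℕ} {σ : State} {a : ℕ} {i e : Expr} {Q : State → Prop}
    (hb : Bounded X σ) (hi : i.short = true) (hs : e.short = true) (hv : |e.eval σ| ≤ 2 ^ X)
    (hq : Bounded X (σ.setArr a (i.eval σ) (e.eval σ)) →
      Q (σ.setArr a (i.eval σ) (e.eval σ))) :
    Runs X (.store a i e) σ 1 Q :=
  ⟨_, _, .store σ a i e,
    by have := hb.cost_le_of_short hs; have := hb.cost_le_of_short hi; omega,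
    hb.setArr a _ hv, hq (hb.setArr a _ hv)⟩

theorem Runs.toss {X : ℕ} {σ : State} {x : ℕ} {Q : State → Prop}
    (hb : Bounded X σ) (hq : Bounded X (σ.toss x) → Q (σ.toss x)) :
    Runs X (.toss x) σ 1 Q :=
  ⟨_, _, .toss σ x, by have := hb.pos; omega, hb.toss x, hq (hb.toss x)⟩

theorem Runs.assign_seq {X : ℕ} {σ : State} {x : ℕ} {e : Expr} {d : Program} {N : ℕ}
    {Q : State → Prop} (hb : Bounded X σ) (hs : e.short = true) (hv : |e.eval σ| ≤ 2 ^ X)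
    (hd : Bounded X (σ.setReg x (e.eval σ)) → Runs X d (σ.setReg x (e.eval σ)) N Q) :
    Runs X (.seq (.assign x e) d) σ (1 + N) Q :=
  (Runs.assign (Q := fun τ => Bounded X τ ∧ τ = σ.setReg x (e.eval σ)) hb hs hv
    fun h => ⟨h, rfl⟩).seq fun _ _ _ h => h.2 ▸ hd (h.2 ▸ h.1)

theorem Runs.store_seq {X : ℕ} {σ : State} {a : ℕ} {i e : Expr} {d : Program} {N : ℕ}
    {Q : State → Prop} (hb : Bounded X σ) (hi : i.short = true) (hs : e.short = true)
    (hv : |e.eval σ| ≤ 2 ^ X)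
    (hd : Bounded X (σ.setArr a (i.eval σ) (e.eval σ)) →
      Runs X d (σ.setArr a (i.eval σ) (e.eval σ)) N Q) :
    Runs X (.seq (.store a i e) d) σ (1 + N) Q :=
  (Runs.store (Q := fun τ => Bounded X τ ∧ τ = σ.setArr a (i.eval σ) (e.eval σ)) hb hi hs hv
    fun h => ⟨h, rfl⟩).seq fun _ _ _ h => h.2 ▸ hd (h.2 ▸ h.1)

theorem Runs.toss_seq {X : ℕ} {σ : State} {x : ℕ} {d : Program} {N : ℕ}
    {Q : State → Prop} (hb : Bounded X σ)
    (hd : Bounded X (σ.toss x) → Runs X d (σ.toss x) N Q) :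
    Runs X (.seq (.toss x) d) σ (1 + N) Q :=
  (Runs.toss (Q := fun τ => Bounded X τ ∧ τ = σ.toss x) hb
    fun h => ⟨h, rfl⟩).seq fun _ _ _ h => h.2 ▸ hd (h.2 ▸ h.1)

theorem Runs.ite {X : ℕ} {σ : State} {e : Expr} {c d : Program} {N : ℕ} {Q : State → Prop}
    (hb : Bounded X σ) (hs : e.short = true) (hc : 0 < e.eval σ → Runs X c σ N Q)
    (hd : e.eval σ ≤ 0 → Runs X d σ N Q) : Runs X (.ite e c d) σ (1 + N) Q := by
  have hcost := hb.cost_le_of_short hs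
  by_cases h : 0 < e.eval σ
  · obtain ⟨τ, t, he, ht, hq⟩ := hc h
    exact ⟨τ, _, .ite_pos h he, by rw [add_mul]; omega, hq⟩
  · obtain ⟨τ, t, he, ht, hq⟩ := hd (not_lt.1 h)
    exact ⟨τ, _, .ite_neg h he, by rw [add_mul]; omega, hq⟩

/-- While `x < y`, do `c` and increase `x`. -/
def Program.whileLess (x y : ℕ) (c : Program) : Program :=
  .loop (.sub (.reg y) (.reg x)) (.seq c (.assign x (.add (.reg x) (.lit 1))))

theorem Frame.of_whileLess_step {x y : ℕ} {c : Program} {σ τ : State} (h : Frame c σ τ) (z : ℤ) :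
    Frame (.whileLess x y c) σ (τ.setReg x z) := by
  refine ⟨fun u hu => ?_, fun a ha => ?_, fun hc => ?_⟩
  · simp only [Program.whileLess, Program.writesReg, Bool.or_eq_false_iff,
      beq_eq_false_iff_ne] at hu
    rw [State.setReg_reg, if_neg hu.2, h.reg u hu.1]
  · simp only [Program.whileLess, Program.writesArr, Bool.or_false] at ha
    exact h.arr a ha
  · simp only [Program.whileLess, Program.tosses, Bool.or_false] at hc
    exact h.coins hc

/-- Induction on the number of remaining rounds. Each round adds two steps to those of the body, one
for the test and one for the increment. The invariant is required after the increment, so it may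
also speak of the counter. -/
theorem Runs.whileLess {X x y : ℕ} {c : Program} {σ : State} (I : ℕ → State → Prop)
    (A B N : ℕ) (hxy : y ≠ x) (hcx : c.writesReg x = false) (hcy : c.writesReg y = false)
    (hAB : A ≤ B) (hx : σ.reg x = A) (hy : σ.reg y = B) (hb : Bounded X σ) (hI : I A σ)
    (step : ∀ (i : ℕ) (τ : State), A ≤ i → i < B → τ.reg x = i → τ.reg y = B →
      Frame (.whileLess x y c) σ τ → Bounded X τ → I i τ →
      Runs X c τ N fun τ' => I (i + 1) (τ'.setReg x ((i + 1 : ℕ) : ℤ))) :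
    Runs X (.whileLess x y c) σ ((B - A) * (N + 2) + 1) fun τ =>
      I B τ ∧ τ.reg x = B := by
  have main : ∀ (m i : ℕ) (τ : State), i + m = B → A ≤ i → τ.reg x = i → τ.reg y = B →
      Frame (.whileLess x y c) σ τ → Bounded X τ → I i τ →
      Runs X (.whileLess x y c) τ (m * (N + 2) + 1) fun τ => I B τ ∧ τ.reg x = B := by
    intro m
    induction m with
    | zero =>
      intro i τ hi _ hx hy _ hb hI
      obtain rfl : i = B := by omega
      have hcost := hb.cost_le_of_short (e := .sub (.reg y) (.reg x)) rfl
      refine ⟨τ, _, .loop_neg ?_, ?_, hb, hI, hx⟩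
      · simp [Expr.eval, hx, hy]
      · omega
    | succ m ih =>
      intro i τ hi hA hx hy hf hb hI
      have hcost := hb.cost_le_of_short (e := .sub (.reg y) (.reg x)) rfl
      obtain ⟨τ₁, t₁, he₁, ht₁, hb₁, hI₁⟩ := step i τ hA (by omega) hx hy hf hb hI
      have hf₁ := he₁.frame
      have hx₁ : τ₁.reg x = i := by rw [hf₁.reg x hcx, hx]
      have hev : (Expr.add (.reg x) (.lit 1)).eval τ₁ = ((i + 1 : ℕ) : ℤ) := by
        simp [Expr.eval, hx₁]
      -- The increased counter is at most `B`, and `B` already stands in register `y`, so the memory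
      -- bound persists.
      have hle : |(Expr.add (.reg x) (.lit 1)).eval τ₁| ≤ 2 ^ X := by
        have h1 := hb.reg y
        rw [hy] at h1
        rw [hev, Nat.abs_cast]
        rw [Nat.abs_cast] at h1
        have : ((i + 1 : ℕ) : ℤ) ≤ B := by exact_mod_cast (by omega)
        omega
      have hcost₂ := hb₁.cost_le_of_short (e := .add (.reg x) (.lit 1)) rfl
      have hexec := Exec.assign τ₁ x (.add (.reg x) (.lit 1))
      rw [hev] at hexec hle
      obtain ⟨τ₂, t₂, he₂, ht₂, hb₂, hq⟩ := ih (i + 1) (τ₁.setReg x ((i + 1 : ℕ) : ℤ))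
        (by omega) (by omega) (by simp) (by rw [State.setReg_reg, if_neg hxy, hf₁.reg y hcy, hy])
        (hf.trans (hf₁.of_whileLess_step _)) (hb₁.setReg x hle) hI₁
      refine ⟨τ₂, _, .loop_pos ?_ (.seq he₁ hexec) he₂, ?_, hb₂, hq⟩
      · simp only [Expr.eval, hx, hy]
        omega
      · have : (m + 1) * (N + 2) + 1 = m * (N + 2) + 1 + N + 2 := by ring
        rw [this, add_mul, add_mul]
        omega
  exact main (B - A) A σ (by omega) le_rfl hx hy (Frame.refl _ _) hb hI

/-- For `x` from `0` to `y`, do `c`. -/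
def Program.forLess (x y : ℕ) (c : Program) : Program :=
  .seq (.assign x (.lit 0)) (.whileLess x y c)

theorem Frame.of_whileLess {x y : ℕ} {c : Program} {σ τ : State} {z : ℤ}
    (h : Frame (.whileLess x y c) (σ.setReg x z) τ) :
    Frame (.forLess x y c) σ τ := by
  refine ⟨fun u hu => ?_, fun a ha => ?_, fun hc => ?_⟩
  · simp only [Program.forLess, Program.writesReg, Bool.or_eq_false_iff,
      beq_eq_false_iff_ne] at hu
    rw [h.reg u hu.2, State.setReg_reg, if_neg hu.1]
  · simp only [Program.forLess, Program.writesArr, Bool.false_or] at ha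
    exact h.arr a ha
  · simp only [Program.forLess, Program.tosses, Bool.false_or] at hc
    exact h.coins hc

theorem Runs.forLess {X x y : ℕ} {c : Program} {σ : State} (I : ℕ → State → Prop)
    (B N : ℕ) (hxy : y ≠ x) (hcx : c.writesReg x = false) (hcy : c.writesReg y = false)
    (hy : σ.reg y = B) (hb : Bounded X σ) (hI : I 0 (σ.setReg x 0))
    (step : ∀ (i : ℕ) (τ : State), i < B → τ.reg x = i → τ.reg y = B →
      Frame (.forLess x y c) σ τ → Bounded X τ → I i τ →
      Runs X c τ N fun τ' => I (i + 1) (τ'.setReg x ((i + 1 : ℕ) : ℤ))) :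
    Runs X (.forLess x y c) σ (B * (N + 2) + 2) fun τ => I B τ ∧ τ.reg x = B := by
  refine Runs.mono (N := 1 + ((B - 0) * (N + 2) + 1)) ?_ (by rw [Nat.sub_zero]; omega)
    (fun τ _ _ h => h)
  refine Runs.assign_seq hb rfl (by simp [Expr.eval]) fun hb' => ?_
  refine Runs.whileLess I 0 B N hxy hcx hcy (Nat.zero_le B) (by simp [Expr.eval])
    (by rw [State.setReg_reg, if_neg hxy, hy]) hb' hI ?_
  intro i τ _ hi h1 h2 h3 h4 h5
  exact step i τ hi h1 h2 (Frame.of_whileLess h3) h4 h5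

end RandomizedRAM

/-! ### The signed count of orientations with given outdegrees modulo `k` -/

section Coefficients

variable {n k : ℕ}

/-- The indicator of the index `u`. -/
def unitVec (n k u : ℕ) : Fin n → ZMod k := fun w => if (w : ℕ) = u then 1 else 0

/-- Started from the demand `a`, orient the pairs in `l` one after the other, each time
decreasing the demand of one end by one; `demandCoeff a l d` counts the ways to end with the demand
`d`, with a sign for each pair whose second end is chosen. -/
def demandCoeff (a : Fin n → ZMod k) (l : List (ℕ × ℕ)) : (Fin n → ZMod k) → ℤ :=
  l.foldl (fun U e d => U (d + unitVec n k e.1) - U (d + unitVec n k e.2))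
    (fun d => if d = a then 1 else 0)

@[simp] theorem demandCoeff_nil (a d : Fin n → ZMod k) :
    demandCoeff a [] d = if d = a then 1 else 0 := rfl

theorem demandCoeff_concat (a : Fin n → ZMod k) (l : List (ℕ × ℕ)) (u v : ℕ)
    (d : Fin n → ZMod k) : demandCoeff a (l ++ [(u, v)]) d =
      demandCoeff a l (d + unitVec n k u) - demandCoeff a l (d + unitVec n k v) := by
  simp [demandCoeff, List.foldl_append]

theorem abs_demandCoeff_le (a : Fin n → ZMod k) (l : List (ℕ × ℕ)) :
    ∀ d, |demandCoeff a l d| ≤ 2 ^ l.length := by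
  induction l using List.reverseRecOn with
  | nil => intro d; rw [demandCoeff_nil]; split <;> simp
  | append_singleton l e ih =>
    obtain ⟨u, v⟩ := e
    intro d
    rw [demandCoeff_concat]
    refine (abs_sub _ _).trans ?_
    rw [List.length_append, List.length_singleton, pow_succ]
    have := ih (d + unitVec n k u)
    have := ih (d + unitVec n k v)
    linarith

theorem unitVec_dotProduct (x : Fin n → ZMod k) (u : Fin n) : unitVec n k u ⬝ᵥ x = x u := by
  simp [unitVec, dotProduct, ← Fin.ext_iff]

/-! ### Characters of `(ZMod k) ^ n` and the uncertainty principle -/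

variable [NeZero k]

/-- The character of `(ZMod k) ^ n` belonging to the vector `c`. -/
noncomputable def dotChar (c : Fin n → ZMod k) : AddChar (Fin n → ZMod k) ℂ where
  toFun x := ZMod.stdAddChar (c ⬝ᵥ x)
  map_zero_eq_one' := by simp
  map_add_eq_mul' x y := by rw [dotProduct_add, AddChar.map_add_eq_mul]

theorem dotChar_apply (c x : Fin n → ZMod k) : dotChar c x = ZMod.stdAddChar (c ⬝ᵥ x) := rfl

theorem dotChar_comm (c x : Fin n → ZMod k) : dotChar c x = dotChar x c := by
  rw [dotChar_apply, dotChar_apply, dotProduct_comm]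

theorem dotChar_add (c d x : Fin n → ZMod k) :
    dotChar (c + d) x = dotChar c x * dotChar d x := by
  rw [dotChar_comm, AddChar.map_add_eq_mul, dotChar_comm x c, dotChar_comm x d]

theorem dotChar_eq_zero_iff (c : Fin n → ZMod k) : dotChar c = 0 ↔ c = 0 := by
  constructor
  · intro h
    ext w
    have h1 : dotChar c (Pi.single w 1) = 1 := by rw [h]; rfl
    rw [dotChar_apply, dotProduct_single_one, ← AddChar.map_zero_eq_one (ZMod.stdAddChar (N := k))] at h1
    exact ZMod.injective_stdAddChar h1
  · rintro rfl
    ext x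
    simp [dotChar_apply]

theorem sum_dotChar (c : Fin n → ZMod k) :
    ∑ x, dotChar c x = if c = 0 then (k : ℂ) ^ n else 0 := by
  classical
  rw [AddChar.sum_eq_ite]
  simp [dotChar_eq_zero_iff, Fintype.card_pi, ZMod.card]

theorem norm_dotChar (c x : Fin n → ZMod k) : ‖dotChar c x‖ = 1 :=
  AddChar.norm_apply _ _

/-- The product of the differences of the values of `x`, as roots of unity, at the pairs in `l`. -/
noncomputable def pairProd (l : List (ℕ × ℕ)) (x : Fin n → ZMod k) : ℂ :=
  (l.map fun e => dotChar (unitVec n k e.1) x - dotChar (unitVec n k e.2) x).prod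

/-- The Fourier transform turns each shift of the demand by a unit vector into multiplication by the
value of `x` at that vertex, as a root of unity. So each pair contributes one factor, a difference
of two such values. -/
theorem sum_demandCoeff_mul_dotChar (a : Fin n → ZMod k) (l : List (ℕ × ℕ)) (x : Fin n → ZMod k) :
    ∑ d, (demandCoeff a l d : ℂ) * dotChar (-d) x = dotChar (-a) x * pairProd l x := by
  induction l using List.reverseRecOn with
  | nil => simp [pairProd]
  | append_singleton l e ih =>
    obtain ⟨u, v⟩ := e
    have key : ∀ w, ∑ d, (demandCoeff a l (d + unitVec n k w) : ℂ) * dotChar (-d) x =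
        dotChar (-a) x * pairProd l x * dotChar (unitVec n k w) x := by
      intro w
      rw [← ih, Finset.sum_mul]
      refine Fintype.sum_equiv (Equiv.addRight (unitVec n k w)) _ _ fun d => ?_
      rw [Equiv.coe_addRight, mul_assoc, ← dotChar_add, neg_add, neg_add_cancel_right]
    simp only [demandCoeff_concat, Int.cast_sub, sub_mul, Finset.sum_sub_distrib, key]
    simp only [pairProd, List.map_append, List.prod_append, List.map_cons, List.map_nil,
      List.prod_cons, List.prod_nil]
    ring

/-- Orthogonality: on summing the previous identity over `x`, only the demand `0` survives. This
exhibits the count at demand `0`, as a function of `a`, as the Fourier transform of `pairProd l`. -/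
theorem demandCoeff_zero_mul (a : Fin n → ZMod k) (l : List (ℕ × ℕ)) :
    (demandCoeff a l 0 : ℂ) * k ^ n = ∑ x, dotChar (-a) x * pairProd l x := by
  simp only [← sum_demandCoeff_mul_dotChar]
  rw [Finset.sum_comm]
  simp only [← Finset.mul_sum, sum_dotChar, neg_eq_zero]
  simp

theorem demandCoeff_zero_eq_zero {l : List (ℕ × ℕ)} (h : ∀ x : Fin n → ZMod k, pairProd l x = 0)
    (a : Fin n → ZMod k) : demandCoeff a l 0 = 0 := by
  have h1 := demandCoeff_zero_mul a l
  have hk : (k : ℂ) ^ n ≠ 0 := pow_ne_zero _ (Nat.cast_ne_zero.2 (NeZero.ne k))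
  simpa [h, hk] using h1

/-- Fourier inversion; equivalently, the expansion of the product into monomials with exponents
modulo `k`. -/
theorem pairProd_eq_sum (l : List (ℕ × ℕ)) (x : Fin n → ZMod k) :
    pairProd l x = ∑ a, (demandCoeff a l 0 : ℂ) * dotChar a x := by
  have hk : (k : ℂ) ^ n ≠ 0 := pow_ne_zero _ (Nat.cast_ne_zero.2 (NeZero.ne k))
  refine mul_right_cancel₀ hk ?_
  rw [Finset.sum_mul]
  have h1 : ∀ a : Fin n → ZMod k, (demandCoeff a l 0 : ℂ) * dotChar a x * k ^ n =
      ∑ y, pairProd l y * dotChar (x - y) a := by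
    intro a
    rw [mul_right_comm, demandCoeff_zero_mul, Finset.sum_mul]
    refine Finset.sum_congr rfl fun y _ => ?_
    rw [sub_eq_add_neg, dotChar_add, dotChar_comm x a, dotChar_apply (-y) a, dotChar_apply (-a) y,
      neg_dotProduct, neg_dotProduct, dotProduct_comm y a]
    ring
  simp only [h1]
  rw [Finset.sum_comm]
  simp only [← Finset.mul_sum, sum_dotChar, sub_eq_zero]
  simp

open Classical in
/-- If few vectors `x` make the product nonzero, then many coefficients are nonzero. -/
theorem pow_le_card_mul_card {l : List (ℕ × ℕ)} {x : Fin n → ZMod k} (hx : pairProd l x ≠ 0) :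
    k ^ n ≤ (Finset.univ.filter fun a : Fin n → ZMod k => demandCoeff a l 0 ≠ 0).card *
      (Finset.univ.filter fun x : Fin n → ZMod k => pairProd l x ≠ 0).card := by
  -- Let `M` be the largest absolute value of the product, attained at `y`. Each coefficient is at
  -- most `B.card * M / k ^ n`, and `M` is at most the sum of the `A.card` nonzero coefficients in
  -- absolute value. Hence `M * k ^ n ≤ A.card * B.card * M`, and `M` cancels.
  obtain ⟨y, -, hy⟩ := Finset.exists_max_image Finset.univ
    (fun x : Fin n → ZMod k => ‖pairProd l x‖) ⟨x, Finset.mem_univ x⟩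
  set A := Finset.univ.filter fun a : Fin n → ZMod k => demandCoeff a l 0 ≠ 0 with hA
  set B := Finset.univ.filter fun x : Fin n → ZMod k => pairProd l x ≠ 0 with hB
  have hpos : 0 < ‖pairProd l y‖ := (norm_pos_iff.2 hx).trans_le (hy x (Finset.mem_univ x))
  have h1 : ∀ a : Fin n → ZMod k,
      ‖(demandCoeff a l 0 : ℂ)‖ * k ^ n ≤ B.card * ‖pairProd l y‖ := by
    intro a
    have h2 : ‖(demandCoeff a l 0 : ℂ)‖ * k ^ n = ‖(demandCoeff a l 0 : ℂ) * k ^ n‖ := by simp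
    rw [h2, demandCoeff_zero_mul, ← Finset.sum_subset (Finset.subset_univ B), ← nsmul_eq_mul]
    · refine (norm_sum_le _ _).trans (Finset.sum_le_card_nsmul _ _ _ fun z _ => ?_)
      rw [norm_mul, norm_dotChar, one_mul]
      exact hy z (Finset.mem_univ z)
    · intro z _ hz
      have : pairProd l z = 0 := by simpa [hB] using hz
      simp [this]
  have h3 : ‖pairProd l y‖ * k ^ n ≤ A.card * (B.card * ‖pairProd l y‖) := by
    have h5 : pairProd l y = ∑ a ∈ A, (demandCoeff a l 0 : ℂ) * dotChar a y := by
      rw [pairProd_eq_sum l y, ← Finset.sum_subset (Finset.subset_univ A)]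
      intro a _ ha
      have : demandCoeff a l 0 = 0 := by simpa [hA] using ha
      simp [this]
    refine (mul_le_mul_of_nonneg_right (h5 ▸ norm_sum_le _ _) (by positivity)).trans ?_
    rw [Finset.sum_mul, ← nsmul_eq_mul]
    refine Finset.sum_le_card_nsmul _ _ _ fun a _ => ?_
    rw [norm_mul, norm_dotChar, mul_one]
    exact h1 a
  have h4 : ((k ^ n : ℕ) : ℝ) ≤ ((A.card * B.card : ℕ) : ℝ) := by
    push_cast
    refine le_of_mul_le_mul_left ?_ hpos
    linarith
  exact_mod_cast h4

/-- Distinct residues give distinct roots of unity, so a factor vanishes only where the two entries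
agree. -/
theorem pairProd_ne_zero_iff {l : List (ℕ × ℕ)} {x : Fin n → ZMod k} :
    pairProd l x ≠ 0 ↔ ∀ e ∈ l, unitVec n k e.1 ⬝ᵥ x ≠ unitVec n k e.2 ⬝ᵥ x := by
  rw [pairProd, Ne, List.prod_eq_zero_iff]
  simp only [List.mem_map, not_exists, not_and, sub_eq_zero, dotChar_apply]
  refine forall₂_congr fun e _ => ?_
  rw [not_iff_not]
  exact ZMod.injective_stdAddChar.eq_iff

/-- `l` lists the edges of `G`. -/
def ListsEdges (G : SimpleGraph (Fin n)) (l : List (ℕ × ℕ)) : Prop :=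
  ∀ u v : Fin n, G.Adj u v ↔ ((u : ℕ), (v : ℕ)) ∈ l ∨ ((v : ℕ), (u : ℕ)) ∈ l

theorem pairProd_ne_zero_iff_isColoring {G : SimpleGraph (Fin n)} {l : List (ℕ × ℕ)}
    (hl : ListsEdges G l) (hn : ∀ e ∈ l, e.1 < n ∧ e.2 < n) (x : Fin n → ZMod k) :
    pairProd l x ≠ 0 ↔ ∀ u v, G.Adj u v → x u ≠ x v := by
  rw [pairProd_ne_zero_iff]
  constructor
  · intro h u v huv
    rcases (hl u v).1 huv with h1 | h1
    · simpa only [unitVec_dotProduct] using h _ h1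
    · simpa only [unitVec_dotProduct] using (h _ h1).symm
  · rintro h ⟨u, v⟩ he
    obtain ⟨hu, hv⟩ := hn _ he
    have := h ⟨u, hu⟩ ⟨v, hv⟩ ((hl _ _).2 (Or.inl he))
    rw [← unitVec_dotProduct x ⟨u, hu⟩, ← unitVec_dotProduct x ⟨v, hv⟩] at this
    exact this

/-- The reason for one-sided error: without a coloring the product is identically zero, hence so is
its Fourier transform. -/
theorem demandCoeff_eq_zero_of_not_colorable {G : SimpleGraph (Fin n)} {l : List (ℕ × ℕ)}
    (hl : ListsEdges G l) (hn : ∀ e ∈ l, e.1 < n ∧ e.2 < n) (hG : ¬ G.Colorable k)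
    (a : Fin n → ZMod k) : demandCoeff a l 0 = 0 := by
  refine demandCoeff_zero_eq_zero (fun x => ?_) a
  by_contra hx
  rw [← ne_eq, pairProd_ne_zero_iff_isColoring hl hn] at hx
  refine hG ⟨SimpleGraph.Coloring.mk (fun v => (ZMod.finEquiv k).symm (x v)) fun {u v} huv => ?_⟩
  exact fun h => hx u v huv ((ZMod.finEquiv k).symm.injective h)

-- The points where the product is nonzero inject into the proper colorings, so few colorings force
-- many nonzero coefficients.
open Classical in
theorem pow_le_card_mul_card_coloring {G : SimpleGraph (Fin n)} {l : List (ℕ × ℕ)}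
    (hl : ListsEdges G l) (hn : ∀ e ∈ l, e.1 < n ∧ e.2 < n) (hG : G.Colorable k) :
    k ^ n ≤ (Finset.univ.filter fun a : Fin n → ZMod k => demandCoeff a l 0 ≠ 0).card *
      Nat.card (G.Coloring (Fin k)) := by
  obtain ⟨c⟩ := hG
  have hx : pairProd l (fun v => ZMod.finEquiv k (c v)) ≠ 0 := by
    rw [pairProd_ne_zero_iff_isColoring hl hn]
    exact fun u v huv h => c.valid huv ((ZMod.finEquiv k).injective h)
  refine (pow_le_card_mul_card hx).trans (Nat.mul_le_mul_left _ ?_)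
  have : Finite (G.Coloring (Fin k)) :=
    Finite.of_injective (fun c : G.Coloring (Fin k) => (c : Fin n → Fin k)) DFunLike.coe_injective
  rw [← Nat.card_eq_finsetCard]
  refine Nat.card_le_card_of_injective (fun x => SimpleGraph.Coloring.mk
    (fun v => (ZMod.finEquiv k).symm (x.1 v)) fun {u v} huv h => ?_) fun x y hxy => ?_
  · have := (Finset.mem_filter.1 x.2).2
    rw [pairProd_ne_zero_iff_isColoring hl hn] at this
    exact this u v huv ((ZMod.finEquiv k).symm.injective h)
  · ext v
    have := DFunLike.congr_fun hxy v
    exact (ZMod.finEquiv k).symm.injective this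

end Coefficients

/-! ### The edges in the order of a path decomposition -/

section EdgeOrder

open Classical

variable {n p : ℕ} {G : SimpleGraph (Fin n)}

/-- `i` is the first bag that contains both ends of the edge `u v`. -/
def FirstBag (P : PathDecomposition G p) (i u v : ℕ) : Prop :=
  (∃ (hu : u < n) (hv : v < n), G.Adj ⟨u, hu⟩ ⟨v, hv⟩) ∧
    (∃ (hi : i < p) (hu : u < n), ⟨u, hu⟩ ∈ P.bag ⟨i, hi⟩) ∧
    (∃ (hi : i < p) (hv : v < n), ⟨v, hv⟩ ∈ P.bag ⟨i, hi⟩) ∧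
    ∀ j, j + 1 = i → ¬ ((∃ (hj : j < p) (hu : u < n), ⟨u, hu⟩ ∈ P.bag ⟨j, hj⟩) ∧
      ∃ (hj : j < p) (hv : v < n), ⟨v, hv⟩ ∈ P.bag ⟨j, hj⟩)

/-- If `i < j` both qualified, the interval property would put both ends into bag `j - 1`, against
the last clause for `j`. Thus comparing a bag with its predecessor suffices to treat each edge only
once; no record of treated edges is needed. -/
theorem FirstBag.eq {P : PathDecomposition G p} {i j u v : ℕ} (hi : FirstBag P i u v)
    (hj : FirstBag P j u v) : i = j := by
  have key : ∀ {i j : ℕ}, FirstBag P i u v → FirstBag P j u v → ¬ i < j := by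
    rintro i j ⟨-, ⟨hi, hu, hui⟩, ⟨_, hv, hvi⟩, -⟩ ⟨-, ⟨hj, _, huj⟩, ⟨_, _, hvj⟩, hlast⟩ hij
    refine hlast (j - 1) (by omega) ⟨⟨by omega, hu, ?_⟩, ⟨by omega, hv, ?_⟩⟩
    · exact P.mem_bag_of_between _ ⟨i, hi⟩ _ ⟨j, hj⟩ (by simp; omega) (by simp) hui huj
    · exact P.mem_bag_of_between _ ⟨i, hi⟩ _ ⟨j, hj⟩ (by simp; omega) (by simp) hvi hvj
  rcases lt_trichotomy i j with h | h | h
  · exact absurd h (key hi hj)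
  · exact h
  · exact absurd h (key hj hi)

theorem FirstBag.symm {P : PathDecomposition G p} {i u v : ℕ} (h : FirstBag P i u v) :
    FirstBag P i v u := by
  obtain ⟨⟨hu, hv, hadj⟩, h1, h2, h3⟩ := h
  exact ⟨⟨hv, hu, hadj.symm⟩, h2, h1, fun j hj hh => h3 j hj hh.symm⟩

theorem exists_firstBag (P : PathDecomposition G p) {u v : Fin n} (h : G.Adj u v) :
    ∃ i < p, FirstBag P i u v := by
  have hex : ∃ i : ℕ, ∃ hi : i < p, u ∈ P.bag ⟨i, hi⟩ ∧ v ∈ P.bag ⟨i, hi⟩ := by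
    obtain ⟨i, hi⟩ := P.exists_adj_mem_bag u v h
    exact ⟨i, i.2, hi⟩
  obtain ⟨hi, hu, hv⟩ := Nat.find_spec hex
  refine ⟨_, hi, ⟨u.2, v.2, h⟩, ⟨hi, u.2, hu⟩, ⟨hi, v.2, hv⟩, ?_⟩
  rintro j hj ⟨⟨hjp, _, h1⟩, ⟨_, _, h2⟩⟩
  exact Nat.find_min hex (m := j) (by omega) ⟨hjp, h1, h2⟩

/-- The edges from `u` to vertices below `v` whose first bag is `i`. -/
noncomputable def edgesAt (P : PathDecomposition G p) (i u v : ℕ) : List (ℕ × ℕ) :=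
  ((List.range v).filter fun y => FirstBag P i u y).map fun y => (u, y)

/-- The edges `x y`, where `y < x`, sorted by the first bag, then by `x`, then by `y`, up to the
position `(i, u, v)`. -/
noncomputable def edgesBefore (P : PathDecomposition G p) (i u v : ℕ) : List (ℕ × ℕ) :=
  (List.range i).flatMap (fun j => (List.range n).flatMap fun x => edgesAt P j x x) ++
    (List.range u).flatMap (fun x => edgesAt P i x x) ++ edgesAt P i u v

/-- All edges, in the order of the path decomposition. -/
noncomputable def edgeList (P : PathDecomposition G p) : List (ℕ × ℕ) := edgesBefore P p 0 0

variable (P : PathDecomposition G p)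

/-- This lemma and the next four follow the three nested loops of `forEdges`: the start, the
innermost step with and without an edge, and the ends of the two inner loops. -/
theorem edgesBefore_zero : edgesBefore P 0 0 0 = [] := by simp [edgesBefore, edgesAt]

theorem edgesBefore_succ_of_firstBag {i u v : ℕ} (h : FirstBag P i u v) :
    edgesBefore P i u (v + 1) = edgesBefore P i u v ++ [(u, v)] := by
  simp [edgesBefore, edgesAt, List.range_succ, List.filter_append, h]

theorem edgesBefore_succ_of_not_firstBag {i u v : ℕ} (h : ¬ FirstBag P i u v) :
    edgesBefore P i u (v + 1) = edgesBefore P i u v := by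
  simp [edgesBefore, edgesAt, List.range_succ, List.filter_append, h]

theorem edgesBefore_succ_zero (i u : ℕ) :
    edgesBefore P i (u + 1) 0 = edgesBefore P i u u := by
  simp [edgesBefore, edgesAt, List.range_succ]

theorem edgesBefore_succ_zero_zero (i : ℕ) :
    edgesBefore P (i + 1) 0 0 = edgesBefore P i n 0 := by
  simp [edgesBefore, edgesAt, List.range_succ]

theorem mem_edgesBefore {i u v x y : ℕ} : (x, y) ∈ edgesBefore P i u v ↔
    ∃ j, FirstBag P j x y ∧ (j < i ∧ y < x ∨ j = i ∧ (x < u ∧ y < x ∨ x = u ∧ y < v)) := by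
  simp only [edgesBefore, edgesAt, List.mem_append, List.mem_flatMap, List.mem_range,
    List.mem_map, List.mem_filter, decide_eq_true_eq, Prod.mk.injEq]
  constructor
  · rintro ((⟨j, hj, x', hx', y', ⟨hy', hf⟩, rfl, rfl⟩ | ⟨x', hx', y', ⟨hy', hf⟩, rfl, rfl⟩) |
      ⟨y', ⟨hy', hf⟩, rfl, rfl⟩)
    · exact ⟨j, hf, Or.inl ⟨hj, hy'⟩⟩
    · exact ⟨i, hf, Or.inr ⟨rfl, Or.inl ⟨hx', hy'⟩⟩⟩
    · exact ⟨i, hf, Or.inr ⟨rfl, Or.inr ⟨rfl, hy'⟩⟩⟩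
  · rintro ⟨j, hf, ⟨hj, hy⟩ | ⟨rfl, ⟨hx, hy⟩ | ⟨rfl, hy⟩⟩⟩
    · obtain ⟨⟨hx, -⟩, -⟩ := id hf
      exact Or.inl (Or.inl ⟨j, hj, x, hx, y, ⟨hy, hf⟩, rfl, rfl⟩)
    · exact Or.inl (Or.inr ⟨x, hx, y, ⟨hy, hf⟩, rfl, rfl⟩)
    · exact Or.inr ⟨y, ⟨hy, hf⟩, rfl, rfl⟩

theorem nodup_edgesAt (i u v : ℕ) : (edgesAt P i u v).Nodup :=
  (List.nodup_range.filter _).map fun _ _ h => (Prod.mk.inj h).2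

/-- Blocks of different bags are disjoint because the first bag is unique; within one bag, blocks
differ in the first entry of the pair. -/
theorem nodup_edgesBefore (i u v : ℕ) : (edgesBefore P i u v).Nodup := by
  have hmem : ∀ {i u v x y}, (x, y) ∈ edgesAt P i u v → x = u ∧ FirstBag P i x y := by
    intro i u v x y h
    simp only [edgesAt, List.mem_map, List.mem_filter, decide_eq_true_eq, Prod.mk.injEq] at h
    obtain ⟨y', ⟨-, h⟩, rfl, rfl⟩ := h
    exact ⟨rfl, h⟩
  have hrow : ∀ i u, ((List.range u).flatMap fun x => edgesAt P i x x).Nodup := by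
    intro i u
    refine List.nodup_flatMap.2 ⟨fun x _ => nodup_edgesAt P i x x, ?_⟩
    refine List.nodup_range.imp fun {x y} hxy => ?_
    rintro ⟨x', y'⟩ h1 h2
    exact hxy ((hmem h1).1.symm.trans (hmem h2).1)
  have hmem' : ∀ {i u x y}, (x, y) ∈ (List.range u).flatMap (fun x => edgesAt P i x x) →
      x < u ∧ FirstBag P i x y := by
    intro i u x y h
    obtain ⟨x', hx', h⟩ := List.mem_flatMap.1 h
    obtain ⟨rfl, hf⟩ := hmem h
    exact ⟨List.mem_range.1 hx', hf⟩
  refine List.nodup_append'.2 ⟨List.nodup_append'.2 ⟨?_, hrow i u, ?_⟩, nodup_edgesAt P i u v, ?_⟩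
  · refine List.nodup_flatMap.2 ⟨fun j _ => hrow j n, ?_⟩
    refine List.nodup_range.imp fun {x y} hxy => ?_
    rintro ⟨x', y'⟩ h1 h2
    exact hxy ((hmem' h1).2.eq (hmem' h2).2)
  · rintro ⟨x, y⟩ h1 h2
    obtain ⟨j, hj, h1⟩ := List.mem_flatMap.1 h1
    exact absurd ((hmem' h1).2.eq (hmem' h2).2) (List.mem_range.1 hj).ne
  · rintro ⟨x, y⟩ h1 h2
    obtain ⟨rfl, hf⟩ := hmem h2
    rcases List.mem_append.1 h1 with h1 | h1
    · obtain ⟨j, hj, h1⟩ := List.mem_flatMap.1 h1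
      exact absurd ((hmem' h1).2.eq hf) (List.mem_range.1 hj).ne
    · exact absurd (hmem' h1).1 (lt_irrefl _)

theorem nodup_edgeList : (edgeList P).Nodup := nodup_edgesBefore P p 0 0

theorem mem_edgeList {x y : ℕ} : (x, y) ∈ edgeList P ↔ ∃ j, FirstBag P j x y ∧ y < x := by
  rw [edgeList, mem_edgesBefore]
  constructor
  · rintro ⟨j, hf, ⟨-, h⟩ | ⟨-, ⟨h, -⟩ | ⟨-, h⟩⟩⟩
    · exact ⟨j, hf, h⟩
    · omega
    · omega
  · rintro ⟨j, hf, h⟩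
    obtain ⟨-, ⟨hj, -⟩, -⟩ := id hf
    exact ⟨j, hf, Or.inl ⟨hj, h⟩⟩

theorem lt_of_mem_edgeList : ∀ e ∈ edgeList P, e.1 < n ∧ e.2 < n := by
  rintro ⟨x, y⟩ h
  obtain ⟨j, ⟨⟨hx, hy, -⟩, -⟩, -⟩ := (mem_edgeList P).1 h
  exact ⟨hx, hy⟩

theorem listsEdges_edgeList : ListsEdges G (edgeList P) := by
  intro u v
  simp only [mem_edgeList]
  constructor
  · intro h
    obtain ⟨i, hi, hf⟩ := exists_firstBag P h
    rcases lt_or_gt_of_ne (fun h' : (u : ℕ) = v => h.ne (Fin.ext h')) with huv | huv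
    · exact Or.inr ⟨i, hf.symm, huv⟩
    · exact Or.inl ⟨i, hf, huv⟩
  · rintro (⟨j, ⟨⟨_, _, h⟩, -⟩, -⟩ | ⟨j, ⟨⟨_, _, h⟩, -⟩, -⟩)
    · exact h
    · exact h.symm

theorem edgesBefore_subset {i u v : ℕ} (hv : v ≤ u) :
    edgesBefore P i u v ⊆ edgeList P := by
  rintro ⟨x, y⟩ h
  obtain ⟨j, hf, h⟩ := (mem_edgesBefore P).1 h
  exact (mem_edgeList P).2 ⟨j, hf, by omega⟩

theorem length_edgeList_le : (edgeList P).length ≤ n * n := by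
  rw [← List.toFinset_card_of_nodup (nodup_edgeList P)]
  have : (edgeList P).toFinset ⊆ Finset.range n ×ˢ Finset.range n := by
    intro e he
    have := lt_of_mem_edgeList P e (List.mem_toFinset.1 he)
    simpa using this
  simpa using Finset.card_le_card this

theorem length_edgesBefore_le {i u v : ℕ} (hv : v ≤ u) :
    (edgesBefore P i u v).length ≤ (edgeList P).length :=
  (List.subperm_of_subset (nodup_edgesBefore P i u v) (edgesBefore_subset P hv)).length_le

/-- The number of pairs in `l` that contain `w`. -/
def incidences (l : List (ℕ × ℕ)) (w : ℕ) : ℕ := l.countP fun e => e.1 = w ∨ e.2 = w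

@[simp] theorem incidences_nil (w : ℕ) : incidences [] w = 0 := rfl

theorem incidences_concat (l : List (ℕ × ℕ)) (u v w : ℕ) :
    incidences (l ++ [(u, v)]) w = incidences l w + if u = w ∨ v = w then 1 else 0 := by
  simp [incidences, List.countP_append, List.countP_singleton]

theorem incidences_edgesBefore_le {i u v : ℕ} (hv : v ≤ u) (w : ℕ) :
    incidences (edgesBefore P i u v) w ≤ incidences (edgeList P) w :=
  (List.subperm_of_subset (nodup_edgesBefore P i u v) (edgesBefore_subset P hv)).countP_le _

/-- Send a listed edge at `w` to its other end. Since pairs are listed with the larger end first, an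
edge does not occur in both orders and the map is injective. -/
theorem incidences_edgeList_le_degree [DecidableRel G.Adj] (w : Fin n) :
    incidences (edgeList P) w ≤ G.degree w := by
  rw [incidences, List.countP_eq_length_filter, ← G.card_neighborFinset_eq_degree,
    ← List.toFinset_card_of_nodup ((nodup_edgeList P).filter _),
    ← Finset.card_map Fin.valEmbedding]
  refine Finset.card_le_card_of_injOn (fun e => if e.1 = w then e.2 else e.1) ?_ ?_
  · rintro ⟨x, y⟩ h
    simp only [List.coe_toFinset, List.mem_filter, Set.mem_ofPred_eq, decide_eq_true_eq] at h
    obtain ⟨h, hw⟩ := h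
    obtain ⟨j, ⟨⟨hx, hy, hadj⟩, -⟩, hlt⟩ := (mem_edgeList P).1 h
    simp only [Finset.coe_map, Set.mem_image, Finset.mem_coe, SimpleGraph.mem_neighborFinset]
    by_cases hxw : x = w
    · refine ⟨⟨y, hy⟩, ?_, by simp [hxw]⟩
      have : w = ⟨x, hx⟩ := Fin.ext hxw.symm
      exact this ▸ hadj
    · refine ⟨⟨x, hx⟩, ?_, by simp [hxw]⟩
      have : w = ⟨y, hy⟩ := Fin.ext (hw.resolve_left hxw).symm
      exact this ▸ hadj.symm
  · rintro ⟨x, y⟩ h ⟨x', y'⟩ h' heq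
    simp only [List.coe_toFinset, List.mem_filter, Set.mem_ofPred_eq, decide_eq_true_eq] at h h'
    obtain ⟨-, -, hlt⟩ := (mem_edgeList P).1 h.1
    obtain ⟨-, -, hlt'⟩ := (mem_edgeList P).1 h'.1
    have h2 := h.2
    have h2' := h'.2
    simp only at heq
    simp only [Prod.mk.injEq]
    split_ifs at heq <;> omega

/-- A vertex with edges before and edges after position `(i, u, v)` lies in bag `i`. -/
theorem mem_bag_of_incidences {i u v : ℕ} (hi : i < p) (w : Fin n)
    (h0 : 0 < incidences (edgesBefore P i u v) w)
    (h1 : incidences (edgesBefore P i u v) w < incidences (edgeList P) w) :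
    w ∈ P.bag ⟨i, hi⟩ := by
  have hbag : ∀ {x y j : ℕ}, FirstBag P j x y → (x = w ∨ y = w) →
      ∃ hj : j < p, w ∈ P.bag ⟨j, hj⟩ := by
    rintro x y j ⟨-, ⟨hj, hx, hxj⟩, ⟨_, hy, hyj⟩, -⟩ (h | h)
    · exact ⟨hj, by rwa [show (⟨x, hx⟩ : Fin n) = w from Fin.ext h] at hxj⟩
    · exact ⟨hj, by rwa [show (⟨y, hy⟩ : Fin n) = w from Fin.ext h] at hyj⟩
  obtain ⟨⟨x, y⟩, hxy, hw⟩ := List.countP_pos_iff.1 h0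
  simp only [decide_eq_true_eq] at hw
  obtain ⟨j, hf, hj⟩ := (mem_edgesBefore P).1 hxy
  obtain ⟨hjp, hwj⟩ := hbag hf hw
  -- By counting, some edge at `w` is still to come. Its first bag has index at least `i`, while
  -- that of an edge already seen is at most `i`; the interval property does the rest.
  have : ∃ e ∈ edgeList P, (e.1 = (w : ℕ) ∨ e.2 = (w : ℕ)) ∧ e ∉ edgesBefore P i u v := by
    by_contra! hcon
    have hsub : (edgeList P).filter (fun e => e.1 = (w : ℕ) ∨ e.2 = (w : ℕ)) ⊆
        (edgesBefore P i u v).filter (fun e => e.1 = (w : ℕ) ∨ e.2 = (w : ℕ)) := by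
      intro e he
      simp only [List.mem_filter, decide_eq_true_eq] at he ⊢
      exact ⟨hcon e he.1 he.2, he.2⟩
    have := (List.subperm_of_subset ((nodup_edgeList P).filter _) hsub).length_le
    rw [← List.countP_eq_length_filter, ← List.countP_eq_length_filter] at this
    exact absurd h1 (not_lt.2 this)
  obtain ⟨⟨x', y'⟩, he, hw', hnot⟩ := this
  obtain ⟨j', hf', hlt⟩ := (mem_edgeList P).1 he
  obtain ⟨hjp', hwj'⟩ := hbag hf' hw'
  rw [mem_edgesBefore] at hnot
  push Not at hnot
  have := (hnot j' hf').1
  refine P.mem_bag_of_between w ⟨j, hjp⟩ _ ⟨j', hjp'⟩ ?_ ?_ hwj hwj'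
  · simp only [Fin.mk_le_mk]; omega
  · simp only [Fin.mk_le_mk]
    by_contra hcon
    have := this (by omega)
    omega

variable {k : ℕ}

/-- The demands that can be reached from `a` by the pairs in `l` and from which the demand `0` may
be reached by the remaining edges, as far as single vertices are concerned. -/
noncomputable def demandBox (a : Fin n → ZMod k) (l : List (ℕ × ℕ)) :
    Set (Fin n → ZMod k) :=
  {d | ∀ w : Fin n, (d w).val ≤ incidences (edgeList P) w - incidences l w ∧
    ∃ c ≤ incidences l w, d w = a w - (c : ℕ)}

/-- The box is a product of sets `A w`. The two conditions bound the size of `A w` by one more than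
the remaining and by one more than the used edges at `w`. The smaller of these two numbers of edges
is at most half the degree, and it is zero unless `w` lies in bag `i`. -/
theorem length_le_of_subset_demandBox [NeZero k] [DecidableRel G.Adj] {i u v : ℕ} (hi : i < p)
    (a : Fin n → ZMod k) {L : List (Fin n → ZMod k)} (hL : L.Nodup)
    (hsub : ∀ d ∈ L, d ∈ demandBox P a (edgesBefore P i u v)) :
    L.length ≤ (G.maxDegree / 2 + 1) ^ (P.width + 1) := by
  set l := edgesBefore P i u v with hl
  set A : Fin n → Finset (ZMod k) := fun w =>
    Finset.univ.filter fun x => x.val ≤ incidences (edgeList P) w - incidences l w ∧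
      ∃ c ≤ incidences l w, x = a w - (c : ℕ) with hA
  have h1 : L.toFinset ⊆ Fintype.piFinset A := by
    intro d hd
    rw [Fintype.mem_piFinset]
    intro w
    rw [hA, Finset.mem_filter]
    exact ⟨Finset.mem_univ _, hsub d (List.mem_toFinset.1 hd) w⟩
  have hcard1 : ∀ w, (A w).card ≤ incidences (edgeList P) w - incidences l w + 1 := by
    intro w
    rw [← Finset.card_range (_ + 1)]
    refine Finset.card_le_card_of_injOn ZMod.val (fun x hx => ?_)
      ((ZMod.val_injective k).injOn)
    have := (Finset.mem_filter.1 hx).2.1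
    simp only [Finset.coe_range, Set.mem_Iio]
    omega
  have hcard2 : ∀ w, (A w).card ≤ incidences l w + 1 := by
    intro w
    have : A w ⊆ (Finset.range (incidences l w + 1)).image fun c : ℕ => a w - (c : ZMod k) := by
      intro x hx
      obtain ⟨c, hc, rfl⟩ := (Finset.mem_filter.1 hx).2.2
      exact Finset.mem_image_of_mem _ (Finset.mem_range.2 (by omega))
    refine (Finset.card_le_card this).trans (Finset.card_image_le.trans ?_)
    rw [Finset.card_range]
  have hcard : ∀ w, (A w).card ≤ if w ∈ P.bag ⟨i, hi⟩ then G.maxDegree / 2 + 1 else 1 := by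
    intro w
    have h3 := hcard1 w
    have h4 := hcard2 w
    split_ifs with hw
    · have h5 := incidences_edgeList_le_degree P w
      have h6 := G.degree_le_maxDegree w
      omega
    · have h5 : ¬ (0 < incidences l w ∧ incidences l w < incidences (edgeList P) w) :=
        fun h => hw (mem_bag_of_incidences P hi w h.1 h.2)
      omega
  rw [← List.toFinset_card_of_nodup hL]
  refine (Finset.card_le_card h1).trans ?_
  rw [Fintype.card_piFinset]
  refine (Finset.prod_le_prod' fun w _ => hcard w).trans ?_
  rw [Finset.prod_ite, Finset.prod_const, Finset.prod_const, one_pow, mul_one]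
  refine Nat.pow_le_pow_right (by omega) ?_
  have : (P.bag ⟨i, hi⟩).card ≤ Finset.univ.sup fun i => (P.bag i).card :=
    Finset.le_sup (f := fun i => (P.bag i).card) (Finset.mem_univ (⟨i, hi⟩ : Fin p))
  -- The truncated subtraction in the width is harmless: `width + 1` is at least the size of every
  -- bag.
  rw [PathDecomposition.width]
  have hfilter : (Finset.univ.filter fun w => w ∈ P.bag ⟨i, hi⟩) = P.bag ⟨i, hi⟩ := by
    ext w
    simp
  rw [hfilter]
  omega

end EdgeOrder

/-! ### Layers of the dynamic program -/

section Layers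

variable {n k : ℕ}

/-- Add `z` to the entry at `d` of a table with the given keys and values, unless the demand `d`
exceeds `R` somewhere. -/
def insertEntry (R : Fin n → ℕ) (T : List (Fin n → ZMod k) × ((Fin n → ZMod k) → ℤ))
    (d : Fin n → ZMod k) (z : ℤ) : List (Fin n → ZMod k) × ((Fin n → ZMod k) → ℤ) :=
  if ∀ w, (d w).val ≤ R w then
    (if d ∈ T.1 then T.1 else T.1 ++ [d], Function.update T.2 d (T.2 d + z))
  else T

theorem insertEntry_snd (R : Fin n → ℕ) (T : List (Fin n → ZMod k) × ((Fin n → ZMod k) → ℤ))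
    (d : Fin n → ZMod k) (z : ℤ) (x : Fin n → ZMod k) :
    (insertEntry R T d z).2 x =
      T.2 x + if x = d ∧ ∀ w, (x w).val ≤ R w then z else 0 := by
  unfold insertEntry
  by_cases hx : x = d
  · subst hx
    split_ifs <;> simp_all
  · split_ifs <;> simp_all

theorem mem_insertEntry (R : Fin n → ℕ) (T : List (Fin n → ZMod k) × ((Fin n → ZMod k) → ℤ))
    (d : Fin n → ZMod k) (z : ℤ) (x : Fin n → ZMod k) :
    x ∈ (insertEntry R T d z).1 ↔ x ∈ T.1 ∨ x = d ∧ ∀ w, (x w).val ≤ R w := by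
  unfold insertEntry
  by_cases hx : x = d
  · subst hx
    split_ifs <;> simp_all
  · split_ifs <;> simp_all

/-- The keys of a table are distinct, and the values elsewhere are zero. -/
structure IsTable (T : List (Fin n → ZMod k) × ((Fin n → ZMod k) → ℤ)) : Prop where
  nodup : T.1.Nodup
  eq_zero : ∀ d, d ∉ T.1 → T.2 d = 0

theorem length_insertEntry_le (R : Fin n → ℕ)
    (T : List (Fin n → ZMod k) × ((Fin n → ZMod k) → ℤ)) (d : Fin n → ZMod k) (z : ℤ) :
    (insertEntry R T d z).1.length ≤ T.1.length + 1 := by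
  unfold insertEntry
  split_ifs <;> simp

theorem isTable_empty : IsTable (([], fun _ => 0) :
    List (Fin n → ZMod k) × ((Fin n → ZMod k) → ℤ)) :=
  ⟨List.nodup_nil, fun _ _ => rfl⟩

theorem IsTable.insertEntry {R : Fin n → ℕ}
    {T : List (Fin n → ZMod k) × ((Fin n → ZMod k) → ℤ)} (h : IsTable T)
    (d : Fin n → ZMod k) (z : ℤ) : IsTable (insertEntry R T d z) := by
  refine ⟨?_, fun x hx => ?_⟩
  · unfold _root_.insertEntry
    split_ifs with h1 h2
    · exact h.nodup
    · exact List.nodup_append'.2 ⟨h.nodup, List.nodup_singleton d, by simpa using h2⟩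
    · exact h.nodup
  · rw [mem_insertEntry, not_or] at hx
    rw [insertEntry_snd, if_neg hx.2, h.eq_zero x hx.1, add_zero]

/-- Pass the value `z` at `d` to the two demands that result from orienting the edge `u v`. -/
def expandEntry (R : Fin n → ℕ) (u v : ℕ) (T : List (Fin n → ZMod k) × ((Fin n → ZMod k) → ℤ))
    (d : Fin n → ZMod k) (z : ℤ) : List (Fin n → ZMod k) × ((Fin n → ZMod k) → ℤ) :=
  insertEntry R (insertEntry R T (d - unitVec n k u) z) (d - unitVec n k v) (-z)

/-- The table that results from the entries of `T` at the keys in `L` by orienting the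
edge `u v`. -/
def expandKeys (R : Fin n → ℕ) (u v : ℕ) (f : (Fin n → ZMod k) → ℤ) (L : List (Fin n → ZMod k)) :
    List (Fin n → ZMod k) × ((Fin n → ZMod k) → ℤ) :=
  L.foldl (fun T d => expandEntry R u v T d (f d)) ([], fun _ => 0)

theorem expandKeys_concat (R : Fin n → ℕ) (u v : ℕ) (f : (Fin n → ZMod k) → ℤ)
    (L : List (Fin n → ZMod k)) (d : Fin n → ZMod k) :
    expandKeys R u v f (L ++ [d]) = expandEntry R u v (expandKeys R u v f L) d (f d) := by
  simp [expandKeys, List.foldl_append]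

theorem isTable_expandKeys (R : Fin n → ℕ) (u v : ℕ) (f : (Fin n → ZMod k) → ℤ)
    (L : List (Fin n → ZMod k)) : IsTable (expandKeys R u v f L) := by
  induction L using List.reverseRecOn with
  | nil => exact isTable_empty
  | append_singleton L d ih =>
    rw [expandKeys_concat]
    exact (ih.insertEntry _ _).insertEntry _ _

/-- Values are pushed forward from each key, whereas `demandCoeff` pulls them back. The two agree
because the keys are distinct, so that each old entry is passed on once. -/
theorem expandKeys_snd (R : Fin n → ℕ) (u v : ℕ) (f : (Fin n → ZMod k) → ℤ)
    {L : List (Fin n → ZMod k)} (hL : L.Nodup) (x : Fin n → ZMod k) :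
    (expandKeys R u v f L).2 x = if ∀ w, (x w).val ≤ R w then
      (if x + unitVec n k u ∈ L then f (x + unitVec n k u) else 0) -
        (if x + unitVec n k v ∈ L then f (x + unitVec n k v) else 0) else 0 := by
  induction L using List.reverseRecOn with
  | nil => simp [expandKeys]
  | append_singleton L d ih =>
    obtain ⟨hL, -, hd⟩ := List.nodup_append'.1 hL
    have hd : d ∉ L := by simpa using hd
    rw [expandKeys_concat, expandEntry, insertEntry_snd, insertEntry_snd, ih hL]
    simp only [eq_sub_iff_add_eq, List.mem_append, List.mem_singleton]
    have key : ∀ y, (if y ∈ L ∨ y = d then f y else 0) =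
        (if y ∈ L then f y else 0) + if y = d then f d else 0 := by
      intro y
      by_cases hy : y = d
      · subst hy
        simp [hd]
      · simp [hy]
    rw [key, key]
    by_cases hx : ∀ w, (x w).val ≤ R w
    · simp only [hx, implies_true, and_true, if_true]
      split_ifs <;> ring
    · simp [hx]

theorem mem_expandKeys {R : Fin n → ℕ} {u v : ℕ} {f : (Fin n → ZMod k) → ℤ}
    {L : List (Fin n → ZMod k)} {x : Fin n → ZMod k} (hx : x ∈ (expandKeys R u v f L).1) :
    (∀ w, (x w).val ≤ R w) ∧ (x + unitVec n k u ∈ L ∨ x + unitVec n k v ∈ L) := by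
  induction L using List.reverseRecOn with
  | nil => simp [expandKeys] at hx
  | append_singleton L d ih =>
    rw [expandKeys_concat, expandEntry, mem_insertEntry, mem_insertEntry] at hx
    rcases hx with (hx | hx) | hx
    · obtain ⟨h1, h2⟩ := ih hx
      exact ⟨h1, by rw [List.mem_append, List.mem_append]; tauto⟩
    · exact ⟨hx.2, Or.inl (by simp [hx.1])⟩
    · exact ⟨hx.2, Or.inr (by simp [hx.1])⟩

variable {p : ℕ} {G : SimpleGraph (Fin n)}

/-- The number of edges at `w` that are not in `l`. -/
noncomputable def remaining (P : PathDecomposition G p) (l : List (ℕ × ℕ)) (w : Fin n) : ℕ :=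
  incidences (edgeList P) w - incidences l w

/-- The table `T` is the table of the dynamic program after the edges in `l`. -/
structure IsLayer (P : PathDecomposition G p) (a : Fin n → ZMod k) (l : List (ℕ × ℕ))
    (T : List (Fin n → ZMod k) × ((Fin n → ZMod k) → ℤ)) : Prop extends IsTable T where
  snd_eq : ∀ d, T.2 d = if ∀ w, (d w).val ≤ remaining P l w then demandCoeff a l d else 0
  subset : ∀ d ∈ T.1, d ∈ demandBox P a l

theorem isLayer_nil (P : PathDecomposition G p) (a : Fin n → ZMod k) :
    IsLayer P a [] (insertEntry (remaining P []) ([], fun _ => 0) a 1) := by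
  refine ⟨isTable_empty.insertEntry _ _, fun d => ?_, fun d hd => ?_⟩
  · rw [insertEntry_snd, demandCoeff_nil]
    by_cases hd : ∀ w, (d w).val ≤ remaining P [] w <;> simp [hd]
  · rw [mem_insertEntry] at hd
    rcases hd with hd | ⟨rfl, hd⟩
    · simp at hd
    · exact fun w => ⟨hd w, 0, by simp⟩

theorem abs_layer_le {P : PathDecomposition G p} {a : Fin n → ZMod k} {l : List (ℕ × ℕ)}
    {T : List (Fin n → ZMod k) × ((Fin n → ZMod k) → ℤ)} (hT : IsLayer P a l T)
    (d : Fin n → ZMod k) : |T.2 d| ≤ 2 ^ l.length := by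
  rw [hT.snd_eq]
  split_ifs
  · exact abs_demandCoeff_le a l d
  · simp

/-- `L` may be an initial part of the keys: the machine stores such half-finished tables, and their
values have to fit into memory as well. -/
theorem abs_expandKeys_le {P : PathDecomposition G p} {a : Fin n → ZMod k} {l : List (ℕ × ℕ)}
    {T : List (Fin n → ZMod k) × ((Fin n → ZMod k) → ℤ)} (hT : IsLayer P a l T)
    (R : Fin n → ℕ) (u v : ℕ) {L : List (Fin n → ZMod k)} (hL : L.Nodup) (x : Fin n → ZMod k) :
    |(expandKeys R u v T.2 L).2 x| ≤ 2 * 2 ^ l.length := by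
  have key : ∀ y, |if y ∈ L then T.2 y else 0| ≤ 2 ^ l.length := by
    intro y
    split_ifs
    · exact abs_layer_le hT y
    · simp
  rw [expandKeys_snd R u v T.2 hL]
  by_cases hx : ∀ w, (x w).val ≤ R w
  · rw [if_pos hx, two_mul]
    exact (abs_sub _ _).trans (add_le_add (key _) (key _))
  · simp [hx]

theorem mem_demandBox_sub {P : PathDecomposition G p} {a : Fin n → ZMod k} {l : List (ℕ × ℕ)}
    {u v : ℕ} {d : Fin n → ZMod k} (hd : d ∈ demandBox P a l) {x : ℕ} (hx : x = u ∨ x = v)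
    (hlive : ∀ w, ((d - unitVec n k x) w).val ≤ remaining P (l ++ [(u, v)]) w) :
    d - unitVec n k x ∈ demandBox P a (l ++ [(u, v)]) := by
  intro w
  refine ⟨hlive w, ?_⟩
  obtain ⟨-, c, hc, hdw⟩ := hd w
  rw [incidences_concat]
  by_cases hwx : (w : ℕ) = x
  · refine ⟨c + 1, ?_, ?_⟩
    · rw [if_pos (by omega)]
      omega
    · simp [unitVec, hwx, hdw]
      ring
  · exact ⟨c, by omega, by simp [unitVec, hwx, hdw]⟩

/-- After all edges only the demand `0` is left. -/
theorem IsLayer.eq_zero_of_mem {P : PathDecomposition G p} {a : Fin n → ZMod k}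
    {T : List (Fin n → ZMod k) × ((Fin n → ZMod k) → ℤ)} (hT : IsLayer P a (edgeList P) T)
    {d : Fin n → ZMod k} (hd : d ∈ T.1) : d = 0 := by
  ext w
  have := (hT.subset d hd w).1
  rw [Nat.sub_self, Nat.le_zero, ZMod.val_eq_zero] at this
  exact this

theorem IsLayer.snd_zero {P : PathDecomposition G p} {a : Fin n → ZMod k} {l : List (ℕ × ℕ)}
    {T : List (Fin n → ZMod k) × ((Fin n → ZMod k) → ℤ)} (hT : IsLayer P a l T) :
    T.2 0 = demandCoeff a l 0 := by
  rw [hT.snd_eq, if_pos]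
  simp

theorem IsLayer.mem_demandBox_of_mem_expandKeys {P : PathDecomposition G p} {a : Fin n → ZMod k}
    {l : List (ℕ × ℕ)} {T : List (Fin n → ZMod k) × ((Fin n → ZMod k) → ℤ)} (hT : IsLayer P a l T)
    {u v : ℕ} {L : List (Fin n → ZMod k)} (hL : L ⊆ T.1) {d : Fin n → ZMod k}
    (hd : d ∈ (expandKeys (remaining P (l ++ [(u, v)])) u v T.2 L).1) :
    d ∈ demandBox P a (l ++ [(u, v)]) := by
  obtain ⟨h1, h2⟩ := mem_expandKeys hd
  rcases h2 with h2 | h2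
  · have h3 := mem_demandBox_sub (u := u) (v := v) (hT.subset _ (hL h2)) (Or.inl rfl)
    rw [add_sub_cancel_right] at h3
    exact h3 h1
  · have h3 := mem_demandBox_sub (u := u) (v := v) (hT.subset _ (hL h2)) (Or.inr rfl)
    rw [add_sub_cancel_right] at h3
    exact h3 h1

/-- Pruning loses nothing. If a demand is small enough after the edge `u v`, then so are both
demands it may come from: they exceed it by at most one at an end of the edge, where one more edge
remained. So the discarded entries would only have contributed to demands that are discarded too. -/
theorem IsLayer.concat {P : PathDecomposition G p} {a : Fin n → ZMod k} {l : List (ℕ × ℕ)}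
    {T : List (Fin n → ZMod k) × ((Fin n → ZMod k) → ℤ)} (hT : IsLayer P a l T) {u v : ℕ}
    (hl : ∀ w, incidences (l ++ [(u, v)]) w ≤ incidences (edgeList P) w) :
    IsLayer P a (l ++ [(u, v)]) (expandKeys (remaining P (l ++ [(u, v)])) u v T.2 T.1) := by
  refine ⟨isTable_expandKeys _ _ _ _ _, fun d => ?_, fun d hd => ?_⟩
  · rw [expandKeys_snd _ _ _ _ hT.nodup]
    refine if_ctx_congr Iff.rfl (fun hd => ?_) fun _ => rfl
    have key : ∀ x, (x = u ∨ x = v) → (if d + unitVec n k x ∈ T.1 then T.2 (d + unitVec n k x)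
        else 0) = demandCoeff a l (d + unitVec n k x) := by
      intro x hx
      have hlive : ∀ w, ((d + unitVec n k x) w).val ≤ remaining P l w := by
        intro w
        refine (ZMod.val_add_le _ _).trans ?_
        have h1 := hd w
        have h2 := hl w
        rw [remaining, incidences_concat] at h1
        rw [incidences_concat] at h2
        rw [remaining]
        by_cases hwx : (w : ℕ) = x
        · have h3 : (1 : ZMod k).val ≤ 1 := by
            rw [ZMod.val_one_eq_one_mod]
            exact Nat.mod_le _ _
          rw [if_pos (by omega)] at h1 h2
          have h5 : (unitVec n k x w).val ≤ 1 := by rwa [unitVec, if_pos hwx]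
          omega
        · have h5 : (unitVec n k x w).val = 0 := by rw [unitVec, if_neg hwx, ZMod.val_zero]
          omega
      have h4 := hT.snd_eq (d + unitVec n k x)
      rw [if_pos hlive] at h4
      rw [← h4]
      split_ifs with h5
      · rfl
      · exact (hT.eq_zero _ h5).symm
    rw [key u (Or.inl rfl), key v (Or.inr rfl), demandCoeff_concat]
  · exact hT.mem_demandBox_of_mem_expandKeys (fun _ h => h) hd

end Layers

/-! ### Insertion of an entry into the current layer -/

namespace RandomizedRAM

/-- The address of entry `w` of row `r`, for rows of length `n`. -/
def Expr.cell (r w : Expr) : Expr := .add (.mul r (.reg 0)) w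

/-- Test whether the demand in the row behind the last entry is at most the number of remaining
edges everywhere, and compute its code. -/
def checkRow : Program :=
  .seq (.assign 14 (.lit 1)) <| .seq (.assign 15 (.reg 5)) <| .forLess 13 0 <|
    .seq (.assign 17 (.get 3 (.cell (.reg 4) (.reg 13)))) <|
    .seq (.ite (.sub (.reg 17) (.get 2 (.reg 13))) (.assign 14 (.lit 0)) .skip) <|
    .assign 15 (.add (.mul (.reg 15) (.reg 2)) (.reg 17))

/-- Add the value in register `16` at the demand in the row behind the last entry, if this demand
has passed the test. -/
def addEntry : Program :=
  .ite (.reg 14)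
    (.seq (.assign 17 (.get 5 (.reg 15))) <| .ite (.reg 17)
      (.store 4 (.sub (.reg 17) (.lit 1)) (.add (.get 4 (.sub (.reg 17) (.lit 1))) (.reg 16)))
      (.seq (.store 4 (.reg 4) (.reg 16)) <| .seq (.assign 4 (.add (.reg 4) (.lit 1))) <|
        .store 5 (.reg 15) (.reg 4)))
    .skip

/-- Memory layout: array `2` counts the remaining edges at each vertex, array `3` holds the demands
row by row, array `4` the value of each row, and array `5` maps the code of a demand to its row
number plus one, so that `0` means absent. Register `4` is the first free row, where a candidate
demand is prepared; it becomes an entry only if register `4` is advanced. Register `5` is the number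
of the current step, the leading part of the codes. -/
def insertRow : Program := .seq checkRow addEntry

section

variable {n k : ℕ}

/-- The entry of `d` at `w`, as an integer. -/
def digit (d : Fin n → ZMod k) (w : ℕ) : ℤ := if h : w < n then ((d ⟨w, h⟩).val : ℤ) else 0

theorem digit_fin (d : Fin n → ZMod k) (w : Fin n) : digit d w = (d w).val := by
  simp [digit]

theorem digit_nonneg (d : Fin n → ZMod k) (w : ℕ) : 0 ≤ digit d w := by
  unfold digit
  split <;> simp

theorem digit_lt [NeZero k] (d : Fin n → ZMod k) (w : ℕ) : digit d w < k := by
  unfold digit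
  split
  · exact_mod_cast ZMod.val_lt _
  · exact_mod_cast Nat.pos_of_ne_zero (NeZero.ne k)

/-- The number with the digits `d 0, d 1, …` to base `k` after the leading part `g`. -/
def encode (g : ℕ) (d : Fin n → ZMod k) : ℕ → ℤ
  | 0 => g
  | w + 1 => encode g d w * k + digit d w

theorem encode_nonneg (g : ℕ) (d : Fin n → ZMod k) (w : ℕ) : 0 ≤ encode g d w := by
  induction w with
  | zero => simp [encode]
  | succ w ih =>
    have := digit_nonneg d w
    rw [encode]
    positivity

/-- Together with `le_encode`: the codes of step `g` lie between `g * k ^ n` and `(g + 1) * k ^ n`,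
so different steps never collide in array `5`. -/
theorem encode_lt [NeZero k] (g : ℕ) (d : Fin n → ZMod k) (w : ℕ) :
    encode g d w < (g + 1) * k ^ w := by
  induction w with
  | zero => simp [encode]
  | succ w ih =>
    have := digit_lt d w
    rw [encode, pow_succ, ← mul_assoc]
    have h : (encode g d w + 1) * k ≤ ((g + 1) * k ^ w) * k := by gcongr; omega
    linarith

theorem le_encode [NeZero k] (g : ℕ) (d : Fin n → ZMod k) (w : ℕ) :
    g * (k : ℤ) ^ w ≤ encode g d w := by
  induction w with
  | zero => simp [encode]
  | succ w ih =>
    have := digit_nonneg d w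
    rw [encode, pow_succ, ← mul_assoc]
    have h : (g * (k : ℤ) ^ w) * k ≤ encode g d w * k := by gcongr
    linarith

theorem encode_le [NeZero k] (g : ℕ) (d : Fin n → ZMod k) {w m : ℕ} (h : w ≤ m) :
    encode g d w ≤ (g + 1) * k ^ m := by
  refine (encode_lt g d w).le.trans ?_
  have : (1 : ℤ) ≤ k := by exact_mod_cast Nat.pos_of_ne_zero (NeZero.ne k)
  gcongr

theorem encode_injective [NeZero k] (g : ℕ) {d d' : Fin n → ZMod k}
    (h : encode g d n = encode g d' n) : d = d' := by
  have key : ∀ m, encode g d m = encode g d' m → ∀ w < m, digit d w = digit d' w := by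
    intro m
    induction m with
    | zero => intro _ w hw; omega
    | succ m ih =>
      intro h w hw
      rw [encode, encode] at h
      have h1 := digit_lt d m
      have h2 := digit_lt d' m
      have h3 := digit_nonneg d m
      have h4 := digit_nonneg d' m
      have h5 : digit d m = digit d' m := by
        have := congrArg (fun z : ℤ => z % k) h
        simpa [Int.add_emod, Int.emod_eq_of_lt h3 h1, Int.emod_eq_of_lt h4 h2] using this
      have hk : (k : ℤ) ≠ 0 := by exact_mod_cast NeZero.ne k
      have h6 : encode g d m = encode g d' m := by
        refine mul_right_cancel₀ hk ?_
        linarith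
      rcases Nat.lt_succ_iff_lt_or_eq.1 hw with hw | rfl
      · exact ih h6 w hw
      · exact h5
  ext w
  have := key n h w w.2
  rw [digit_fin, digit_fin] at this
  exact ZMod.val_injective k (by exact_mod_cast this)

/-- Row `r` of array `3` holds `d`. -/
def RowIs (σ : State) (r : ℤ) (d : Fin n → ZMod k) : Prop :=
  ∀ w < n, σ.arr 3 (r * n + (w : ℕ)) = digit d w

/-- Registers `0` and `2` hold `n` and `k`. -/
structure Header (n k : ℕ) (σ : State) : Prop where
  reg_zero : σ.reg 0 = n
  reg_two : σ.reg 2 = k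

theorem Header.of_frame {c : Program} {σ τ : State} (h : Header n k σ) (hf : Frame c σ τ)
    (h0 : c.writesReg 0 = false) (h2 : c.writesReg 2 = false) : Header n k τ :=
  ⟨by rw [hf.reg 0 h0, h.reg_zero], by rw [hf.reg 2 h2, h.reg_two]⟩

theorem runs_checkRow [NeZero k] {X : ℕ} {σ : State} (hb : Bounded X σ) (hh : Header n k σ)
    {g : ℕ} (hg : σ.reg 5 = g) (hX : ((g : ℤ) + 1) * k ^ n ≤ 2 ^ X) {R : Fin n → ℕ}
    (hR : ∀ w : Fin n, σ.arr 2 (w : ℕ) = R w) {d : Fin n → ZMod k} (hd : RowIs σ (σ.reg 4) d) :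
    Runs X checkRow σ (n * 6 + 4) fun τ =>
      τ.reg 14 = (if ∀ w, (d w).val ≤ R w then 1 else 0) ∧ τ.reg 15 = encode g d n := by
  classical
  refine Runs.mono (N := 1 + (1 + (n * 6 + 2))) ?_ (by omega) (fun _ _ _ h => h)
  refine Runs.assign_seq hb rfl (by simpa [Expr.eval] using hb.one_le) fun hb1 => ?_
  refine Runs.assign_seq hb1 rfl (by simpa [Expr.eval] using hb.reg 5) fun hb2 => ?_
  refine (Runs.forLess (fun i τ => (τ.reg 14 = if ∀ w : Fin n, (w : ℕ) < i → (d w).val ≤ R w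
    then 1 else 0) ∧ τ.reg 15 = encode g d i) n 4 (by decide) rfl rfl (by simp [hh.reg_zero]) hb2
    (by simp [encode, Expr.eval, hg]) ?_).mono le_rfl ?_
  · rintro i τ hi h13 h0 hf hb ⟨h14, h15⟩
    have h4 : τ.reg 4 = σ.reg 4 := by simpa using hf.reg 4 rfl
    have h2 : τ.reg 2 = k := by simpa [hh.reg_two] using hf.reg 2 rfl
    have hA3 : τ.arr 3 = σ.arr 3 := by simpa using hf.arr 3 rfl
    have hA2 : τ.arr 2 = σ.arr 2 := by simpa using hf.arr 2 rfl
    have hrow : τ.arr 3 (τ.reg 4 * τ.reg 0 + τ.reg 13) = digit d i := by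
      rw [hA3, h4, h0, h13, hd i hi]
    have hRi := hR ⟨i, hi⟩
    have hdi := digit_fin d ⟨i, hi⟩
    simp only at hRi hdi
    refine Runs.mono (N := 1 + ((1 + 1) + 1)) ?_ (by omega) (fun _ _ _ h => h)
    refine Runs.assign_seq hb rfl (hb.arr _ _) fun hb1 => ?_
    simp only [Expr.eval, Expr.cell, hrow] at hb1 ⊢
    refine Runs.seq (Q := fun υ => υ.reg 14 =
      (if ∀ w : Fin n, (w : ℕ) < i + 1 → (d w).val ≤ R w then 1 else 0) ∧
      υ.reg 15 = encode g d i ∧ υ.reg 17 = digit d i ∧ υ.reg 2 = k) ?_ ?_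
    · have hsplit : (∀ w : Fin n, (w : ℕ) < i + 1 → (d w).val ≤ R w) ↔
          (∀ w : Fin n, (w : ℕ) < i → (d w).val ≤ R w) ∧ (d ⟨i, hi⟩).val ≤ R ⟨i, hi⟩ := by
        constructor
        · exact fun h => ⟨fun w hw => h w (by omega), h ⟨i, hi⟩ (by simp)⟩
        · rintro ⟨h, h'⟩ w hw
          rcases Nat.lt_succ_iff_lt_or_eq.1 hw with hw | rfl
          · exact h w hw
          · exact h'
      refine Runs.ite hb1 rfl (fun hpos => ?_) fun hneg => ?_
      · refine Runs.assign hb1 rfl (by simp [Expr.eval]) fun _ => ?_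
        simp only [Expr.eval, State.setReg_reg, State.setReg_arr, h13, hA2] at hpos ⊢
        norm_num at hpos ⊢
        exact ⟨⟨⟨i, hi⟩, le_rfl, by omega⟩, h15, h2⟩
      · refine Runs.skip hb1 ?_
        simp only [Expr.eval, State.setReg_reg, State.setReg_arr, h13, hA2] at hneg ⊢
        norm_num at hneg ⊢
        refine ⟨?_, h15, h2⟩
        rw [h14]
        refine if_congr ?_ rfl rfl
        constructor
        · intro h w hw
          exact hsplit.2 ⟨h, by omega⟩ w (by omega)
        · intro h w hw
          exact h w (by omega)
    · rintro υ hbυ - ⟨h14', h15', h17', h2'⟩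
      have hval : (Expr.add (.mul (.reg 15) (.reg 2)) (.reg 17)).eval υ = encode g d (i + 1) := by
        simp [Expr.eval, h15', h17', h2', encode]
      refine Runs.assign hbυ rfl ?_ fun _ => ?_
      · rw [hval, abs_of_nonneg (encode_nonneg _ _ _)]
        exact (encode_le g d (Nat.succ_le_of_lt hi)).trans hX
      · rw [hval]
        simpa using h14'
  · rintro τ - - ⟨⟨h14, h15⟩, -⟩
    refine ⟨?_, h15⟩
    rw [h14]
    exact if_congr ⟨fun h w => h w w.2, fun h w _ => h w⟩ rfl rfl

/-- The entries of the table `T` fill the rows from `base` on, and array `5` tells the row of each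
key. Array `5` is unused beyond the codes of step `g`. -/
structure HoldsTable (σ : State) (g base : ℕ)
    (T : List (Fin n → ZMod k) × ((Fin n → ZMod k) → ℤ)) : Prop where
  tail : σ.reg 4 = ((base + T.1.length : ℕ) : ℤ)
  row : ∀ (t : ℕ) (h : t < T.1.length), RowIs σ ((base + t : ℕ) : ℤ) T.1[t]
  val : ∀ (t : ℕ) (h : t < T.1.length), σ.arr 4 ((base + t : ℕ) : ℤ) = T.2 T.1[t]
  pos : ∀ d, σ.arr 5 (encode g d n) =
    if d ∈ T.1 then ((base + T.1.idxOf d + 1 : ℕ) : ℤ) else 0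
  fresh : ∀ z : ℤ, ((g : ℤ) + 1) * k ^ n ≤ z → σ.arr 5 z = 0

theorem HoldsTable.congr {σ τ : State} {g base : ℕ}
    {T : List (Fin n → ZMod k) × ((Fin n → ZMod k) → ℤ)} (h : HoldsTable σ g base T)
    (h4 : τ.reg 4 = σ.reg 4)
    (hrow : ∀ r < base + T.1.length, ∀ w < n,
      τ.arr 3 (((r : ℕ) : ℤ) * n + (w : ℕ)) = σ.arr 3 ((r : ℤ) * n + (w : ℕ)))
    (h4' : τ.arr 4 = σ.arr 4) (h5 : τ.arr 5 = σ.arr 5) : HoldsTable τ g base T :=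
  ⟨h4.trans h.tail, fun t ht w hw => (hrow _ (by omega) w hw).trans (h.row t ht w hw),
    fun t ht => by rw [h4']; exact h.val t ht, fun d => by rw [h5]; exact h.pos d,
    fun z hz => by rw [h5]; exact h.fresh z hz⟩

theorem runs_addEntry [NeZero k] {X : ℕ} {σ : State} (hb : Bounded X σ)
    {g base : ℕ} {T : List (Fin n → ZMod k) × ((Fin n → ZMod k) → ℤ)} (hT : IsTable T)
    (hσ : HoldsTable σ g base T) {R : Fin n → ℕ} {d : Fin n → ZMod k} {z : ℤ}
    (h14 : σ.reg 14 = if ∀ w, (d w).val ≤ R w then 1 else 0) (h15 : σ.reg 15 = encode g d n)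
    (h16 : σ.reg 16 = z) (hd : RowIs σ (σ.reg 4) d)
    (htail : ((base + T.1.length + 1 : ℕ) : ℤ) ≤ 2 ^ X) (hval : |T.2 d + z| ≤ 2 ^ X) :
    Runs X addEntry σ 6 fun τ => HoldsTable τ g base (insertEntry R T d z) ∧
      ∀ j : ℤ, j < base → τ.arr 4 j = σ.arr 4 j := by
  refine Runs.mono (N := 1 + 5) ?_ (by omega) (fun _ _ _ h => h)
  refine Runs.ite hb rfl (fun hpos => ?_) fun hneg => ?_
  · have hlive : ∀ w, (d w).val ≤ R w := by
      by_contra hcon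
      rw [Expr.eval, h14, if_neg hcon] at hpos
      omega
    rw [insertEntry, if_pos hlive]
    have h17 : σ.arr 5 (σ.reg 15) = if d ∈ T.1 then ((base + T.1.idxOf d + 1 : ℕ) : ℤ) else 0 := by
      rw [h15, hσ.pos]
    refine Runs.mono (N := 1 + (1 + 3)) ?_ (by omega) (fun _ _ _ h => h)
    refine Runs.assign_seq hb rfl (hb.arr _ _) fun hb1 => ?_
    simp only [Expr.eval, h17] at hb1 ⊢
    by_cases hmem : d ∈ T.1
    · have hlt := List.idxOf_lt_length_of_mem hmem
      have hget : T.1[T.1.idxOf d] = d := List.getElem_idxOf hlt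
      rw [if_pos hmem] at hb1 ⊢
      rw [if_pos hmem]
      refine Runs.ite hb1 rfl (fun _ => ?_) fun hneg => ?_
      · have hold : σ.arr 4 ((base : ℤ) + (T.1.idxOf d : ℤ)) = T.2 d := by
          have := hσ.val _ hlt
          rw [hget] at this
          exact_mod_cast this
        refine Runs.mono (N := 1) ?_ (by omega) (fun _ _ _ h => h)
        refine Runs.store hb1 rfl rfl ?_ fun _ => ?_
        · simp [Expr.eval, hold, h16]
          exact hval
        · simp only [Expr.eval, State.setReg_reg, State.setReg_arr]
          norm_num [hold, h16]
          refine ⟨⟨?_, ?_, ?_, ?_, ?_⟩, ?_⟩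
          · simpa using hσ.tail
          · intro t ht w hw
            simpa using hσ.row t ht w hw
          · intro t ht
            have := hσ.val t ht
            simp only [State.setArr_arr, true_and, Nat.cast_add, add_right_inj, Nat.cast_inj,
              State.setReg_arr, Function.update_apply]
            by_cases htd : t = T.1.idxOf d
            · subst htd
              simp [hget]
            · rw [if_neg htd, if_neg]
              · exact_mod_cast this
              · intro h
                refine htd ?_
                rw [← h, hT.nodup.idxOf_getElem]
          · intro d'
            simpa using hσ.pos d'
          · intro z hz
            simpa using hσ.fresh z hz
          · intro j hj h
            omega
      · simp [Expr.eval] at hneg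
        omega
    · rw [if_neg hmem] at hb1 ⊢
      rw [if_neg hmem]
      refine Runs.ite hb1 rfl (fun hpos => ?_) fun _ => ?_
      · simp [Expr.eval] at hpos
      -- The value of an absent key is zero, so writing `z` is the same as adding it.
      · have hz : T.2 d + z = z := by rw [hT.eq_zero d hmem, zero_add]
        refine Runs.mono (N := 1 + (1 + 1)) ?_ (by omega) (fun _ _ _ h => h)
        refine Runs.store_seq hb1 rfl rfl (by simpa [Expr.eval] using hb.reg 16) fun hb2 => ?_
        have htail' : ((base : ℤ) + T.1.length + 1) ≤ 2 ^ X := by exact_mod_cast htail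
        have h4 := hσ.tail
        push_cast at h4
        refine Runs.assign_seq hb2 rfl ?_ fun hb3 => ?_
        · simp [Expr.eval, h4]
          rw [abs_of_nonneg (by positivity)]
          exact htail'
        refine Runs.store hb3 rfl rfl ?_ fun _ => ?_
        · simp [Expr.eval, h4]
          rw [abs_of_nonneg (by positivity)]
          exact htail'
        · simp only [Expr.eval, State.setReg_reg, State.setArr_reg]
          norm_num [h16, h4, h15, hz]
          refine ⟨⟨?_, ?_, ?_, ?_, ?_⟩, ?_⟩
          · simp
            ring
          · intro t ht w hw
            simp only [List.length_append, List.length_singleton] at ht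
            rcases Nat.lt_succ_iff_lt_or_eq.1 ht with ht | rfl
            · simpa [List.getElem_append_left, ht] using hσ.row t ht w hw
            · have := hd w hw
              rw [h4] at this
              simpa using this
          · intro t ht
            simp only [List.length_append, List.length_singleton] at ht
            rcases Nat.lt_succ_iff_lt_or_eq.1 ht with ht | rfl
            · have hne : T.1[t] ≠ d := fun h => hmem (h ▸ List.getElem_mem ht)
              have := hσ.val t ht
              push_cast at this
              simp [List.getElem_append_left, ht, hne, this, ht.ne]
            · simp
          · intro d'
            by_cases hd' : d' = d
            · subst hd'
              simp [List.idxOf_append, hmem]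
            · have hne : encode g d' n ≠ encode g d n := fun h => hd' (encode_injective g h)
              have := hσ.pos d'
              simp only [State.setArr_arr, true_and, State.setReg_arr, hne, if_false,
                List.mem_append, List.mem_singleton, hd', or_false]
              simp only [this, Nat.reduceEqDiff, false_and, if_false]
              split_ifs with hmem'
              · rw [List.idxOf_append_of_mem hmem']
              · rfl
          · intro x hx
            have hne : x ≠ encode g d n := by
              have := encode_lt g d n
              omega
            simpa [hne] using hσ.fresh x hx
          · intro j hj h
            omega
  · have hlive : ¬ ∀ w, (d w).val ≤ R w := by
      intro hcon
      rw [Expr.eval, h14, if_pos hcon] at hneg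
      omega
    rw [insertEntry, if_neg hlive]
    exact (Runs.skip hb ⟨hσ, fun _ _ => rfl⟩).mono (by omega) fun _ _ _ h => h

theorem runs_insertRow [NeZero k] {X : ℕ} {σ : State} (hb : Bounded X σ) (hh : Header n k σ)
    {g base : ℕ} (hg : σ.reg 5 = g) (hX : ((g : ℤ) + 1) * k ^ n ≤ 2 ^ X)
    {T : List (Fin n → ZMod k) × ((Fin n → ZMod k) → ℤ)} (hT : IsTable T)
    (hσ : HoldsTable σ g base T) {R : Fin n → ℕ} (hR : ∀ w : Fin n, σ.arr 2 (w : ℕ) = R w)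
    {d : Fin n → ZMod k} {z : ℤ} (h16 : σ.reg 16 = z) (hd : RowIs σ (σ.reg 4) d)
    (htail : ((base + T.1.length + 1 : ℕ) : ℤ) ≤ 2 ^ X) (hval : |T.2 d + z| ≤ 2 ^ X) :
    Runs X insertRow σ (n * 6 + 10) fun τ => HoldsTable τ g base (insertEntry R T d z) ∧
      ∀ j : ℤ, j < base → τ.arr 4 j = σ.arr 4 j := by
  refine Runs.mono (N := (n * 6 + 4) + 6) ?_ (by omega) (fun _ _ _ h => h)
  refine Runs.seq (runs_checkRow hb hh hg hX hR hd) fun τ hbτ hf ⟨h14, h15⟩ => ?_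
  have h4 : τ.reg 4 = σ.reg 4 := hf.reg 4 rfl
  have hA3 : τ.arr 3 = σ.arr 3 := hf.arr 3 rfl
  have hA4 : τ.arr 4 = σ.arr 4 := hf.arr 4 rfl
  rw [← hA4]
  refine runs_addEntry hbτ hT (hσ.congr h4 (fun _ _ _ _ => by rw [hA3]) hA4 (hf.arr 5 rfl)) h14 h15
    ((hf.reg 16 rfl).trans h16) ?_ htail hval
  intro w hw
  rw [h4, hA3]
  exact hd w hw

end

end RandomizedRAM

/-! ### Orienting one edge -/

namespace RandomizedRAM

/-- Copy the row with the index in register `12` behind the last entry. -/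
def copyRow : Program :=
  .forLess 13 0 <| .store 3 (.cell (.reg 4) (.reg 13)) (.get 3 (.cell (.reg 12) (.reg 13)))

/-- Insert the entry with the index in register `12`, multiplied by `c`, with its demand decreased
by one at the vertex in register `x`. -/
def pushChild (x : ℕ) (c : ℤ) : Program :=
  .seq copyRow <| .seq (.assign 17 (.sub (.get 3 (.cell (.reg 12) (.reg x))) (.lit 1))) <|
  .seq (.ite (.sub (.lit 0) (.reg 17)) (.assign 17 (.sub (.reg 2) (.lit 1))) .skip) <|
  .seq (.store 3 (.cell (.reg 4) (.reg x)) (.reg 17)) <|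
  .seq (.assign 16 (.mul (.lit c) (.get 4 (.reg 12)))) insertRow

section

variable {n k : ℕ}

/-- Rows occupy disjoint blocks of length `n`. Only the column in the lower row must be below `n`,
since the other address lies at or beyond the start of a later row. -/
theorem cell_ne {r t : ℤ} (hrt : r < t) {w w' : ℕ} (hw : w < n) :
    r * n + (w : ℤ) ≠ t * n + (w' : ℤ) := by
  have h : (r + 1) * n ≤ t * n := by gcongr; omega
  have : (w : ℤ) < n := by exact_mod_cast hw
  intro h'
  have : (0 : ℤ) ≤ w' := by positivity
  linarith

theorem runs_copyRow {X : ℕ} {σ : State} (hb : Bounded X σ) (hh : Header n k σ)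
    {r : ℕ} (h12 : σ.reg 12 = r) (hr : (r : ℤ) < σ.reg 4) {d : Fin n → ZMod k}
    (hd : RowIs σ r d) :
    Runs X copyRow σ (n * 3 + 2) fun τ => RowIs τ (σ.reg 4) d ∧
      ∀ s : ℤ, s < σ.reg 4 → ∀ w < n, τ.arr 3 (s * n + (w : ℕ)) = σ.arr 3 (s * n + (w : ℕ)) := by
  refine (Runs.forLess (fun i τ => (∀ w < i, τ.arr 3 (σ.reg 4 * n + (w : ℕ)) = digit d w) ∧
    ∀ s : ℤ, s < σ.reg 4 → ∀ w < n, τ.arr 3 (s * n + (w : ℕ)) = σ.arr 3 (s * n + (w : ℕ)))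
    n 1 (by decide) rfl rfl hh.reg_zero hb (by simp) ?_).mono (by omega) ?_
  · rintro i τ hi h13 h0 hf hb ⟨hI, hrest⟩
    have h4 : τ.reg 4 = σ.reg 4 := hf.reg 4 rfl
    have h12' : τ.reg 12 = r := (hf.reg 12 rfl).trans h12
    refine Runs.store hb rfl rfl (hb.arr _ _) fun _ => ⟨fun w hw => ?_, fun s hs w hw => ?_⟩
    · simp only [Expr.eval, Expr.cell, h13, h0, h4, h12', State.setReg_arr, State.setArr_arr,
        true_and, add_right_inj, Nat.cast_inj]
      split_ifs with hwi
      · subst hwi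
        rw [hrest r hr w hi, hd w hi]
      · exact hI w (by omega)
    · have := cell_ne (w' := i) hs hw
      simp only [Expr.eval, Expr.cell, h13, h0, h4, State.setReg_arr, State.setArr_arr,
        true_and, this, if_false]
      exact hrest s hs w hw
  · rintro τ - - ⟨⟨h1, h2⟩, -⟩
    exact ⟨h1, h2⟩

theorem digit_sub_unitVec [NeZero k] (d : Fin n → ZMod k) (u w : ℕ) (hw : w < n) :
    digit (d - unitVec n k u) w =
      if w = u then (if digit d u = 0 then (k : ℤ) - 1 else digit d u - 1) else digit d w := by
  have hk : 0 < k := Nat.pos_of_ne_zero (NeZero.ne k)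
  split_ifs with h1 h2
  · subst h1
    simp only [digit, hw, dif_pos, Nat.cast_eq_zero, ZMod.val_eq_zero] at h2 ⊢
    simp only [Pi.sub_apply, unitVec, if_true, h2, zero_sub]
    rw [ZMod.neg_val', ZMod.val_one_eq_one_mod]
    rcases Nat.lt_or_ge 1 k with h | h
    · rw [Nat.mod_eq_of_lt h, Nat.mod_eq_of_lt (by omega)]
      omega
    -- Modulo `1` the only digit is `0`, and `k - 1 = 0` is still correct.
    · obtain rfl : k = 1 := by omega
      simp
  · subst h1
    simp only [digit, hw, dif_pos, Nat.cast_eq_zero] at h2 ⊢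
    have hlt := ZMod.val_lt (d ⟨w, hw⟩)
    simp only [Pi.sub_apply, unitVec, if_true]
    have h1 : (1 : ZMod k).val = 1 := by
      rw [ZMod.val_one_eq_one_mod]
      exact Nat.mod_eq_of_lt (by omega)
    rw [ZMod.val_sub (by omega), h1]
    omega
  · simp [digit, hw, unitVec, h1]

/-- All writes to arrays `3` and `4` hit rows from `base` on, so the rows of the old layer, which
lie below `base`, can still be read afterwards. -/
theorem runs_pushChild [NeZero k] {X : ℕ} {σ : State} (hb : Bounded X σ) (hh : Header n k σ)
    {g base : ℕ} (hg : σ.reg 5 = g) (hX : ((g : ℤ) + 1) * k ^ n ≤ 2 ^ X)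
    {T : List (Fin n → ZMod k) × ((Fin n → ZMod k) → ℤ)} (hT : IsTable T)
    (hσ : HoldsTable σ g base T) {R : Fin n → ℕ} (hR : ∀ w : Fin n, σ.arr 2 (w : ℕ) = R w)
    {r : ℕ} (h12 : σ.reg 12 = r) (hr : r < base) {d : Fin n → ZMod k} (hd : RowIs σ r d)
    {y : ℤ} (hy : σ.arr 4 r = y) {x u : ℕ} (hx : x = 10 ∨ x = 11) (hu : σ.reg x = u)
    (hun : u < n) {c : ℤ} (hc : c = 1 ∨ c = -1)
    (htail : ((base + T.1.length + 1 : ℕ) : ℤ) ≤ 2 ^ X)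
    (hval : |T.2 (d - unitVec n k u) + c * y| ≤ 2 ^ X) :
    Runs X (pushChild x c) σ (n * 9 + 20) fun τ =>
      HoldsTable τ g base (insertEntry R T (d - unitVec n k u) (c * y)) ∧
      (∀ j : ℤ, j < base → τ.arr 4 j = σ.arr 4 j) ∧
      ∀ s : ℤ, s < base → ∀ w < n, τ.arr 3 (s * n + (w : ℕ)) = σ.arr 3 (s * n + (w : ℕ)) := by
  have h4 := hσ.tail
  have hr4 : (r : ℤ) < σ.reg 4 := by rw [h4]; exact_mod_cast (by omega)
  refine Runs.mono (N := (n * 3 + 2) + (1 + ((1 + 1) + (1 + (1 + (n * 6 + 10)))))) ?_ (by omega)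
    (fun _ _ _ h => h)
  refine Runs.seq (runs_copyRow hb hh h12 hr4 hd) fun τ hbτ hf ⟨hrow, hrest⟩ => ?_
  have hx' : τ.reg x = u := by
    rw [← hu]
    rcases hx with rfl | rfl <;> exact hf.reg _ rfl
  have hx17 : x ≠ 17 := by omega
  have hhτ : Header n k τ := hh.of_frame hf rfl rfl
  have h12τ : τ.reg 12 = r := (hf.reg 12 rfl).trans h12
  have h4τ : τ.reg 4 = σ.reg 4 := hf.reg 4 rfl
  have hold : τ.arr 3 (τ.reg 12 * τ.reg 0 + τ.reg x) = digit d u := by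
    rw [h12τ, hhτ.reg_zero, hx', hrest r hr4 u hun, hd u hun]
  have hdig := digit_nonneg d u
  have hdigb : digit d u ≤ 2 ^ X := by
    have := hbτ.arr 3 (τ.reg 12 * τ.reg 0 + τ.reg x)
    rw [hold] at this
    exact (le_abs_self _).trans this
  have hpos : (0 : ℤ) < 2 ^ X := by positivity
  refine Runs.assign_seq hbτ (by rcases hx with rfl | rfl <;> rfl) ?_ fun hb1 => ?_
  · simp only [Expr.eval, Expr.cell, hold, abs_le]
    constructor <;> omega
  simp only [Expr.eval, Expr.cell, hold] at hb1 ⊢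
  -- Both branches end in the same memory, with the decreased digit in register `17`; the cyclic
  -- step from `0` to `k - 1` is the only case that needs a correction.
  refine Runs.seq (Q := fun υ => υ = (τ.setReg 17 (digit d u - 1)).setReg 17
    (digit (d - unitVec n k u) u)) ?_ ?_
  · rw [digit_sub_unitVec d u u hun, if_pos rfl]
    refine Runs.ite hb1 rfl (fun h => ?_) fun h => ?_
    · have h0 : digit d u = 0 := by
        simp [Expr.eval] at h
        omega
      have hk2 := hbτ.reg 2
      rw [hhτ.reg_two, Nat.abs_cast] at hk2
      refine Runs.assign hb1 rfl ?_ fun _ => ?_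
      · simp only [Expr.eval, State.setReg_reg]
        norm_num [hhτ.reg_two, abs_le]
        constructor <;> omega
      · simp [Expr.eval, h0, hhτ.reg_two]
    · have h0 : digit d u ≠ 0 := by
        simp [Expr.eval] at h
        omega
      refine Runs.skip hb1 ?_
      rw [if_neg h0]
      simp [State.setReg]
  rintro υ hbυ - rfl
  have hcase : (τ.setReg 17 (digit d u - 1)).setReg 17 (digit (d - unitVec n k u) u) =
      τ.setReg 17 (digit (d - unitVec n k u) u) := by simp [State.setReg]
  rw [hcase] at hbυ ⊢
  refine Runs.store_seq hbυ (by rcases hx with rfl | rfl <;> rfl) rfl (hbυ.reg 17) fun hb2 => ?_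
  have haddr : (Expr.add (.mul (.reg 4) (.reg 0)) (.reg x)).eval (τ.setReg 17 (digit (d - unitVec n k u) u)) =
      σ.reg 4 * n + (u : ℤ) := by
    simp [Expr.eval, hhτ.reg_zero, hx', hx17, h4τ]
  rw [haddr] at hb2 ⊢
  have hA4 : τ.arr 4 = σ.arr 4 := hf.arr 4 rfl
  have hyval : |c * y| ≤ 2 ^ X := by
    have := hb.arr 4 r
    rw [hy] at this
    rcases hc with rfl | rfl <;> simpa using this
  refine Runs.assign_seq hb2 (by rcases hc with rfl | rfl <;> rfl) ?_ fun hb3 => ?_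
  · simpa [Expr.eval, h12τ, hA4, hy] using hyval
  have hev : (Expr.mul (.lit c) (.get 4 (.reg 12))).eval
      ((τ.setReg 17 (digit (d - unitVec n k u) u)).setArr 3 (σ.reg 4 * n + (u : ℤ))
        ((Expr.reg 17).eval (τ.setReg 17 (digit (d - unitVec n k u) u)))) = c * y := by
    simp [Expr.eval, h12τ, hA4, hy]
  rw [hev] at hb3 ⊢
  have hne : ∀ s : ℤ, s < σ.reg 4 → ∀ w < n,
      (s * n + (w : ℕ) : ℤ) ≠ σ.reg 4 * n + (u : ℤ) := fun s hs w hw => cell_ne hs hw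
  refine (runs_insertRow hb3 ⟨by simpa using hhτ.reg_zero, by simpa using hhτ.reg_two⟩ (g := g)
    (by simpa [hg] using hf.reg 5 rfl) hX hT (hσ.congr (by simpa using h4τ) ?_ ?_ ?_)
    (R := R) ?_ (by simp) (d := d - unitVec n k u) ?_ htail hval).mono le_rfl ?_
  · intro s hs w hw
    have hs4 : (s : ℤ) < σ.reg 4 := by rw [h4]; exact_mod_cast hs
    simp [hne s hs4 w hw, hrest s hs4 w hw]
  · ext j
    simp [hA4]
  · ext j
    simp [hf.arr 5 rfl]
  · intro w
    simpa [hf.arr 2 rfl] using hR w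
  · intro w hw
    rw [digit_sub_unitVec d u w hw]
    simp only [State.setReg_reg, State.setArr_reg, State.setReg_arr, State.setArr_arr]
    norm_num [h4τ, Expr.eval]
    by_cases hwu : w = u
    · subst hwu
      rw [if_pos rfl, if_pos rfl, digit_sub_unitVec d w w hw, if_pos rfl]
    · rw [if_neg hwu, if_neg hwu]
      exact hrow w hw
  · rintro ρ - hfρ ⟨h1, h2⟩
    refine ⟨h1, fun j hj => ?_, fun s hs w hw => ?_⟩
    · rw [h2 j hj]
      simp [hA4]
    · have hs4 : s < σ.reg 4 := by
        rw [h4]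
        push_cast
        omega
      rw [hfρ.arr 3 rfl]
      simp [hne s hs4 w hw, hrest s hs4 w hw]

end

end RandomizedRAM

/-! ### From one layer to the next -/

namespace RandomizedRAM

/-- Replace the current layer by the next one, for the edge with its ends in registers `10`
and `11`. -/
def processEdge : Program :=
  .seq (.store 2 (.reg 10) (.sub (.get 2 (.reg 10)) (.lit 1))) <|
  .seq (.store 2 (.reg 11) (.sub (.get 2 (.reg 11)) (.lit 1))) <|
  .seq (.assign 5 (.add (.reg 5) (.lit 1))) <| .seq (.assign 7 (.reg 4)) <|
  .seq (.assign 12 (.reg 6)) <|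
  .seq (.whileLess 12 7 (.seq (pushChild 10 1) (pushChild 11 (-1)))) (.assign 6 (.reg 7))

section

variable {n k p : ℕ} {G : SimpleGraph (Fin n)}

/-- The memory holds the layer `T` of the dynamic program after the edges in `l`, started from the
demand `a`; `g` is the number of the current step, and `base` the first row of the layer. -/
structure HoldsLayer (P : PathDecomposition G p) (a : Fin n → ZMod k) (l : List (ℕ × ℕ))
    (g base : ℕ) (T : List (Fin n → ZMod k) × ((Fin n → ZMod k) → ℤ)) (σ : State) : Prop where
  header : Header n k σ
  reg_five : σ.reg 5 = g
  reg_six : σ.reg 6 = base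
  table : HoldsTable σ g base T
  layer : IsLayer P a l T
  arr_two : ∀ w : Fin n, σ.arr 2 (w : ℕ) = remaining P l w

/-- Raising the step number makes all codes unused again, so the next layer starts as an empty table
right behind the current one, without any erasing. -/
theorem HoldsTable.next [NeZero k] {σ τ : State} {g base : ℕ}
    {T : List (Fin n → ZMod k) × ((Fin n → ZMod k) → ℤ)} (h : HoldsTable σ g base T)
    (h4 : τ.reg 4 = σ.reg 4) (h5 : τ.arr 5 = σ.arr 5) :
    HoldsTable τ (g + 1) (base + T.1.length)
      (([], fun _ => 0) : List (Fin n → ZMod k) × ((Fin n → ZMod k) → ℤ)) := by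
  refine ⟨by simpa using h4.trans h.tail, fun t ht => by simp at ht, fun t ht => by simp at ht,
    fun d => ?_, fun z hz => ?_⟩
  · rw [h5, h.fresh]
    · simp
    · have := le_encode (g + 1) d n
      push_cast at this
      exact this
  · rw [h5, h.fresh]
    refine le_trans ?_ hz
    have : (0 : ℤ) ≤ k ^ n := by positivity
    push_cast
    nlinarith

theorem remaining_concat (P : PathDecomposition G p) {l : List (ℕ × ℕ)} {u v : ℕ}
    (hl : ∀ w, incidences (l ++ [(u, v)]) w ≤ incidences (edgeList P) w) (w : Fin n) :
    (remaining P (l ++ [(u, v)]) w : ℤ) =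
      remaining P l w - if u = (w : ℕ) ∨ v = (w : ℕ) then 1 else 0 := by
  have := hl w
  rw [incidences_concat] at this
  rw [remaining, remaining, incidences_concat]
  split_ifs at this ⊢ <;> omega

/-- The loop visits the entries of the old layer; after `t` of them the new table is `expandKeys` of
the first `t` keys. The room `2 * C + 2` covers the old layer, the new one, the first child and the
row under construction. -/
theorem runs_processEdge [NeZero k] {X : ℕ} {σ : State} (hb : Bounded X σ)
    {P : PathDecomposition G p} {a : Fin n → ZMod k} {l : List (ℕ × ℕ)} {g base : ℕ}
    {T : List (Fin n → ZMod k) × ((Fin n → ZMod k) → ℤ)} (hσ : HoldsLayer P a l g base T σ)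
    {u v : ℕ} (hu : u < n) (hvu : v < u) (h10 : σ.reg 10 = u) (h11 : σ.reg 11 = v)
    (hl : ∀ w, incidences (l ++ [(u, v)]) w ≤ incidences (edgeList P) w) {C : ℕ}
    (hC : ∀ L : List (Fin n → ZMod k), L.Nodup → (∀ d ∈ L, d ∈ demandBox P a (l ++ [(u, v)])) →
      L.length ≤ C) (hTC : T.1.length ≤ C) (hX : ((g : ℤ) + 2) * k ^ n ≤ 2 ^ X)
    (htail : ((base + 2 * C + 2 : ℕ) : ℤ) ≤ 2 ^ X) (hlX : l.length + 2 ≤ X) :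
    Runs X processEdge σ (C * (n * 18 + 42) + 7) fun τ => ∃ T',
      HoldsLayer P a (l ++ [(u, v)]) (g + 1) (base + T.1.length) T' τ ∧ T'.1.length ≤ C := by
  have hk : 0 < k := Nat.pos_of_ne_zero (NeZero.ne k)
  have hkn : (1 : ℤ) ≤ k ^ n := one_le_pow₀ (by exact_mod_cast hk)
  have hv : v < n := hvu.trans hu
  refine Runs.mono (N := 1 + (1 + (1 + (1 + (1 + ((C * (n * 18 + 42) + 1) + 1))))))
    ?_ (by omega) (fun _ _ _ h => h)
  have hremu := remaining_concat P hl ⟨u, hu⟩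
  have hremv := remaining_concat P hl ⟨v, hv⟩
  have hRu := hσ.arr_two ⟨u, hu⟩
  have hRv := hσ.arr_two ⟨v, hv⟩
  simp only [true_or, or_true, if_true] at hremu hremv hRu hRv
  have h1X := hb.one_le
  have hle : ∀ z : ℤ, 0 ≤ z - 1 → |z| ≤ 2 ^ X → |z - 1| ≤ 2 ^ X := by
    intro z h0 hz
    rw [abs_of_nonneg h0]
    have := le_abs_self z
    omega
  have hbu := hb.arr 2 u
  have hbv := hb.arr 2 v
  rw [hRu] at hbu
  rw [hRv] at hbv
  refine Runs.store_seq hb rfl rfl ?_ fun hb1 => ?_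
  · simp only [Expr.eval, h10, hRu]
    exact hle _ (by omega) hbu
  refine Runs.store_seq hb1 rfl rfl ?_ fun hb2 => ?_
  · have hvu' : v ≠ u := hvu.ne
    simp [Expr.eval, h10, h11, hRv, hvu']
    exact hle _ (by omega) hbv
  refine Runs.assign_seq hb2 rfl ?_ fun hb3 => ?_
  · simp [Expr.eval, hσ.reg_five]
    rw [abs_of_nonneg (by positivity)]
    nlinarith
  refine Runs.assign_seq hb3 rfl (by simpa [Expr.eval] using hb.reg 4) fun hb4 => ?_
  refine Runs.assign_seq hb4 rfl (by simpa [Expr.eval] using hb.reg 6) fun hb5 => ?_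
  set σ' : State := (State.setReg _ 12 _) with hσ'
  have h0' : σ'.reg 0 = n := by simpa [hσ'] using hσ.header.reg_zero
  have h2' : σ'.reg 2 = k := by simpa [hσ'] using hσ.header.reg_two
  have h4' : σ'.reg 4 = σ.reg 4 := by simp [hσ']
  have h5' : σ'.reg 5 = ((g + 1 : ℕ) : ℤ) := by simp [hσ', Expr.eval, hσ.reg_five]
  have h7' : σ'.reg 7 = ((base + T.1.length : ℕ) : ℤ) := by
    rw [← hσ.table.tail]
    simp [hσ', Expr.eval]
  have h12' : σ'.reg 12 = base := by simp [hσ', Expr.eval, hσ.reg_six]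
  have h10' : σ'.reg 10 = u := by simpa [hσ'] using h10
  have h11' : σ'.reg 11 = v := by simpa [hσ'] using h11
  have hA3 : σ'.arr 3 = σ.arr 3 := by ext; simp [hσ']
  have hA4 : σ'.arr 4 = σ.arr 4 := by ext; simp [hσ']
  have hA5 : σ'.arr 5 = σ.arr 5 := by ext; simp [hσ']
  have hA2 : ∀ w : Fin n, σ'.arr 2 (w : ℕ) = remaining P (l ++ [(u, v)]) w := by
    intro w
    have hw := hσ.arr_two w
    have hvu' : v ≠ u := hvu.ne
    rw [remaining_concat P hl]
    simp only [hσ', Expr.eval, State.setReg_arr, State.setArr_arr, State.setReg_reg,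
      State.setArr_reg, true_and, h10, h11, Nat.cast_inj, hvu', if_false, hRu, hRv]
    by_cases hwu : (w : ℕ) = u
    · have : w = ⟨u, hu⟩ := Fin.ext hwu
      subst this
      simp [hvu'.symm]
    · by_cases hwv : (w : ℕ) = v
      · have : w = ⟨v, hv⟩ := Fin.ext hwv
        subst this
        simp
      · simp [hwu, hwv, hw, Ne.symm hwu, Ne.symm hwv]
  clear_value σ'
  set R := remaining P (l ++ [(u, v)]) with hR
  refine Runs.seq (Runs.mono (N' := C * (n * 18 + 42) + 1)
    (Runs.whileLess (fun i τ => HoldsTable τ (g + 1) (base + T.1.length)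
      (expandKeys R u v T.2 (T.1.take (i - base))) ∧
      (∀ (t : ℕ) (h : t < T.1.length), RowIs τ ((base + t : ℕ) : ℤ) T.1[t]) ∧
      ∀ (t : ℕ) (h : t < T.1.length), τ.arr 4 ((base + t : ℕ) : ℤ) = T.2 T.1[t])
    base (base + T.1.length) (n * 18 + 40) (by decide) rfl rfl (by omega) h12' h7' hb5 ?_ ?_)
    ?_ fun τ _ _ h => h) ?_
  · refine ⟨?_, ?_, ?_⟩
    · simpa [expandKeys] using hσ.table.next h4' hA5
    · intro t ht w hw
      rw [hA3]
      exact hσ.table.row t ht w hw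
    · intro t ht
      rw [hA4]
      exact hσ.table.val t ht
  · rintro i τ hi hi' h12 - hf hbτ ⟨hI1, hI2, hI3⟩
    obtain ⟨t, rfl⟩ := Nat.exists_eq_add_of_le hi
    have ht : t < T.1.length := by omega
    rw [Nat.add_sub_cancel_left] at hI1
    set d := T.1[t] with hd
    set Tp := expandKeys R u v T.2 (T.1.take t) with hTp
    have htable : IsTable Tp := isTable_expandKeys _ _ _ _ _
    -- The keys of the half-finished table already lie in the box that belongs to the next layer.
    have hlen : Tp.1.length ≤ C := hC _ htable.nodup fun x hx =>
      hσ.layer.mem_demandBox_of_mem_expandKeys (fun _ h => List.mem_of_mem_take h) hx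
    have hTpval : ∀ x, |Tp.2 x| ≤ 2 * 2 ^ l.length :=
      abs_expandKeys_le hσ.layer R u v hσ.layer.nodup.take
    have hTval : |T.2 d| ≤ 2 ^ l.length := abs_layer_le hσ.layer d
    -- A partial sum is at most `2 * 2 ^ l.length`, and the two children add at most `2 ^ l.length`
    -- each; hence the summand `2` in `hlX`.
    have hpow : 4 * (2 : ℤ) ^ l.length ≤ 2 ^ X := by
      have : (2 : ℤ) ^ (l.length + 2) ≤ 2 ^ X := pow_le_pow_right₀ (by norm_num) hlX
      rw [pow_add] at this
      linarith
    have htail' : ((base + 2 * C + 2 : ℕ) : ℤ) ≤ 2 ^ X := htail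
    have hpl : (0 : ℤ) < 2 ^ l.length := by positivity
    have hcode : (((g + 1 : ℕ) : ℤ) + 1) * k ^ n ≤ 2 ^ X := by
      push_cast
      linarith
    have hh : Header n k τ := ⟨(hf.reg 0 rfl).trans h0', (hf.reg 2 rfl).trans h2'⟩
    have hRτ : ∀ w : Fin n, τ.arr 2 (w : ℕ) = R w := by
      intro w
      rw [hf.arr 2 rfl]
      exact hA2 w
    refine Runs.mono (N := (n * 9 + 20) + (n * 9 + 20)) ?_ (by omega) (fun _ _ _ h => h)
    refine Runs.seq (runs_pushChild hbτ hh ((hf.reg 5 rfl).trans h5') hcode htable hI1 hRτ h12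
      (by omega) (hI2 t ht) (hI3 t ht) (Or.inl rfl) ((hf.reg 10 rfl).trans h10') hu (Or.inl rfl)
      ?_ ?_) fun τ₁ hbτ₁ hf₁ ⟨hP1, hP2, hP3⟩ => ?_
    · push_cast at htail' ⊢
      omega
    · rw [one_mul]
      refine (abs_add_le _ _).trans ?_
      have := hTpval (d - unitVec n k u)
      linarith
    rw [one_mul, ← hd] at hP1
    have hrow₁ : ∀ (s : ℕ) (h : s < T.1.length), RowIs τ₁ ((base + s : ℕ) : ℤ) T.1[s] := by
      intro s hs w hw
      rw [hP3 _ (by exact_mod_cast (by omega)) w hw]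
      exact hI2 s hs w hw
    have hval₁ : ∀ (s : ℕ) (h : s < T.1.length), τ₁.arr 4 ((base + s : ℕ) : ℤ) = T.2 T.1[s] := by
      intro s hs
      rw [hP2 _ (by exact_mod_cast (by omega))]
      exact hI3 s hs
    refine (runs_pushChild hbτ₁ (hh.of_frame hf₁ rfl rfl)
      (((hf₁.reg 5 rfl).trans (hf.reg 5 rfl)).trans h5') hcode
      (htable.insertEntry _ _) hP1 (R := R) ?_ ((hf₁.reg 12 rfl).trans h12)
      (by omega) (hrow₁ t ht) (hval₁ t ht) (Or.inr rfl)
      (((hf₁.reg 11 rfl).trans (hf.reg 11 rfl)).trans h11') (by omega) (Or.inr rfl)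
      ?_ ?_).mono le_rfl ?_
    · intro w
      rw [hf₁.arr 2 rfl]
      exact hRτ w
    · have := length_insertEntry_le R Tp (d - unitVec n k u) (T.2 d)
      refine le_trans ?_ htail'
      exact_mod_cast (by omega)
    · rw [← hd, insertEntry_snd, neg_one_mul]
      refine (abs_add_le _ _).trans ((add_le_add_left (abs_add_le _ _) _).trans ?_)
      have h1 := hTpval (d - unitVec n k v)
      have h2 : |if d - unitVec n k v = d - unitVec n k u ∧
          ∀ w, ((d - unitVec n k v) w).val ≤ R w then T.2 d else 0| ≤ 2 ^ l.length := by
        split_ifs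
        · exact hTval
        · simp
      rw [abs_neg]
      linarith
    · rintro τ₂ - - ⟨hQ1, hQ2, hQ3⟩
      refine ⟨?_, ?_, ?_⟩
      · have htake : T.1.take (base + t + 1 - base) = T.1.take t ++ [d] := by
          rw [show base + t + 1 - base = t + 1 by omega, List.take_add_one,
            List.getElem?_eq_getElem ht]
          rfl
        rw [htake, expandKeys_concat, expandEntry]
        rw [neg_one_mul, ← hd] at hQ1
        exact hQ1.congr (by simp) (fun _ _ _ _ => rfl) rfl rfl
      · intro s hs w hw
        rw [State.setReg_arr, hQ3 _ (by exact_mod_cast (by omega)) w hw]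
        exact hrow₁ s hs w hw
      · intro s hs
        rw [State.setReg_arr, hQ2 _ (by exact_mod_cast (by omega))]
        exact hval₁ s hs
  · rw [Nat.add_sub_cancel_left]
    gcongr
  · rintro τ hbτ hf ⟨⟨hI1, -, -⟩, -⟩
    rw [Nat.add_sub_cancel_left, List.take_length] at hI1
    have h7 : τ.reg 7 = ((base + T.1.length : ℕ) : ℤ) := (hf.reg 7 rfl).trans h7'
    refine Runs.assign hbτ rfl (hbτ.reg 7) fun _ => ?_
    have hlayer := hσ.layer.concat hl
    refine ⟨_, ⟨⟨?_, ?_⟩, ?_, ?_, hI1.congr (by simp) (fun _ _ _ _ => rfl) rfl rfl, hlayer, ?_⟩,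
      hC _ hlayer.nodup hlayer.subset⟩
    · simpa using (hf.reg 0 rfl).trans h0'
    · simpa using (hf.reg 2 rfl).trans h2'
    · rw [State.setReg_reg, if_neg (by decide), hf.reg 5 rfl, h5']
    · simpa [Expr.eval] using h7
    · intro w
      rw [State.setReg_arr, hf.arr 2 rfl]
      exact hA2 w

end

end RandomizedRAM

/-! ### The loop over all edges -/

namespace RandomizedRAM

/-- Positive if the bag in register `9` is the first to contain both ends of the edge with the ends
in registers `10` and `11`. -/
def firstBagTest : Expr :=
  .sub (.mul (.get 0 (.cell (.reg 10) (.reg 11)))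
      (.mul (.get 1 (.cell (.reg 9) (.reg 10))) (.get 1 (.cell (.reg 9) (.reg 11)))))
    (.mul (.get 1 (.cell (.sub (.reg 9) (.lit 1)) (.reg 10)))
      (.get 1 (.cell (.sub (.reg 9) (.lit 1)) (.reg 11))))

/-- Do `c` for all edges in the order of the path decomposition. -/
def forEdges (c : Program) : Program :=
  .forLess 9 1 <| .forLess 10 0 <| .forLess 11 10 <| .ite firstBagTest c .skip

section

open Classical

variable {n k p : ℕ} {G : SimpleGraph (Fin n)}

/-- The numbers of vertices and bags and the two matrices are in their places. -/
structure HoldsInput (P : PathDecomposition G p) (σ : State) : Prop where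
  reg_zero : σ.reg 0 = n
  reg_one : σ.reg 1 = p
  adj : ∀ u < n, ∀ v < n, σ.arr 0 ((u : ℕ) * (n : ℤ) + (v : ℕ)) =
    if ∃ (hu : u < n) (hv : v < n), G.Adj ⟨u, hu⟩ ⟨v, hv⟩ then 1 else 0
  bag : ∀ i : ℕ, ∀ v < n, σ.arr 1 (i * (n : ℤ) + (v : ℕ)) =
    if ∃ (hi : i < p) (hv : v < n), ⟨v, hv⟩ ∈ P.bag ⟨i, hi⟩ then 1 else 0
  bag_neg : ∀ v < n, σ.arr 1 ((-1) * (n : ℤ) + (v : ℕ)) = 0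

theorem cell_inj {u v u' v' : ℕ} (hv : v < n) (hv' : v' < n)
    (h : (u : ℤ) * n + (v : ℤ) = (u' : ℤ) * n + (v' : ℤ)) : u = u' ∧ v = v' := by
  rcases lt_trichotomy (u : ℤ) u' with h1 | h1 | h1
  · exact absurd h (cell_ne h1 hv)
  · refine ⟨by exact_mod_cast h1, ?_⟩
    rw [h1] at h
    exact_mod_cast add_left_cancel h
  · exact absurd h.symm (cell_ne h1 hv')

theorem holdsInput_coloringInput [DecidableRel G.Adj] (P : PathDecomposition G p) (s : ℕ)
    (ω : ℕ → Bool) : HoldsInput P (coloringInput G P k s ω) := by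
  refine ⟨by simp [coloringInput], by simp [coloringInput], fun u hu v hv => ?_,
    fun i v hv => ?_, fun v hv => ?_⟩
  · have hiff : (∃ u' v' : Fin n, ((u : ℕ) : ℤ) * n + (v : ℕ) = ((u' : ℕ) : ℤ) * n + (v' : ℕ) ∧
        G.Adj u' v') ↔ ∃ (hu : u < n) (hv : v < n), G.Adj ⟨u, hu⟩ ⟨v, hv⟩ := by
      constructor
      · rintro ⟨u', v', h, hadj⟩
        obtain ⟨h1, h2⟩ := cell_inj hv v'.2 h
        subst h1 h2
        exact ⟨hu, hv, hadj⟩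
      · rintro ⟨hu, hv, hadj⟩
        exact ⟨⟨u, hu⟩, ⟨v, hv⟩, rfl, hadj⟩
    simp only [coloringInput, if_true]
    by_cases h : ∃ (hu : u < n) (hv : v < n), G.Adj ⟨u, hu⟩ ⟨v, hv⟩
    · rw [if_pos (hiff.2 h), if_pos h]
    · rw [if_neg (fun h' => h (hiff.1 h')), if_neg h]
  · simp only [coloringInput, one_ne_zero, if_false, if_true]
    refine if_congr ⟨?_, ?_⟩ rfl rfl
    · rintro ⟨i', v', h, hmem⟩
      obtain ⟨h1, h2⟩ := cell_inj hv v'.2 h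
      subst h1 h2
      exact ⟨i'.2, hv, hmem⟩
    · rintro ⟨hi, hv, hmem⟩
      exact ⟨⟨i, hi⟩, ⟨v, hv⟩, rfl, hmem⟩
  · simp only [coloringInput, one_ne_zero, if_false, if_true]
    rw [if_neg]
    rintro ⟨i', v', h, -⟩
    have h1 : ((-1 : ℤ)) < ((i' : ℕ) : ℤ) := by omega
    exact cell_ne h1 hv h

theorem HoldsInput.of_frame {P : PathDecomposition G p} {c : Program} {σ τ : State}
    (h : HoldsInput P σ) (hf : Frame c σ τ) (h0 : c.writesReg 0 = false)
    (h1 : c.writesReg 1 = false) (ha0 : c.writesArr 0 = false) (ha1 : c.writesArr 1 = false) :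
    HoldsInput P τ := by
  refine ⟨(hf.reg 0 h0).trans h.reg_zero, (hf.reg 1 h1).trans h.reg_one, ?_, ?_, ?_⟩
  · rw [hf.arr 0 ha0]
    exact h.adj
  · rw [hf.arr 1 ha1]
    exact h.bag
  · rw [hf.arr 1 ha1]
    exact h.bag_neg

theorem HoldsInput.firstBagTest_pos_iff {P : PathDecomposition G p} {σ : State}
    (h : HoldsInput P σ) {i u v : ℕ} (hu : u < n) (hv : v < n) (h9 : σ.reg 9 = i)
    (h10 : σ.reg 10 = u) (h11 : σ.reg 11 = v) :
    0 < firstBagTest.eval σ ↔ FirstBag P i u v := by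
  simp only [firstBagTest, Expr.eval, Expr.cell, h9, h10, h11, h.reg_zero, h.adj u hu v hv,
    h.bag i u hu, h.bag i v hv, FirstBag]
  -- For bag `0` the test reads row `-1` of the incidence matrix. Its addresses are negative and
  -- hold `0`, so the clause about the preceding bag is void, as it should be.
  rcases i with _ | i
  · have h1 := h.bag_neg u hu
    norm_num at h1
    simp [h1]
    split_ifs <;> simp_all
  · have h1 : ((i + 1 : ℕ) : ℤ) - 1 = i := by push_cast; ring
    rw [h1, h.bag i u hu, h.bag i v hv]
    simp only [Nat.add_right_cancel_iff, forall_eq]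
    split_ifs <;> simp_all

theorem Frame.of_forLess_body {c : Program} {σ τ : State} (h : Frame c σ τ) (x y : ℕ) :
    Frame (.forLess x y c) σ τ :=
  h.mono (by simp +contextual [Program.forLess, Program.whileLess, Program.writesReg])
    (by simp +contextual [Program.forLess, Program.whileLess, Program.writesArr])
    (by simp +contextual [Program.forLess, Program.whileLess, Program.tosses])

/-- The invariant is indexed by the list of edges treated so far and must be insensitive to the
three loop counters. The rule serves two passes: counting the degrees and running the dynamic
program. -/
theorem runs_forEdges {X : ℕ} {c : Program}
    (hc : ∀ x, x = 0 ∨ x = 1 ∨ x = 9 ∨ x = 10 ∨ x = 11 → c.writesReg x = false)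
    (hc0 : c.writesArr 0 = false) (hc1 : c.writesArr 1 = false) {σ : State} (hb : Bounded X σ)
    {P : PathDecomposition G p} (hin : HoldsInput P σ) (I : List (ℕ × ℕ) → State → Prop)
    (hI : ∀ l τ x z, x = 9 ∨ x = 10 ∨ x = 11 → I l τ → I l (τ.setReg x z)) {N : ℕ} (hN : 1 ≤ N)
    (h0 : I [] σ)
    (step : ∀ (i u v : ℕ) (τ : State), i < p → u < n → v < u → FirstBag P i u v → Bounded X τ →
      Frame (forEdges c) σ τ → τ.reg 10 = u → τ.reg 11 = v → I (edgesBefore P i u v) τ →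
      Runs X c τ N (I (edgesBefore P i u v ++ [(u, v)]))) :
    Runs X (forEdges c) σ (p * (n * (n * (N + 3) + 4) + 4) + 2) (I (edgeList P)) := by
  have w0 := hc 0 (by simp)
  have w1 := hc 1 (by simp)
  have w9 := hc 9 (by simp)
  have w10 := hc 10 (by simp)
  have w11 := hc 11 (by simp)
  refine (Runs.forLess (fun i τ => I (edgesBefore P i 0 0) τ) p (n * (n * (N + 3) + 4) + 2)
    (by decide) ?_ ?_ hin.reg_one hb ?_ ?_).mono (le_of_eq (by ring)) (fun _ _ _ h => h.1)
  · simp [Program.forLess, Program.whileLess, Program.writesReg, w9]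
  · simp [Program.forLess, Program.whileLess, Program.writesReg, w1]
  · rw [edgesBefore_zero]
    exact hI _ _ _ _ (by simp) h0
  intro i τ hi h9 _ hf hb hIi
  have hin1 : HoldsInput P τ := by
    refine hin.of_frame hf ?_ ?_ ?_ ?_ <;>
      simp [Program.forLess, Program.whileLess, Program.writesReg, Program.writesArr, w0, w1, hc0,
        hc1]
  refine (Runs.forLess (fun u τ => I (edgesBefore P i u 0) τ) n (n * (N + 3) + 2)
    (by decide) ?_ ?_ hin1.reg_zero hb (hI _ _ _ _ (by simp) hIi) ?_).mono le_rfl ?_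
  · simp [Program.forLess, Program.whileLess, Program.writesReg, w10]
  · simp [Program.forLess, Program.whileLess, Program.writesReg, w0]
  rotate_left
  · rintro τ' - - ⟨h, -⟩
    rw [edgesBefore_succ_zero_zero]
    exact hI _ _ _ _ (by simp) h
  intro u τ₁ hu h10 _ hf₁ hb₁ hIu
  have h9₁ : τ₁.reg 9 = i := by
    rw [hf₁.reg 9, h9]
    simp [Program.forLess, Program.whileLess, Program.writesReg, w9]
  have hin2 : HoldsInput P τ₁ := by
    refine hin1.of_frame hf₁ ?_ ?_ ?_ ?_ <;>
      simp [Program.forLess, Program.whileLess, Program.writesReg, Program.writesArr, w0, w1, hc0,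
        hc1]
  refine (Runs.forLess (fun v τ => I (edgesBefore P i u v) τ) u (N + 1)
    (by decide) ?_ ?_ h10 hb₁ (hI _ _ _ _ (by simp) hIu) ?_).mono
    (by gcongr) ?_
  · simp [Program.writesReg, w11]
  · simp [Program.writesReg, w10]
  rotate_left
  · rintro τ' - - ⟨h, -⟩
    rw [edgesBefore_succ_zero]
    exact hI _ _ _ _ (by simp) h
  intro v τ₂ hv h11 h10₂ hf₂ hb₂ hIv
  have h9₂ : τ₂.reg 9 = i := by
    rw [hf₂.reg 9, h9₁]
    simp [Program.forLess, Program.whileLess, Program.writesReg, w9]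
  have hin3 : HoldsInput P τ₂ := by
    refine hin2.of_frame hf₂ ?_ ?_ ?_ ?_ <;>
      simp [Program.forLess, Program.whileLess, Program.writesReg, Program.writesArr, w0, w1, hc0,
        hc1]
  have htest := hin3.firstBagTest_pos_iff hu (hv.trans hu) h9₂ h10₂ h11
  refine (Runs.ite (N := N) hb₂ rfl (fun hpos => ?_) fun hneg => ?_).mono (by omega)
    (fun _ _ _ h => h)
  · rw [edgesBefore_succ_of_firstBag P (htest.1 hpos)]
    refine (step i u v τ₂ hi hu hv (htest.1 hpos) hb₂ ?_ h10₂ h11 hIv).mono le_rfl ?_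
    · exact hf.trans (((hf₁.trans (hf₂.of_forLess_body _ _))).of_forLess_body _ _)
    · exact fun _ _ _ h => hI _ _ _ _ (by simp) h
  · rw [edgesBefore_succ_of_not_firstBag P (fun h => absurd (htest.2 h) (not_lt.2 hneg))]
    exact (Runs.skip hb₂ (hI _ _ _ _ (by simp) hIv)).mono hN (fun _ _ _ h => h)

/-- Count the edge with its ends in registers `10` and `11` at both ends. -/
def countEdge : Program :=
  .seq (.store 2 (.reg 10) (.add (.get 2 (.reg 10)) (.lit 1)))
    (.store 2 (.reg 11) (.add (.get 2 (.reg 11)) (.lit 1)))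

theorem runs_countEdges {X : ℕ} {σ : State} (hb : Bounded X σ) {P : PathDecomposition G p}
    (hin : HoldsInput P σ) (h0 : ∀ w < n, σ.arr 2 (w : ℕ) = 0)
    (hX : (edgeList P).length + 1 ≤ X) :
    Runs X (forEdges countEdge) σ (p * (n * (n * 5 + 4) + 4) + 2) fun τ =>
      ∀ w : Fin n, τ.arr 2 (w : ℕ) = remaining P [] w := by
  refine (runs_forEdges (N := 2) (I := fun l τ => ∀ w < n, τ.arr 2 (w : ℕ) = incidences l w) ?_
    rfl rfl hb hin ?_ (by norm_num) (by simpa using h0) ?_).mono le_rfl ?_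
  · rintro x (rfl | rfl | rfl | rfl | rfl) <;> rfl
  · intro l τ x z _ h
    simpa using h
  · intro i u v τ hi hu hv hfirst hb hf h10 h11 hI
    have hlen : ∀ w, ((incidences (edgesBefore P i u v) w : ℕ) : ℤ) + 1 ≤ 2 ^ X := by
      intro w
      have h1 := (List.countP_le_length (p := fun e : ℕ × ℕ => decide (e.1 = w ∨ e.2 = w))
        (l := edgesBefore P i u v)).trans (length_edgesBefore_le P hv.le)
      have h2 : X < 2 ^ X := Nat.lt_two_pow_self
      have h3 : incidences (edgesBefore P i u v) w + 1 ≤ 2 ^ X := by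
        rw [incidences]
        omega
      exact_mod_cast h3
    have hvu : v ≠ u := hv.ne
    refine Runs.mono (N := 1 + 1) ?_ le_rfl (fun _ _ _ h => h)
    refine Runs.store_seq hb rfl rfl ?_ fun hb1 => Runs.store hb1 rfl rfl ?_ fun _ w hw => ?_
    · simp only [Expr.eval, h10, hI u hu]
      rw [abs_of_nonneg (by positivity)]
      exact hlen u
    · simp [Expr.eval, h10, h11, hI v (by omega), hvu]
      rw [abs_of_nonneg (by positivity)]
      exact hlen v
    · simp [Expr.eval, h10, h11, hI u hu, hI v (by omega), hvu, incidences_concat]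
      by_cases hwu : w = u
      · subst hwu
        simp [hvu.symm]
      · by_cases hwv : w = v
        · subst hwv
          simp
        · simp [hwu, hwv, Ne.symm hwu, Ne.symm hwv, hI w hw]
  · intro τ _ _ h w
    simpa [remaining] using h w w.2

end

/-! ### Sampling -/

section

variable {n k : ℕ}

/-- The residue modulo `k` of the number with the binary digits `ω 0, …, ω (t - 1)`. -/
def residue (k : ℕ) (ω : ℕ → Bool) : ℕ → ZMod k
  | 0 => 0
  | t + 1 => residue k ω t + residue k ω t + if ω t then 1 else 0

/-- The vector whose entries are determined by consecutive blocks of `2 * n` coin tosses. -/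
def sample (n k : ℕ) (ω : ℕ → Bool) : Fin n → ZMod k :=
  fun w => residue k (fun i => ω (i + w * (2 * n))) (2 * n)

/-- Toss a coin and append the outcome to the binary number in register `17`, modulo `k`. -/
def tossBit : Program :=
  .seq (.toss 19) <| .seq (.assign 17 (.add (.add (.reg 17) (.reg 17)) (.reg 19))) <|
  .ite (.add (.sub (.reg 17) (.reg 2)) (.lit 1)) (.assign 17 (.sub (.reg 17) (.reg 2))) .skip

/-- Fill the row behind the last entry with random residues. -/
def sampleRow : Program :=
  .forLess 13 0 <| .seq (.assign 17 (.lit 0)) <| .seq (.forLess 18 22 tossBit) <|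
    .store 3 (.cell (.reg 4) (.reg 13)) (.reg 17)

/-- Doubling a residue and adding a bit stays below `2 * k`, so a single subtraction reduces it. -/
theorem val_add_self_add_bit [NeZero k] (x : ZMod k) {c : ℕ} (hc : c ≤ 1) :
    (x + x + (c : ZMod k)).val =
      if k ≤ x.val + x.val + c then x.val + x.val + c - k else x.val + x.val + c := by
  have hlt := ZMod.val_lt x
  have hx : x + x + (c : ZMod k) = ((x.val + x.val + c : ℕ) : ZMod k) := by simp
  split_ifs with h
  · rw [hx]
    conv_lhs => rw [show x.val + x.val + c = (x.val + x.val + c - k) + k by omega]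
    rw [Nat.cast_add, ZMod.natCast_self, add_zero, ZMod.val_cast_of_lt (by omega)]
  · rw [hx, ZMod.val_cast_of_lt (by omega)]

theorem runs_tossBit [NeZero k] {X : ℕ} {σ : State} (hb : Bounded X σ) (h2 : σ.reg 2 = k)
    (hX : 2 * (k : ℤ) ≤ 2 ^ X) {x : ZMod k} (h17 : σ.reg 17 = x.val) :
    Runs X tossBit σ 4 fun τ =>
      τ.reg 17 = ((x + x + if σ.coins 0 then 1 else 0 : ZMod k).val : ℕ) ∧
      ∀ i, τ.coins i = σ.coins (i + 1) := by
  refine Runs.mono (N := 1 + (1 + (1 + 1))) ?_ (by omega) (fun _ _ _ h => h)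
  have hlt : (x.val : ℤ) < k := by exact_mod_cast ZMod.val_lt x
  set c : ℕ := if σ.coins 0 then 1 else 0 with hc
  have hc1 : c ≤ 1 := by rw [hc]; split_ifs <;> simp
  have hcZ : (if σ.coins 0 then 1 else 0 : ZMod k) = (c : ZMod k) := by rw [hc]; simp
  have hcI : (if σ.coins 0 then 1 else 0 : ℤ) = (c : ℤ) := by rw [hc]; simp
  have hval := val_add_self_add_bit x hc1
  rw [hcZ]
  refine Runs.toss_seq hb fun hb1 => ?_
  refine Runs.assign_seq hb1 rfl ?_ fun hb2 => ?_
  · simp only [Expr.eval, State.toss_reg, hcI]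
    norm_num [h17, -ZMod.natCast_val]
    rw [abs_of_nonneg (by positivity)]
    omega
  refine Runs.ite hb2 rfl (fun hpos => ?_) fun hneg => ?_
  · simp only [Expr.eval, State.toss_reg, State.setReg_reg, hcI] at hpos
    norm_num [h17, h2, -ZMod.natCast_val] at hpos
    rw [if_pos (by omega)] at hval
    have hres : (Expr.sub (.reg 17) (.reg 2)).eval
        ((σ.toss 19).setReg 17 ((Expr.add (.add (.reg 17) (.reg 17)) (.reg 19)).eval
          (σ.toss 19))) = ((x + x + (c : ZMod k)).val : ℤ) := by
      simp only [Expr.eval, State.toss_reg, State.setReg_reg, hcI]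
      norm_num [h17, h2, hval, -ZMod.natCast_val]
      omega
    refine Runs.assign hb2 rfl ?_ fun _ => ⟨?_, fun i => rfl⟩
    · rw [hres, Nat.abs_cast]
      have := ZMod.val_lt (x + x + (c : ZMod k))
      omega
    · rw [hres]
      simp
  · simp only [Expr.eval, State.toss_reg, State.setReg_reg, hcI] at hneg
    norm_num [h17, h2, -ZMod.natCast_val] at hneg
    rw [if_neg (by omega)] at hval
    refine Runs.skip hb2 ⟨?_, fun i => rfl⟩
    simp only [Expr.eval, State.toss_reg, State.setReg_reg, hcI]
    norm_num [h17, hval, -ZMod.natCast_val]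

/-- Each entry uses `2 * n` tosses, so the row uses exactly `n * (2 * n)`, whatever their outcomes.
Hence different trials read disjoint blocks of the coin sequence at fixed places. -/
theorem runs_sampleRow [NeZero k] {X : ℕ} {σ : State} (hb : Bounded X σ) (hh : Header n k σ)
    (h22 : σ.reg 22 = ((2 * n : ℕ) : ℤ)) (hX : 2 * (k : ℤ) ≤ 2 ^ X) :
    Runs X sampleRow σ (n * (n * 12 + 6) + 2) fun τ =>
      RowIs τ (σ.reg 4) (sample n k σ.coins) ∧
      (∀ i, τ.coins i = σ.coins (i + n * (2 * n))) ∧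
      ∀ s : ℤ, s < σ.reg 4 → ∀ w < n, τ.arr 3 (s * n + (w : ℕ)) = σ.arr 3 (s * n + (w : ℕ)) := by
  refine (Runs.forLess (fun i τ =>
    (∀ w < i, τ.arr 3 (σ.reg 4 * n + (w : ℕ)) = digit (sample n k σ.coins) w) ∧
    (∀ j, τ.coins j = σ.coins (j + i * (2 * n))) ∧
    ∀ s : ℤ, s < σ.reg 4 → ∀ w < n, τ.arr 3 (s * n + (w : ℕ)) = σ.arr 3 (s * n + (w : ℕ)))
    n (n * 12 + 4) (by decide) rfl rfl hh.reg_zero hb (by simp) ?_).mono (by ring_nf; omega) ?_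
  · rintro i τ hi h13 h0 hf hb ⟨hI, hcoins, hrest⟩
    have h4 : τ.reg 4 = σ.reg 4 := hf.reg 4 rfl
    refine Runs.mono (N := 1 + ((2 * n * (4 + 2) + 2) + 1)) ?_ (by ring_nf; omega)
      (fun _ _ _ h => h)
    refine Runs.assign_seq hb rfl (by simp [Expr.eval]) fun hb1 => ?_
    refine Runs.seq (Runs.forLess (fun t υ =>
      υ.reg 17 = ((residue k τ.coins t).val : ℕ) ∧ ∀ j, υ.coins j = τ.coins (j + t))
      (2 * n) 4 (by decide) rfl rfl (by simpa [h22] using hf.reg 22 rfl) hb1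
      (by simp [residue, Expr.eval]) ?_) ?_
    · rintro t υ ht - - hfυ hbυ ⟨h17, hcυ⟩
      have h2 : υ.reg 2 = k := by
        rw [hfυ.reg 2 rfl]
        simpa [hh.reg_two] using hf.reg 2 rfl
      refine (runs_tossBit hbυ h2 hX h17).mono le_rfl ?_
      rintro ρ - - ⟨h1, h2⟩
      refine ⟨?_, fun j => ?_⟩
      · rw [State.setReg_reg, if_neg (by decide), h1, hcυ, zero_add]
        rfl
      · rw [State.setReg_coins, h2, hcυ, add_assoc, add_comm 1 t]
    · rintro υ hbυ hfυ ⟨⟨h17, hcυ⟩, -⟩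
      have h4υ : υ.reg 4 = σ.reg 4 := by simpa [h4] using hfυ.reg 4 rfl
      have h0υ : υ.reg 0 = n := by simpa [h0] using hfυ.reg 0 rfl
      have h13υ : υ.reg 13 = i := by simpa [h13] using hfυ.reg 13 rfl
      have hA : υ.arr 3 = τ.arr 3 := by simpa using hfυ.arr 3 rfl
      have hdig : υ.reg 17 = digit (sample n k σ.coins) i := by
        rw [h17, digit, dif_pos hi, sample]
        have : τ.coins = fun j => σ.coins (j + i * (2 * n)) := funext hcoins
        rw [this]
      refine Runs.store hbυ rfl rfl (hbυ.reg 17) fun _ => ⟨fun w hw => ?_, fun j => ?_,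
        fun s hs w hw => ?_⟩
      · simp only [Expr.eval, Expr.cell, h13υ, h0υ, h4υ, hdig, State.setReg_arr,
          State.setArr_arr, true_and, add_right_inj, Nat.cast_inj, hA]
        split_ifs with hwi
        · rw [hwi]
        · exact hI w (by omega)
      · rw [State.setReg_coins, State.setArr_coins, hcυ, hcoins]
        congr 1
        ring
      · have := cell_ne (w' := i) hs hw
        simp only [Expr.eval, Expr.cell, h13υ, h0υ, h4υ, State.setReg_arr, State.setArr_arr,
          true_and, this, if_false, hA]
        exact hrest s hs w hw
  · rintro τ - - ⟨⟨h1, h2, h3⟩, -⟩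
    exact ⟨h1, h2, h3⟩

end

end RandomizedRAM

/-! ### The algorithm -/

namespace RandomizedRAM

/-- If the last layer holds a nonzero value, set register `20` to `1`. -/
def checkResult : Program :=
  .ite (.sub (.reg 4) (.reg 6))
    (.ite (.mul (.get 4 (.reg 6)) (.get 4 (.reg 6))) (.assign 20 (.lit 1)) .skip) .skip

/-- Compute the coefficient at a random demand. -/
def trial : Program :=
  .seq (forEdges countEdge) <| .seq (.assign 6 (.reg 4)) <|
  .seq (.assign 5 (.add (.reg 5) (.lit 1))) <| .seq sampleRow <|
  .seq (.assign 16 (.lit 1)) <| .seq insertRow <| .seq (forEdges processEdge) checkResult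

/-- Replace the number in register `3` by the minimum of itself and `k ^ n`. -/
def capTrials : Program :=
  .seq (.assign 23 (.lit 1)) <|
  .seq (.forLess 13 0 (.assign 23 (.mul (.reg 23) (.reg 2)))) <|
  .seq (.ite (.sub (.reg 3) (.reg 23)) (.assign 3 (.reg 23)) .skip) <|
  .assign 22 (.add (.reg 0) (.reg 0))

/-- Decide whether the graph is colorable with `k` colors: the answer is Yes if there are at least
as many colors as vertices, or if one of the trials finds a nonzero coefficient. -/
def coloringAlgorithm : Program :=
  .ite (.add (.sub (.reg 2) (.reg 0)) (.lit 1)) (.assign 0 (.lit 1)) <|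
    .seq capTrials <| .seq (.forLess 8 3 trial) <| .assign 0 (.reg 20)

section

variable {n k p : ℕ} {G : SimpleGraph (Fin n)}

/-- The memory between two trials; rows from `tail` on and codes of steps after `g` are unused. -/
structure Ready (k : ℕ) (P : PathDecomposition G p) (g tail : ℕ) (σ : State) : Prop where
  header : Header n k σ
  input : HoldsInput P σ
  reg_twentytwo : σ.reg 22 = ((2 * n : ℕ) : ℤ)
  reg_five : σ.reg 5 = g
  reg_four : σ.reg 4 = tail
  arr_two : ∀ w < n, σ.arr 2 (w : ℕ) = 0
  fresh : ∀ z : ℤ, ((g : ℤ) + 1) * k ^ n ≤ z → σ.arr 5 z = 0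

theorem HoldsTable.setReg {σ : State} {g base : ℕ}
    {T : List (Fin n → ZMod k) × ((Fin n → ZMod k) → ℤ)} (h : HoldsTable σ g base T) {x : ℕ}
    (hx : x ≠ 4) (z : ℤ) : HoldsTable (σ.setReg x z) g base T :=
  h.congr (by simp [hx.symm]) (fun _ _ _ _ => rfl) rfl rfl

theorem HoldsLayer.setReg {P : PathDecomposition G p} {a : Fin n → ZMod k} {l : List (ℕ × ℕ)}
    {g base : ℕ} {T : List (Fin n → ZMod k) × ((Fin n → ZMod k) → ℤ)} {σ : State}
    (h : HoldsLayer P a l g base T σ) {x : ℕ} (hx : 7 ≤ x) (z : ℤ) :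
    HoldsLayer P a l g base T (σ.setReg x z) := by
  refine ⟨⟨?_, ?_⟩, ?_, ?_, h.table.setReg (by omega) z, h.layer, h.arr_two⟩
  · rw [State.setReg_reg, if_neg (by omega), h.header.reg_zero]
  · rw [State.setReg_reg, if_neg (by omega), h.header.reg_two]
  · rw [State.setReg_reg, if_neg (by omega), h.reg_five]
  · rw [State.setReg_reg, if_neg (by omega), h.reg_six]

/-- After the last edge the only possible key is `0`, so the layer is either empty, with coefficient
zero, or its first row holds the coefficient. The machine tests the square, which is positive
exactly for nonzero values. -/
theorem runs_checkResult {X : ℕ} {σ : State} (hb : Bounded X σ) {P : PathDecomposition G p}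
    {a : Fin n → ZMod k} {g base : ℕ} {T : List (Fin n → ZMod k) × ((Fin n → ZMod k) → ℤ)}
    (hσ : HoldsLayer P a (edgeList P) g base T σ) :
    Runs X checkResult σ 3 fun τ =>
      τ.reg 20 = if demandCoeff a (edgeList P) 0 ≠ 0 then 1 else σ.reg 20 := by
  have htail := hσ.table.tail
  push_cast at htail
  refine Runs.mono (N := 1 + (1 + 1)) ?_ (by omega) (fun _ _ _ h => h)
  refine Runs.ite hb rfl (fun hpos => ?_) fun hneg => ?_
  · simp [Expr.eval, htail, hσ.reg_six] at hpos
    have hlen : 0 < T.1.length := hpos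
    have h0 : σ.arr 4 base = demandCoeff a (edgeList P) 0 := by
      have := hσ.table.val 0 hlen
      rw [hσ.layer.eq_zero_of_mem (List.getElem_mem hlen), hσ.layer.snd_zero] at this
      simpa using this
    refine Runs.ite hb rfl (fun hpos => ?_) fun hneg => ?_
    · simp only [Expr.eval, hσ.reg_six, h0] at hpos
      refine Runs.assign hb rfl (by simpa [Expr.eval] using hb.one_le) fun _ => ?_
      rw [if_pos (fun h => by simp [h] at hpos)]
      simp [Expr.eval]
    · simp only [Expr.eval, hσ.reg_six, h0] at hneg
      refine Runs.skip hb ?_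
      rw [if_neg]
      simp only [ne_eq, not_not]
      nlinarith
  · simp [Expr.eval, htail, hσ.reg_six] at hneg
    have h0 : demandCoeff a (edgeList P) 0 = 0 := by
      rw [← hσ.layer.snd_zero]
      exact hσ.layer.eq_zero _ (by simp [hneg])
    refine (Runs.skip hb ?_).mono (by omega) (fun _ _ _ h => h)
    simp [h0]

/-- A bound for the number of steps of a trial, if the layers have at most `C` entries. -/
def trialSteps (n p C : ℕ) : ℕ :=
  p * (n * (n * 5 + 4) + 4) + n * (n * 12 + 6) + n * 6 +
    p * (n * (n * (C * (n * 18 + 42) + 10) + 4) + 4) + 22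

/-- A trial builds one initial layer and one layer for each edge. It therefore consumes `(edgeList
P).length + 1` step numbers and at most `C` rows for each of them. -/
theorem runs_trial [NeZero k] [DecidableRel G.Adj] {X : ℕ} {σ : State} (hb : Bounded X σ)
    {P : PathDecomposition G p} {g tail C : ℕ} (hσ : Ready k P g tail σ)
    (hC : C = (G.maxDegree / 2 + 1) ^ (P.width + 1))
    (hX : ((g : ℤ) + (edgeList P).length + 2) * k ^ n ≤ 2 ^ X)
    (htail : ((tail + ((edgeList P).length + 2) * C + 2 : ℕ) : ℤ) ≤ 2 ^ X)
    (hlX : (edgeList P).length + 2 ≤ X) (hkX : 2 * (k : ℤ) ≤ 2 ^ X) :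
    Runs X trial σ (trialSteps n p C) fun τ =>
      (∃ tail' ≤ tail + ((edgeList P).length + 1) * C,
        Ready k P (g + (edgeList P).length + 1) tail' τ) ∧
      (∀ i, τ.coins i = σ.coins (i + n * (2 * n))) ∧
      τ.reg 20 = if demandCoeff (sample n k σ.coins) (edgeList P) 0 ≠ 0 then 1
        else σ.reg 20 := by
  have hk : 0 < k := Nat.pos_of_ne_zero (NeZero.ne k)
  have hkn : (1 : ℤ) ≤ k ^ n := one_le_pow₀ (by exact_mod_cast hk)
  have hCpos : 1 ≤ C := by
    rw [hC]
    exact Nat.one_le_pow _ _ (by omega)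
  set m := (edgeList P).length with hm
  have hgX : ∀ {t : ℕ}, t ≤ m + 2 → ((g : ℤ) + t) * k ^ n ≤ 2 ^ X := by
    intro t ht
    refine le_trans (mul_le_mul_of_nonneg_right ?_ (by positivity)) hX
    have : (t : ℤ) ≤ m + 2 := by exact_mod_cast ht
    linarith
  have htX : ∀ {t : ℕ}, t ≤ tail + (m + 2) * C + 2 → (t : ℤ) ≤ 2 ^ X := by
    intro t ht
    exact le_trans (by exact_mod_cast ht) htail
  refine Runs.mono (N := (p * (n * (n * 5 + 4) + 4) + 2) + (1 + (1 + ((n * (n * 12 + 6) + 2) +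
    (1 + ((n * 6 + 10) + ((p * (n * (n * ((C * (n * 18 + 42) + 7) + 3) + 4) + 4) + 2) + 3)))))))
    ?_ (by rw [trialSteps]; ring_nf; omega) (fun _ _ _ h => h)
  refine Runs.seq (runs_countEdges hb hσ.input hσ.arr_two (by omega)) fun τ hbτ hf hR => ?_
  have h4 : τ.reg 4 = tail := (hf.reg 4 rfl).trans hσ.reg_four
  have h5 : τ.reg 5 = g := (hf.reg 5 rfl).trans hσ.reg_five
  have hcoins : τ.coins = σ.coins := hf.coins rfl
  have hA5 : τ.arr 5 = σ.arr 5 := hf.arr 5 rfl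
  have hin : HoldsInput P τ := hσ.input.of_frame hf rfl rfl rfl rfl
  have hh : Header n k τ := hσ.header.of_frame hf rfl rfl
  have h22 : τ.reg 22 = ((2 * n : ℕ) : ℤ) := (hf.reg 22 rfl).trans hσ.reg_twentytwo
  have h20 : τ.reg 20 = σ.reg 20 := hf.reg 20 rfl
  refine Runs.assign_seq hbτ rfl (hbτ.reg 4) fun hb1 => ?_
  refine Runs.assign_seq hb1 rfl ?_ fun hb2 => ?_
  · simp [Expr.eval, h5]
    rw [abs_of_nonneg (by positivity)]
    have := hgX (t := 1) (by omega)
    push_cast at this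
    nlinarith
  set τ₁ : State := (State.setReg _ 5 _) with hτ₁
  have hh1 : Header n k τ₁ := ⟨by simpa [hτ₁] using hh.reg_zero, by simpa [hτ₁] using hh.reg_two⟩
  refine Runs.seq (runs_sampleRow hb2 hh1 (by simpa [hτ₁] using h22) hkX)
    fun τ₂ hb₂ hf₂ ⟨hrow, hcoins₂, hrest⟩ => ?_
  have hco : τ₁.coins = σ.coins := by simp [hτ₁, hcoins]
  rw [hco] at hrow hcoins₂
  have h4₁ : τ₁.reg 4 = tail := by simp [hτ₁, h4]
  have h4₂ : τ₂.reg 4 = tail := (hf₂.reg 4 rfl).trans h4₁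
  rw [h4₁] at hrow
  have h5₂ : τ₂.reg 5 = ((g + 1 : ℕ) : ℤ) := by
    rw [hf₂.reg 5 rfl]
    simp [hτ₁, Expr.eval, h5]
  have h6₂ : τ₂.reg 6 = tail := by
    rw [hf₂.reg 6 rfl]
    simp [hτ₁, Expr.eval, h4]
  have hA5₂ : τ₂.arr 5 = σ.arr 5 := by
    rw [hf₂.arr 5 rfl]
    simpa [hτ₁] using hA5
  have hA2₂ : ∀ w : Fin n, τ₂.arr 2 (w : ℕ) = remaining P [] w := by
    intro w
    rw [hf₂.arr 2 rfl]
    simpa [hτ₁] using hR w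
  have hh2 : Header n k τ₂ := hh1.of_frame hf₂ rfl rfl
  have hin₂ : HoldsInput P τ₂ := by
    refine HoldsInput.of_frame ?_ hf₂ rfl rfl rfl rfl
    exact ⟨by simpa [hτ₁] using hin.reg_zero, by simpa [hτ₁] using hin.reg_one, hin.adj, hin.bag,
      hin.bag_neg⟩
  have h22₂ : τ₂.reg 22 = ((2 * n : ℕ) : ℤ) := by
    rw [hf₂.reg 22 rfl]
    simpa [hτ₁] using h22
  have h20₂ : τ₂.reg 20 = σ.reg 20 := by
    rw [hf₂.reg 20 rfl]
    simpa [hτ₁] using h20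
  clear_value τ₁
  set a := sample n k σ.coins with ha
  have htable : HoldsTable (τ₂.setReg 16 1) (g + 1) tail
      (([], fun _ => 0) : List (Fin n → ZMod k) × ((Fin n → ZMod k) → ℤ)) := by
    refine HoldsTable.setReg ⟨by simpa using h4₂, fun t ht => by simp at ht,
      fun t ht => by simp at ht, fun d => ?_, fun z hz => ?_⟩ (by decide) _
    · rw [hA5₂, hσ.fresh]
      · simp
      · have := le_encode (g + 1) d n
        push_cast at this
        exact this
    · rw [hA5₂, hσ.fresh]
      refine le_trans ?_ hz
      push_cast
      nlinarith
  refine Runs.assign_seq hb₂ rfl (by simpa [Expr.eval] using hb.one_le) fun hb3 => ?_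
  simp only [Expr.eval] at hb3 ⊢
  refine Runs.seq (runs_insertRow hb3 ⟨by simpa using hh2.reg_zero, by simpa using hh2.reg_two⟩
    (by simpa using h5₂) ?_ isTable_empty htable (R := remaining P []) (d := a) (z := 1) hA2₂
    (by simp) ?_ ?_ ?_) fun τ₃ hb₃ hf₃ ⟨htab, _⟩ => ?_
  · have := hgX (t := 2) (by omega)
    push_cast at this ⊢
    linarith
  · simpa [h4₂, RowIs] using hrow
  · exact htX (by simp; omega)
  · simpa using hb.one_le
  have hlayer := isLayer_nil P a
  set T₀ := insertEntry (remaining P []) (([], fun _ => 0) :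
    List (Fin n → ZMod k) × ((Fin n → ZMod k) → ℤ)) a 1 with hT₀
  have hT₀C : T₀.1.length ≤ C := by
    refine (length_insertEntry_le _ _ _ _).trans ?_
    simpa using hCpos
  have hholds : HoldsLayer P a [] (g + 1) tail T₀ τ₃ := by
    refine ⟨⟨?_, ?_⟩, ?_, ?_, htab, hlayer, ?_⟩
    · simpa [hh2.reg_zero] using hf₃.reg 0 rfl
    · simpa [hh2.reg_two] using hf₃.reg 2 rfl
    · rw [hf₃.reg 5 rfl]
      simpa using h5₂
    · rw [hf₃.reg 6 rfl]
      simpa using h6₂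
    · intro w
      rw [hf₃.arr 2 rfl]
      exact hA2₂ w
  have hin₃ : HoldsInput P τ₃ := by
    refine HoldsInput.of_frame ?_ hf₃ rfl rfl rfl rfl
    exact ⟨by simpa using hin₂.reg_zero, by simpa using hin₂.reg_one, hin₂.adj, hin₂.bag,
      hin₂.bag_neg⟩
  -- Each edge raises the step number by one and adds at most `C` rows.
  refine Runs.seq (runs_forEdges (c := processEdge) (N := C * (n * 18 + 42) + 7)
    (I := fun l τ => ∃ base T, HoldsLayer P a l (g + 1 + l.length) base T τ ∧ T.1.length ≤ C ∧
      base ≤ tail + l.length * C)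
    (by rintro x (rfl | rfl | rfl | rfl | rfl) <;> rfl) rfl rfl hb₃ hin₃ ?_ (by omega)
    ⟨tail, T₀, hholds, hT₀C, by simp⟩ ?_) ?_
  · rintro l τ x z hx ⟨base, T, h, hT, hbase⟩
    exact ⟨base, T, h.setReg (by omega) z, hT, hbase⟩
  · rintro i u v τ hi hu hv hfirst hbτ - h10 h11 ⟨base, T, h, hT, hbase⟩
    have hnext := edgesBefore_succ_of_firstBag P hfirst
    have hlen : (edgesBefore P i u v).length + 1 ≤ m := by
      have := length_edgesBefore_le P (i := i) (Nat.succ_le_of_lt hv)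
      rwa [Nat.succ_eq_add_one, hnext, List.length_append, List.length_singleton] at this
    have hmul : (edgesBefore P i u v).length * C + C ≤ m * C := by
      rw [← Nat.succ_mul]
      exact Nat.mul_le_mul_right C hlen
    refine (runs_processEdge (C := C) hbτ h hu hv h10 h11 (fun w => ?_) (fun L hL hsub => ?_) hT
      ?_ ?_ (by omega)).mono le_rfl ?_
    · rw [← hnext]
      exact incidences_edgesBefore_le P (Nat.succ_le_of_lt hv) w
    · rw [hC]
      rw [← hnext] at hsub
      exact length_le_of_subset_demandBox P hi a hL hsub
    · have := hgX (t := 1 + (edgesBefore P i u v).length + 2) (by omega)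
      push_cast at this ⊢
      linarith
    · refine htX ?_
      rw [add_mul]
      omega
    · rintro τ' - - ⟨T', h', hT'⟩
      refine ⟨base + T.1.length, T', ?_, hT', ?_⟩
      · rw [List.length_append, List.length_singleton, ← add_assoc]
        exact h'
      · rw [List.length_append, List.length_singleton, add_mul]
        omega
  · rintro τ₄ hb₄ hf₄ ⟨base, T, h, hT, hbase⟩
    refine (runs_checkResult hb₄ h).mono le_rfl fun τ₅ hb₅ hf₅ h20' => ?_
    rw [← hm] at hbase
    refine ⟨⟨base + T.1.length, ?_, ⟨?_, ?_, ?_, ?_, ?_, ?_, ?_⟩⟩, ?_, ?_⟩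
    · rw [add_mul]
      omega
    · exact h.header.of_frame hf₅ rfl rfl
    · exact (hin₃.of_frame hf₄ rfl rfl rfl rfl).of_frame hf₅ rfl rfl rfl rfl
    · rw [hf₅.reg 22 rfl, hf₄.reg 22 rfl, hf₃.reg 22 rfl]
      simpa using h22₂
    · rw [hf₅.reg 5 rfl, h.reg_five]
      push_cast
      ring
    · rw [hf₅.reg 4 rfl, h.table.tail]
    · intro w hw
      rw [hf₅.arr 2 rfl]
      -- All edges have been subtracted again, so the counters in array `2` are back at zero for the
      -- next trial.
      have := h.arr_two ⟨w, hw⟩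
      simpa [remaining] using this
    · intro z hz
      rw [hf₅.arr 5 rfl]
      refine h.table.fresh z (le_trans (le_of_eq ?_) hz)
      push_cast
      ring
    · intro i
      rw [hf₅.coins rfl, hf₄.coins rfl, hf₃.coins rfl]
      exact hcoins₂ i
    · rw [h20', hf₄.reg 20 rfl, hf₃.reg 20 rfl]
      simp [h20₂]

theorem runs_trials [NeZero k] [DecidableRel G.Adj] {X : ℕ} {σ : State} (hb : Bounded X σ)
    {P : PathDecomposition G p} {C S : ℕ} (hσ : Ready k P 0 0 σ)
    (hC : C = (G.maxDegree / 2 + 1) ^ (P.width + 1)) (hS : σ.reg 3 = S) (h20 : σ.reg 20 = 0)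
    (hX : ((S * ((edgeList P).length + 1) + 1) * k ^ n : ℕ) ≤ (2 : ℤ) ^ X)
    (htail : ((S * ((edgeList P).length + 1) * C + C + 2 : ℕ) : ℤ) ≤ 2 ^ X)
    (hlX : (edgeList P).length + 2 ≤ X) (hkX : 2 * (k : ℤ) ≤ 2 ^ X) :
    Runs X (.forLess 8 3 trial) σ (S * (trialSteps n p C + 2) + 2) fun τ =>
      τ.reg 20 = if ∃ j < S, demandCoeff
        (sample n k fun i => σ.coins (i + j * (n * (2 * n)))) (edgeList P) 0 ≠ 0 then 1 else 0 := by
  classical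
  set m := (edgeList P).length with hm
  refine (Runs.forLess (fun j τ => (∃ tail ≤ j * (m + 1) * C, Ready k P (j * (m + 1)) tail τ) ∧
    (∀ i, τ.coins i = σ.coins (i + j * (n * (2 * n)))) ∧
    τ.reg 20 = if ∃ j' < j, demandCoeff
        (sample n k fun i => σ.coins (i + j' * (n * (2 * n)))) (edgeList P) 0 ≠ 0 then 1 else 0)
    S (trialSteps n p C) (by decide) rfl rfl hS hb ?_ ?_).mono le_rfl ?_
  · refine ⟨⟨0, by simp, ⟨⟨?_, ?_⟩, ⟨?_, ?_, hσ.input.adj, hσ.input.bag, hσ.input.bag_neg⟩,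
      ?_, ?_, ?_, hσ.arr_two, ?_⟩⟩, by simp, by simp [h20]⟩
    · simpa using hσ.header.reg_zero
    · simpa using hσ.header.reg_two
    · simpa using hσ.input.reg_zero
    · simpa using hσ.input.reg_one
    · simpa using hσ.reg_twentytwo
    · simpa using hσ.reg_five
    · simpa using hσ.reg_four
    · simpa using hσ.fresh
  · rintro j τ hj h8 - hf hbτ ⟨⟨tail, hle, hready⟩, hcoins, h20'⟩
    have h1 : j * (m + 1) + (m + 1) ≤ S * (m + 1) := by
      rw [← Nat.succ_mul]
      exact Nat.mul_le_mul_right _ hj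
    have h2 : j * (m + 1) * C + (m + 1) * C ≤ S * (m + 1) * C := by
      rw [← add_mul]
      exact Nat.mul_le_mul_right _ h1
    refine (runs_trial (C := C) hbτ hready hC ?_ ?_ hlX hkX).mono le_rfl ?_
    · rw [← hm]
      refine le_trans ?_ hX
      have h3 : (j * (m + 1) + m + 2) * k ^ n ≤ (S * (m + 1) + 1) * k ^ n :=
        Nat.mul_le_mul_right _ (by omega)
      exact_mod_cast h3
    · rw [← hm]
      refine le_trans ?_ htail
      have : (m + 2) * C = (m + 1) * C + C := by ring
      exact_mod_cast (by omega)
    · rintro τ' - - ⟨⟨tail', hle', hr⟩, hco, h20''⟩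
      have hg : j * (m + 1) + m + 1 = (j + 1) * (m + 1) := by ring
      rw [← hm] at hle'
      rw [← hm, hg] at hr
      refine ⟨⟨tail', ?_, ⟨⟨?_, ?_⟩, ⟨?_, ?_, hr.input.adj, hr.input.bag, hr.input.bag_neg⟩,
        ?_, ?_, ?_, hr.arr_two, hr.fresh⟩⟩, ?_, ?_⟩
      · have : (j + 1) * (m + 1) * C = j * (m + 1) * C + (m + 1) * C := by ring
        omega
      · simpa using hr.header.reg_zero
      · simpa using hr.header.reg_two
      · simpa using hr.input.reg_zero
      · simpa using hr.input.reg_one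
      · simpa using hr.reg_twentytwo
      · simpa using hr.reg_five
      · simpa using hr.reg_four
      · intro i
        rw [State.setReg_coins, hco, hcoins]
        congr 1
        ring
      · rw [State.setReg_reg, if_neg (by decide), h20'', h20', show τ.coins =
          fun i => σ.coins (i + j * (n * (2 * n))) from funext hcoins]
        by_cases hj' : demandCoeff (sample n k fun i => σ.coins (i + j * (n * (2 * n))))
            (edgeList P) 0 = 0
        · rw [if_neg (not_not.2 hj')]
          refine if_congr ⟨fun ⟨i, hi, h⟩ => ⟨i, by omega, h⟩, fun ⟨i, hi, h⟩ => ⟨i, ?_, h⟩⟩ rfl rfl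
          rcases Nat.lt_succ_iff_lt_or_eq.1 hi with hi | rfl
          · exact hi
          · exact absurd hj' h
        · rw [if_pos hj', if_pos ⟨j, Nat.lt_succ_self j, hj'⟩]
  · rintro τ - - ⟨⟨-, -, h⟩, -⟩
    exact h

end

end RandomizedRAM

/-! ### Correctness and running time of the whole algorithm -/

namespace RandomizedRAM

section

variable {n k p : ℕ} {G : SimpleGraph (Fin n)}

/-- The cap keeps the later costs free of the bit length of `s`: without it the time would contain
`s` times a logarithm of `s`. No success probability is lost, since there are at most `k ^ n`
colorings. -/
theorem runs_capTrials [NeZero k] {X s : ℕ} {σ : State} (hb : Bounded X σ) (hh : Header n k σ)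
    (hs : σ.reg 3 = s) (hX : ((k ^ n : ℕ) : ℤ) ≤ 2 ^ X) (hnX : 2 * (n : ℤ) ≤ 2 ^ X) :
    Runs X capTrials σ (n * 3 + 6) fun τ => τ.reg 3 = ((min s (k ^ n) : ℕ) : ℤ) ∧
      τ.reg 13 = n ∧ τ.reg 22 = ((2 * n : ℕ) : ℤ) ∧ τ.reg 23 = ((k ^ n : ℕ) : ℤ) := by
  have hk : 0 < k := Nat.pos_of_ne_zero (NeZero.ne k)
  refine Runs.mono (N := 1 + ((n * (1 + 2) + 2) + ((1 + 1) + 1))) ?_ (by omega) (fun _ _ _ h => h)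
  refine Runs.assign_seq hb rfl (by simpa [Expr.eval] using hb.one_le) fun hb1 => ?_
  refine Runs.seq (Runs.forLess (fun i τ => τ.reg 23 = ((k ^ i : ℕ) : ℤ)) n 1 (by decide) rfl rfl
    (by simpa using hh.reg_zero) hb1 (by simp [Expr.eval]) ?_) fun τ hbτ hf ⟨h23, h13⟩ => ?_
  · intro i τ hi h13 h0 hf hbτ hI
    have h2 : τ.reg 2 = k := by simpa [hh.reg_two] using hf.reg 2 rfl
    have hev : (Expr.mul (.reg 23) (.reg 2)).eval τ = ((k ^ (i + 1) : ℕ) : ℤ) := by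
      simp [Expr.eval, hI, h2, pow_succ]
    refine Runs.assign hbτ rfl ?_ fun _ => ?_
    · rw [hev, Nat.abs_cast]
      refine le_trans ?_ hX
      exact_mod_cast Nat.pow_le_pow_right hk hi
    · rw [hev]
      simp
  · have h3 : τ.reg 3 = s := by simpa [hs] using hf.reg 3 rfl
    have h0 : τ.reg 0 = n := by simpa [hh.reg_zero] using hf.reg 0 rfl
    refine Runs.seq (Q := fun υ => υ.reg 3 = ((min s (k ^ n) : ℕ) : ℤ) ∧ υ.reg 0 = n ∧
      υ.reg 13 = n ∧ υ.reg 23 = ((k ^ n : ℕ) : ℤ))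
      (Runs.ite hbτ rfl (fun hpos => ?_) fun hneg => ?_) ?_
    · simp only [Expr.eval, h3, h23] at hpos
      have : min s (k ^ n) = k ^ n := min_eq_right (by omega)
      refine Runs.assign hbτ rfl (hbτ.reg 23) fun _ => ?_
      simp [Expr.eval, this, h0, h13, h23]
    · simp only [Expr.eval, h3, h23] at hneg
      have : min s (k ^ n) = s := min_eq_left (by omega)
      exact Runs.skip hbτ ⟨by rw [this, h3], h0, h13, h23⟩
    · rintro υ hbυ - ⟨h3', h0', h13', h23'⟩
      refine Runs.assign hbυ rfl ?_ fun _ => ?_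
      · simp only [Expr.eval, h0']
        rw [abs_of_nonneg (by positivity)]
        linarith
      · simp [Expr.eval, h0', h3', h13', h23']
        ring

theorem bounded_coloringInput [DecidableRel G.Adj] (P : PathDecomposition G p) {X s : ℕ}
    (ω : ℕ → Bool) (h1 : 1 ≤ X) (hn : (n : ℤ) ≤ 2 ^ X) (hp : (p : ℤ) ≤ 2 ^ X)
    (hk : (k : ℤ) ≤ 2 ^ X) (hs : (s : ℤ) ≤ 2 ^ X) : Bounded X (coloringInput G P k s ω) := by
  have hone : (1 : ℤ) ≤ 2 ^ X := one_le_pow₀ (by norm_num)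
  refine ⟨h1, fun x => ?_, fun a z => ?_⟩
  · simp only [coloringInput]
    split_ifs <;> simp [*]
  · simp only [coloringInput]
    split_ifs <;> simp [hone]

theorem natCast_le_two_pow {m X : ℕ} (h : m ≤ X) : (m : ℤ) ≤ 2 ^ X := by
  exact_mod_cast h.trans Nat.lt_two_pow_self.le

theorem natCast_le_two_pow_of_size_le {m X : ℕ} (h : Nat.size m ≤ X) : (m : ℤ) ≤ 2 ^ X := by
  exact_mod_cast (Nat.size_le.1 h).le

theorem pow_le_two_pow_mul {a b n : ℕ} (ha : a ≤ n) (hb : b ≤ n) (h0 : 1 ≤ a) :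
    a ^ b ≤ 2 ^ (n * n) := by
  calc a ^ b ≤ a ^ n := Nat.pow_le_pow_right h0 hb
    _ ≤ (2 ^ n) ^ n := Nat.pow_le_pow_left (ha.trans Nat.lt_two_pow_self.le) n
    _ = 2 ^ (n * n) := by rw [← pow_mul]

theorem width_add_one_le (P : PathDecomposition G p) (hn : 1 ≤ n) : P.width + 1 ≤ n := by
  have : (Finset.univ.sup fun i => (P.bag i).card) ≤ n :=
    Finset.sup_le fun i _ => (Finset.card_le_univ _).trans (by simp)
  rw [PathDecomposition.width]
  omega

theorem maxDegree_div_two_add_one_le [DecidableRel G.Adj] (hn : 1 ≤ n) :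
    G.maxDegree / 2 + 1 ≤ n := by
  have : Nonempty (Fin n) := ⟨⟨0, hn⟩⟩
  have := G.maxDegree_lt_card_verts
  rw [Fintype.card_fin] at this
  omega

theorem trialSteps_mono {n n' p p' C C' : ℕ} (hn : n ≤ n') (hp : p ≤ p') (hC : C ≤ C') :
    trialSteps n p C ≤ trialSteps n' p' C' := by
  unfold trialSteps
  gcongr

/-- `trialSteps` is affine in `C` with nonnegative coefficients. This allows the exponential factor
`(Δ / 2 + 1) ^ width` to be pulled out of the polynomial. -/
theorem trialSteps_mul_le {A : ℕ} (hA : 1 ≤ A) (n p C : ℕ) :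
    trialSteps n p (A * C) ≤ A * trialSteps n p C := by
  have h : ∀ C, trialSteps n p C = (p * (n * (n * 5 + 4) + 4) + n * (n * 12 + 6) + n * 6 +
      p * (n * (n * 10 + 4) + 4) + 22) + C * (p * n * n * (n * 18 + 42)) := by
    intro C
    unfold trialSteps
    ring
  rw [h, h]
  generalize p * (n * (n * 5 + 4) + 4) + n * (n * 12 + 6) + n * 6 +
    p * (n * (n * 10 + 4) + 4) + 22 = a
  rw [mul_add A a, mul_assoc A C]
  exact Nat.add_le_add_right (Nat.le_mul_of_pos_left _ hA) _

/-- The polynomial factor of the time bound. -/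
noncomputable def timePolynomial : Polynomial ℕ :=
  4000 * (3 * Polynomial.X ^ 2 + 2 * Polynomial.X + 4) *
    (Polynomial.X * (Polynomial.X * (Polynomial.X * 5 + 4) + 4) +
      Polynomial.X * (Polynomial.X * 12 + 6) + Polynomial.X * 6 +
      Polynomial.X * (Polynomial.X * (Polynomial.X * (Polynomial.X * (Polynomial.X * 18 + 42) + 10)
        + 4) + 4) + 22 + (3 * Polynomial.X + 14))

theorem eval_timePolynomial (y : ℕ) : timePolynomial.eval y =
    4000 * (3 * y ^ 2 + 2 * y + 4) * (trialSteps y y y + (3 * y + 14)) := by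
  simp [timePolynomial, trialSteps]

theorem outputsWithin_coloringAlgorithm [NeZero k] [DecidableRel G.Adj]
    (P : PathDecomposition G p) {s : ℕ} (hs : 1 ≤ s) (ω : ℕ → Bool) :
    OutputsWithin coloringAlgorithm (coloringInput G P k s ω)
      (if n ≤ k ∨ ∃ j < min s (k ^ n), demandCoeff
        (sample n k fun i => ω (i + j * (n * (2 * n)))) (edgeList P) 0 ≠ 0 then 1 else 0)
      ((G.maxDegree / 2 + 1) ^ P.width * timePolynomial.eval (n + p + Nat.size k) * s) := by
  classical
  have hk : 0 < k := Nat.pos_of_ne_zero (NeZero.ne k)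
  set A := (G.maxDegree / 2 + 1) ^ P.width with hA
  have hA1 : 1 ≤ A := Nat.one_le_pow _ _ (by omega)
  set y := n + p + Nat.size k with hy
  -- `X` bounds the bits during the trials, where every number is at most `8 * Q ^ 3` with `Q = 2 ^
  -- (n * n)`, or `n` or `p`. Before the cap, `k` and `s` themselves are in memory and the larger
  -- `X₀` applies; the single factor `s` of the time bound absorbs `Nat.size s` there.
  set X := 3 * (n * n) + 3 + n + p with hXdef
  set X₀ := X + Nat.size k + Nat.size s with hX₀
  set Z := 3 * y ^ 2 + 2 * y + 4 with hZ
  have hXZ : X + Nat.size k + 1 ≤ Z := by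
    have h1 : n * n ≤ y ^ 2 := by
      rw [pow_two]
      exact Nat.mul_le_mul (by omega) (by omega)
    omega
  have hsizes : Nat.size s ≤ s := Nat.size_le.2 Nat.lt_two_pow_self
  have hX₀Z : X₀ ≤ Z * s := by
    obtain ⟨z, hz⟩ := Nat.exists_eq_add_of_le' (show 1 ≤ Z by omega)
    have h1 : z ≤ z * s := Nat.le_mul_of_pos_right _ hs
    rw [hz, add_mul, one_mul]
    omega
  have hXZs : X ≤ Z * s := by omega
  set σ := coloringInput G P k s ω with hσ
  have hb : Bounded X₀ σ := bounded_coloringInput P ω (by omega)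
    (natCast_le_two_pow (by omega)) (natCast_le_two_pow (by omega))
    (natCast_le_two_pow_of_size_le (by omega)) (natCast_le_two_pow_of_size_le (by omega))
  have hh : Header n k σ := ⟨by simp [hσ, coloringInput], by simp [hσ, coloringInput]⟩
  have hev : (Expr.add (.sub (.reg 2) (.reg 0)) (.lit 1)).eval σ = (k : ℤ) - n + 1 := by
    simp [Expr.eval, hh.reg_zero, hh.reg_two]
  have hcost := hb.cost_le_of_short (e := .add (.sub (.reg 2) (.reg 0)) (.lit 1)) rfl
  rw [eval_timePolynomial, ← hZ]
  -- With `n ≤ k` the machine answers Yes at once. Otherwise `k < n`, so that `k ^ n ≤ 2 ^ (n * n)`.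
  by_cases hnk : n ≤ k
  · rw [if_pos (Or.inl hnk)]
    refine ⟨_, _, .ite_pos (by rw [hev]; omega) (.assign σ 0 (.lit 1)), by simp [Expr.eval], ?_⟩
    have hcost₂ := hb.cost_le_of_short (e := .lit 1) rfl
    have h1 : 4000 * Z * 1 ≤ 4000 * Z * (trialSteps y y y + (3 * y + 14)) :=
      Nat.mul_le_mul_left _ (by omega)
    have h2 : 4000 * Z * 1 ≤ A * (4000 * Z * (trialSteps y y y + (3 * y + 14))) :=
      h1.trans (Nat.le_mul_of_pos_left _ hA1)
    have h3 := Nat.mul_le_mul_right s h2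
    rw [mul_one, mul_assoc] at h3
    omega
  · have hkn : k ≤ n := by omega
    have hn : 1 ≤ n := by omega
    obtain ⟨Q, hQ⟩ : ∃ Q, Q = 2 ^ (n * n) := ⟨_, rfl⟩
    have hQ1 : 1 ≤ Q := by rw [hQ]; exact Nat.one_le_two_pow
    have hknQ : k ^ n ≤ Q := hQ ▸ pow_le_two_pow_mul hkn le_rfl hk
    have hQX : 8 * (Q * Q * Q) ≤ 2 ^ X := by
      have : 8 * (Q * Q * Q) = 2 ^ (3 * (n * n) + 3) := by
        rw [hQ, pow_add, pow_mul']
        ring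
      rw [this]
      exact Nat.pow_le_pow_right (by norm_num) (by omega)
    have hQQ : Q ≤ Q * Q := Nat.le_mul_of_pos_left _ hQ1
    have hQQQ : Q * Q ≤ Q * Q * Q := Nat.le_mul_of_pos_right _ hQ1
    have hXX₀ : (2 : ℤ) ^ X ≤ 2 ^ X₀ := pow_le_pow_right₀ (by norm_num) (by omega)
    have hknX : ((k ^ n : ℕ) : ℤ) ≤ 2 ^ X := by exact_mod_cast (by omega)
    have h2nX : 2 * (n : ℤ) ≤ 2 ^ X := by
      have := natCast_le_two_pow (m := 2 * n) (X := X) (by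
        have : n ≤ n * n := Nat.le_mul_of_pos_left _ hn
        omega)
      exact_mod_cast this
    obtain ⟨τ, t₁, he₁, ht₁, hb₁, h3, h13, h22, h23⟩ := runs_capTrials hb hh (s := s)
      (by simp [hσ, coloringInput]) (hknX.trans hXX₀) (h2nX.trans hXX₀)
    have hf := he₁.frame
    set S := min s (k ^ n) with hS
    have hSQ : S ≤ Q := (min_le_right _ _).trans hknQ
    -- The input with bound `0` in place of `s` is a reference state: apart from register `3`, which
    -- is capped, it agrees with the actual input and satisfies the smaller bound `X`.
    have hbin : Bounded X (coloringInput G P k 0 ω) := bounded_coloringInput P ω (by omega)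
      (natCast_le_two_pow (by omega)) (natCast_le_two_pow (by omega))
      (natCast_le_two_pow (by omega)) (by simp)
    have hbτ : Bounded X τ := by
      refine ⟨by omega, fun x => ?_, fun a z => ?_⟩
      · by_cases hx3 : x = 3
        · rw [hx3, h3, Nat.abs_cast]
          refine le_trans ?_ hknX
          exact_mod_cast min_le_right _ _
        by_cases hx13 : x = 13
        · rw [hx13, h13, Nat.abs_cast]
          exact natCast_le_two_pow (by omega)
        by_cases hx22 : x = 22
        · rw [hx22, h22, Nat.abs_cast]
          exact_mod_cast h2nX
        by_cases hx23 : x = 23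
        · rw [hx23, h23, Nat.abs_cast]
          exact hknX
        rw [hf.reg x (by simp [capTrials, Program.forLess, Program.whileLess, Program.writesReg,
          hx3, hx13, hx22, hx23])]
        have := hbin.reg x
        simpa [hσ, coloringInput, hx3] using this
      · rw [hf.arr a rfl]
        exact hbin.arr a z
    have hm := length_edgeList_le P
    set m := (edgeList P).length with hmdef
    have hmQ : m + 1 ≤ Q := by
      have : n * n < 2 ^ (n * n) := Nat.lt_two_pow_self
      omega
    obtain ⟨C, hC⟩ : ∃ C, C = (G.maxDegree / 2 + 1) ^ (P.width + 1) := ⟨_, rfl⟩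
    have hCQ : C ≤ Q := by
      rw [hC, hQ]
      exact pow_le_two_pow_mul (maxDegree_div_two_add_one_le hn) (width_add_one_le P hn) (by omega)
    have hready : Ready k P 0 0 τ := by
      refine ⟨hh.of_frame hf rfl rfl,
        (holdsInput_coloringInput P s ω).of_frame hf rfl rfl rfl rfl, h22, ?_, ?_, ?_, ?_⟩
      · rw [hf.reg 5 rfl]
        simp [hσ, coloringInput]
      · rw [hf.reg 4 rfl]
        simp [hσ, coloringInput]
      · intro w _
        rw [hf.arr 2 rfl]
        simp [hσ, coloringInput]
      · intro z _
        rw [hf.arr 5 rfl]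
        simp [hσ, coloringInput]
    have hSm : S * (m + 1) ≤ Q * Q := Nat.mul_le_mul hSQ hmQ
    obtain ⟨υ, t₂, he₂, ht₂, hb₂, h20⟩ := runs_trials hbτ hready hC h3
      (by rw [hf.reg 20 rfl]; simp [hσ, coloringInput])
      (by
        have h1 : (S * (m + 1) + 1) * k ^ n ≤ (Q * Q + 1) * Q :=
          Nat.mul_le_mul (by omega) hknQ
        have h2 : (Q * Q + 1) * Q = Q * Q * Q + Q := by ring
        have h3 : (S * (m + 1) + 1) * k ^ n ≤ 2 ^ X := by omega
        exact_mod_cast h3)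
      (by
        have h1 : S * (m + 1) * C ≤ Q * Q * Q := Nat.mul_le_mul hSm hCQ
        have h2 : S * (m + 1) * C + C + 2 ≤ 2 ^ X := by omega
        exact_mod_cast h2)
      (by omega)
      (by
        have := natCast_le_two_pow (m := 2 * k) (X := X) (by
          have : n ≤ n * n := Nat.le_mul_of_pos_left _ hn
          omega)
        exact_mod_cast this)
    have hcost₃ := hb₂.cost_le_of_short (e := .reg 20) rfl
    refine ⟨_, _, .ite_neg (by rw [hev]; omega) (.seq he₁ (.seq he₂ (.assign υ 0 (.reg 20)))), ?_,
      ?_⟩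
    · have hco : τ.coins = ω := hf.coins rfl
      rw [hco] at h20
      simp only [State.setReg_reg, if_true, Expr.eval]
      rw [h20]
      exact if_congr ⟨Or.inr, fun h => h.resolve_left hnk⟩ rfl rfl
    -- The exponent of `C` is `width + 1`; the surplus factor `Δ / 2 + 1` is at most `n`, hence at
    -- most `y`.
    · have hCA : C ≤ A * y := by
        rw [hC, pow_succ]
        exact Nat.mul_le_mul_left _ ((maxDegree_div_two_add_one_le hn).trans (by omega))
      have hsteps : trialSteps n p C ≤ A * trialSteps y y y :=
        (trialSteps_mono (by omega) (by omega) hCA).trans (trialSteps_mul_le hA1 y y y)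
      have hSs : S ≤ s := min_le_left _ _
      have h1 : (n * 3 + 6) * (4000 * X₀) ≤ (3 * y + 6) * (4000 * (Z * s)) :=
        Nat.mul_le_mul (by omega) (by omega)
      have h2 : (S * (trialSteps n p C + 2) + 2) * (4000 * X) ≤
          (s * (A * trialSteps y y y + 2) + 2 * s) * (4000 * Z) := by
        refine Nat.mul_le_mul (Nat.add_le_add (Nat.mul_le_mul hSs (by omega)) (by omega))
          (by omega)
      -- The summand `3 * y + 14` of the polynomial pays for the cap (`3 * y + 6`) and, with `8` to
      -- spare, for loop control, the first test and the final assignment.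
      have h3 : A * (4000 * Z * (trialSteps y y y + (3 * y + 14))) * s =
          (s * (A * trialSteps y y y)) * (4000 * Z) + A * ((3 * y + 14) * (4000 * (Z * s))) := by
        ring
      have h4 : (3 * y + 14) * (4000 * (Z * s)) ≤ A * ((3 * y + 14) * (4000 * (Z * s))) :=
        Nat.le_mul_of_pos_left _ hA1
      have h5 : (s * (A * trialSteps y y y + 2) + 2 * s) * (4000 * Z) =
          (s * (A * trialSteps y y y)) * (4000 * Z) + 4 * (4000 * (Z * s)) := by ring
      have h6 : (3 * y + 14) * (4000 * (Z * s)) =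
          (3 * y + 6) * (4000 * (Z * s)) + 8 * (4000 * (Z * s)) := by ring
      have h7 : Expr.cost υ (.reg 20) + 1 ≤ 2000 * (Z * s) := by omega
      have h8 : Expr.cost σ (.add (.sub (.reg 2) (.reg 0)) (.lit 1)) + 1 ≤ 2000 * (Z * s) := by
        omega
      omega

end

end RandomizedRAM

/-! ### The success probability -/

namespace RandomizedRAM

open MeasureTheory

/-! ### Blocks of fair coin tosses -/

instance : IsProbabilityMeasure coinMeasure := by
  unfold coinMeasure
  infer_instance

/-- A sequence of coin tosses that starts with `x`. -/
def extendCoins {L : ℕ} (x : Fin L → Bool) : ℕ → Bool :=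
  fun i => if h : i < L then x ⟨i, h⟩ else false

theorem mem_iff_extendCoins_mem {L : ℕ} {B : Set (ℕ → Bool)} (hB : DependsOn (· ∈ B) (Set.Iio L))
    (ω : ℕ → Bool) : ω ∈ B ↔ (fun i : Fin L => ω i) ∈ {x | extendCoins x ∈ B} := by
  have : (ω ∈ B) = (extendCoins (fun i : Fin L => ω i) ∈ B) :=
    hB fun i hi => by simp [extendCoins, Set.mem_Iio.1 hi]
  simp [this]

theorem measurableSet_of_dependsOn {L : ℕ} {B : Set (ℕ → Bool)}
    (hB : DependsOn (· ∈ B) (Set.Iio L)) : MeasurableSet B := by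
  have : B = (fun (ω : ℕ → Bool) (i : Fin L) => ω i) ⁻¹' {x | extendCoins x ∈ B} :=
    Set.ext fun ω => mem_iff_extendCoins_mem hB ω
  rw [this]
  exact (Set.toFinite _).measurableSet.preimage (by fun_prop)

/-- Events that concern disjoint blocks of `L` coin tosses are independent. -/
theorem coinMeasure_real_blocks {L : ℕ} (B : ℕ → Set (ℕ → Bool))
    (hB : ∀ j, DependsOn (· ∈ B j) (Set.Iio L)) (s : Finset ℕ) :
    coinMeasure.real {ω | ∀ j ∈ s, (fun i => ω (i + j * L)) ∈ B j} =
      ∏ j ∈ s, coinMeasure.real (B j) := by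
  set c := (PMF.uniformOfFintype Bool).toMeasure with hc
  have hinj : Function.Injective fun q : ℕ × Fin L => (q.2 : ℕ) + q.1 * L := by
    rintro ⟨a, i⟩ ⟨b, j⟩ h
    have hL : 0 < L := i.pos
    simp only at h
    have h1 : a = b := by
      have := congrArg (· / L) h
      simpa [Nat.add_mul_div_right _ _ hL, Nat.div_eq_of_lt i.2, Nat.div_eq_of_lt j.2] using this
    subst h1
    simpa [Fin.ext_iff] using h
  -- The coins, reindexed along the injection `(j, i) ↦ i + j * L` and curried, form a sequence of
  -- independent blocks. Events on `L` coins are sets in the finite space of blocks, so the product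
  -- formula applies.
  have hcur := Measure.infinitePi_map_curry (fun (_ : ℕ) (_ : Fin L) => c)
  rw [← Measure.map_infinitePi_infinitePi_of_inj (P := fun _ : ℕ => c) hinj,
    Measure.map_map (by fun_prop) (by fun_prop)] at hcur
  have hone := Measure.map_infinitePi_infinitePi_of_inj (P := fun _ : ℕ => c)
    (Fin.val_injective (n := L))
  have hmeas : ∀ j, MeasurableSet {x : Fin L → Bool | extendCoins x ∈ B j} :=
    fun j => (Set.toFinite _).measurableSet
  have hpi := Measure.infinitePi_pi (fun _ : ℕ => Measure.infinitePi fun _ : Fin L => c) (s := s)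
    (t := fun j => {x | extendCoins x ∈ B j}) fun j _ => hmeas j
  rw [← hcur, Measure.map_apply (by fun_prop) (.pi s.countable_toSet fun j _ => hmeas j)] at hpi
  simp only [Measure.real]
  rw [← ENNReal.toReal_prod]
  congr 1
  have hset : {ω : ℕ → Bool | ∀ j ∈ s, (fun i => ω (i + j * L)) ∈ B j} =
      ((MeasurableEquiv.curry ℕ (Fin L) Bool) ∘ fun ω (q : ℕ × Fin L) => ω (q.2 + q.1 * L)) ⁻¹'
        (s : Set ℕ).pi fun j => {x | extendCoins x ∈ B j} := by
    ext ω
    simp only [Set.mem_ofPred_eq, Set.mem_preimage, Set.mem_pi, Finset.mem_coe]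
    exact forall₂_congr fun j _ => mem_iff_extendCoins_mem (hB j) _
  rw [hset, coinMeasure]
  refine hpi.trans (Finset.prod_congr rfl fun j _ => ?_)
  rw [← hone, Measure.map_apply (by fun_prop) (hmeas j)]
  congr 1
  ext ω
  exact (mem_iff_extendCoins_mem (hB j) ω).symm

/-- The number with the binary digits `ω 0`, ..., `ω (t - 1)`. -/
def binaryNumber (ω : ℕ → Bool) : ℕ → ℕ
  | 0 => 0
  | t + 1 => 2 * binaryNumber ω t + if ω t then 1 else 0

theorem residue_eq_binaryNumber (k : ℕ) (ω : ℕ → Bool) (t : ℕ) :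
    residue k ω t = (binaryNumber ω t : ZMod k) := by
  induction t with
  | zero => simp [residue, binaryNumber]
  | succ t ih =>
    rw [residue, binaryNumber, ih]
    push_cast
    ring

/-- The first toss is the most significant digit, hence the reversed index `t - 1 - i`. -/
theorem binaryNumber_eq_iff (ω : ℕ → Bool) (t : ℕ) : ∀ m < 2 ^ t,
    (binaryNumber ω t = m ↔ ∀ i < t, ω i = m.testBit (t - 1 - i)) := by
  induction t with
  | zero =>
    intro m hm
    simp at hm
    simp [binaryNumber, hm]
  | succ t ih =>
    intro m hm
    have hstep : binaryNumber ω (t + 1) = m ↔ binaryNumber ω t = m / 2 ∧ ω t = m.testBit 0 := by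
      rw [binaryNumber, Nat.testBit_zero]
      cases ω t <;> simp <;> omega
    rw [hstep, ih _ (by omega), Nat.forall_lt_succ_right]
    refine and_congr (forall₂_congr fun i hi => ?_) (by simp)
    rw [← Nat.testBit_succ, show (t - 1 - i).succ = t + 1 - 1 - i by omega]

theorem coinMeasure_real_binaryNumber_eq {t m : ℕ} (hm : m < 2 ^ t) :
    coinMeasure.real {ω | binaryNumber ω t = m} = (1 / 2) ^ t := by
  have : {ω : ℕ → Bool | binaryNumber ω t = m} =
      ((Finset.range t : Finset ℕ) : Set ℕ).pi fun i => {m.testBit (t - 1 - i)} := by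
    ext ω
    simp [binaryNumber_eq_iff ω t m hm, Set.mem_pi]
  rw [this, Measure.real, coinMeasure, Measure.infinitePi_pi _ fun _ _ => .singleton _]
  simp

theorem dependsOn_binaryNumber (t : ℕ) :
    DependsOn (fun ω => binaryNumber ω t) (Set.Iio t) := by
  induction t with
  | zero => exact fun _ _ _ => rfl
  | succ t ih =>
    intro ω ω' h
    simp only [binaryNumber]
    rw [h t (by simp), show binaryNumber ω t = binaryNumber ω' t from
      ih fun i hi => h i (Set.mem_Iio.2 ((Set.mem_Iio.1 hi).trans t.lt_succ_self))]

theorem dependsOn_residue (k t : ℕ) (x : ZMod k) :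
    DependsOn (· ∈ {ω | residue k ω t = x}) (Set.Iio t) := by
  intro ω ω' h
  simp only [Set.mem_ofPred_eq, residue_eq_binaryNumber]
  rw [show binaryNumber ω t = binaryNumber ω' t from dependsOn_binaryNumber t h]

/-- At least `⌊2 ^ t / k⌋ ≥ 2 ^ t / k - 1` of the `2 ^ t` equally likely numbers have the required
residue. -/
theorem le_coinMeasure_real_residue_eq {k : ℕ} [NeZero k] (t : ℕ) (x : ZMod k) :
    1 / (k : ℝ) * (1 - k / 2 ^ t) ≤ coinMeasure.real {ω | residue k ω t = x} := by
  have hk : 0 < k := Nat.pos_of_ne_zero (NeZero.ne k)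
  set M := (Finset.range (2 ^ t)).filter fun m => m ≡ x.val [MOD k] with hM
  have hcard : 2 ^ t / k ≤ M.card := by
    rw [hM, ← Nat.count_eq_card_filter_range, Nat.count_modEq_card _ hk]
    exact Nat.le_add_right _ _
  have hsub : (⋃ m ∈ M, {ω | binaryNumber ω t = m}) ⊆ {ω | residue k ω t = x} := by
    refine Set.iUnion₂_subset fun m hm ω (hω : binaryNumber ω t = m) => ?_
    rw [Set.mem_ofPred_eq, residue_eq_binaryNumber, hω,
      (ZMod.natCast_eq_natCast_iff _ _ _).2 (Finset.mem_filter.1 hm).2, ZMod.natCast_zmod_val]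
  have hmeas : ∀ m ∈ M, MeasurableSet {ω : ℕ → Bool | binaryNumber ω t = m} := fun m _ =>
    measurableSet_of_dependsOn (L := t) fun ω ω' h => by
      simp only [Set.mem_ofPred_eq]
      rw [show binaryNumber ω t = binaryNumber ω' t from dependsOn_binaryNumber t h]
  have hdisj : (M : Set ℕ).PairwiseDisjoint fun m => {ω : ℕ → Bool | binaryNumber ω t = m} :=
    fun m _ m' _ hne => Set.disjoint_left.2 fun ω (h : binaryNumber ω t = m)
      (h' : binaryNumber ω t = m') => hne (h.symm.trans h')
  refine le_trans ?_ (measureReal_mono hsub)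
  rw [measureReal_biUnion_finset hdisj hmeas, Finset.sum_congr rfl fun m hm =>
    coinMeasure_real_binaryNumber_eq (Finset.mem_range.1 (Finset.mem_filter.1 hm).1),
    Finset.sum_const, nsmul_eq_mul]
  have h2 : (0 : ℝ) < 2 ^ t := by positivity
  have hk' : (0 : ℝ) < k := by exact_mod_cast hk
  have h3 : (2 : ℝ) ^ t ≤ k * (M.card + 1) := by
    have := (Nat.div_lt_iff_lt_mul hk).1 (Nat.lt_succ_of_le hcard)
    rw [mul_comm] at this
    exact_mod_cast this.le
  have h4 : 1 / (k : ℝ) * (1 - k / 2 ^ t) = (2 ^ t - k) / (k * 2 ^ t) := by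
    field_simp
  rw [h4, one_div, inv_pow, ← div_eq_mul_inv, div_le_div_iff₀ (by positivity) h2]
  nlinarith

/-- This is why `2 * n` tosses for each entry suffice: for `k ≤ n` the total relative bias `n * (k /
2 ^ (2 * n))` is at most `1 / 2`. -/
theorem two_mul_mul_self_le_two_pow (n : ℕ) : 2 * (n * n) ≤ 2 ^ (2 * n) := by
  induction n with
  | zero => simp
  | succ n ih =>
    rcases Nat.eq_zero_or_pos n with rfl | hn
    · norm_num
    · have h1 : 2 ^ (2 * (n + 1)) = 4 * 2 ^ (2 * n) := by
        rw [mul_add, pow_add]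
        ring
      rw [h1]
      nlinarith

/-! ### Success probability of the trials -/

section

variable {n k : ℕ}

theorem dependsOn_sample (A : Set (Fin n → ZMod k)) :
    DependsOn (· ∈ {ω | sample n k ω ∈ A}) (Set.Iio (n * (2 * n))) := by
  intro ω ω' h
  have : sample n k ω = sample n k ω' := by
    funext w
    refine (dependsOn_residue k (2 * n) (residue k (fun i => ω' (i + w * (2 * n))) (2 * n))
      fun i hi => h _ ?_).mpr rfl
    have h1 : ((w : ℕ) + 1) * (2 * n) ≤ n * (2 * n) := Nat.mul_le_mul_right _ w.2
    rw [add_mul, one_mul] at h1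
    have := Set.mem_Iio.1 hi
    exact Set.mem_Iio.2 (by omega)
  simp only [Set.mem_ofPred_eq, this]

/-- The entries are independent and each takes its value with probability at least `(1 - ε) / k`,
where `ε = k / 2 ^ (2 * n)`. By Bernoulli's inequality `(1 - ε) ^ n ≥ 1 - n * ε ≥ 1 / 2`. -/
theorem le_coinMeasure_real_sample_eq [NeZero k] (hkn : k ≤ n) (a : Fin n → ZMod k) :
    1 / (2 * (k : ℝ) ^ n) ≤ coinMeasure.real {ω | sample n k ω = a} := by
  classical
  set B : ℕ → Set (ℕ → Bool) := fun w =>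
    {ω | residue k ω (2 * n) = if h : w < n then a ⟨w, h⟩ else 0} with hB
  have hset : {ω | sample n k ω = a} =
      {ω | ∀ w ∈ Finset.range n, (fun i => ω (i + w * (2 * n))) ∈ B w} := by
    ext ω
    simp only [Set.mem_ofPred_eq, hB, Finset.mem_range, funext_iff]
    constructor
    · intro h w hw
      simpa [hw, sample] using h ⟨w, hw⟩
    · intro h w
      simpa [sample] using h w w.2
  rw [hset, coinMeasure_real_blocks B (fun w => dependsOn_residue k _ _)]
  have hk' : (0 : ℝ) < k := by exact_mod_cast Nat.pos_of_ne_zero (NeZero.ne k)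
  have hsmall : (n : ℝ) * (k / 2 ^ (2 * n)) ≤ 1 / 2 := by
    have h1 : 2 * ((n : ℝ) * n) ≤ 2 ^ (2 * n) := by exact_mod_cast two_mul_mul_self_le_two_pow n
    have h2 : (k : ℝ) ≤ n := by exact_mod_cast hkn
    rw [← mul_div_assoc, div_le_div_iff₀ (by positivity) (by norm_num)]
    nlinarith
  have hsmall' : (k : ℝ) / 2 ^ (2 * n) ≤ 1 / 2 := by
    refine le_trans ?_ hsmall
    have h1 : (1 : ℝ) ≤ n := by
      exact_mod_cast (Nat.one_le_iff_ne_zero.2 (NeZero.ne k)).trans hkn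
    have h2 : (0 : ℝ) ≤ k / 2 ^ (2 * n) := by positivity
    nlinarith
  calc 1 / (2 * (k : ℝ) ^ n) = (1 / (k : ℝ)) ^ n * (1 / 2) := by
        rw [one_div, one_div, inv_pow, mul_inv]
        ring
    _ ≤ (1 / (k : ℝ)) ^ n * (1 + n * (-(k / 2 ^ (2 * n)))) := by
        gcongr
        linarith
    _ ≤ (1 / (k : ℝ)) ^ n * (1 + -(k / 2 ^ (2 * n))) ^ n := by
        gcongr
        exact one_add_mul_le_pow (by linarith) n
    _ = ∏ _w ∈ Finset.range n, 1 / (k : ℝ) * (1 - k / 2 ^ (2 * n)) := by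
        rw [Finset.prod_const, Finset.card_range, mul_pow, sub_eq_add_neg]
    _ ≤ ∏ w ∈ Finset.range n, coinMeasure.real (B w) := by
        refine Finset.prod_le_prod (fun _ _ => ?_) fun w _ => le_coinMeasure_real_residue_eq _ _
        exact mul_nonneg (by positivity) (by linarith)

theorem card_div_le_coinMeasure_real_sample_mem [NeZero k] (hkn : k ≤ n)
    (A : Finset (Fin n → ZMod k)) :
    (A.card : ℝ) / (2 * (k : ℝ) ^ n) ≤ coinMeasure.real {ω | sample n k ω ∈ A} := by
  have hset : {ω | sample n k ω ∈ A} = ⋃ a ∈ A, {ω | sample n k ω = a} := by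
    ext ω
    simp
  have hdisj : (A : Set (Fin n → ZMod k)).PairwiseDisjoint fun a => {ω | sample n k ω = a} :=
    fun a _ b _ hne => Set.disjoint_left.2 fun ω (h : sample n k ω = a)
      (h' : sample n k ω = b) => hne (h.symm.trans h')
  rw [hset, measureReal_biUnion_finset hdisj
    fun a _ => measurableSet_of_dependsOn (dependsOn_sample {a})]
  calc (A.card : ℝ) / (2 * (k : ℝ) ^ n) = ∑ _a ∈ A, 1 / (2 * (k : ℝ) ^ n) := by
        rw [Finset.sum_const, nsmul_eq_mul, mul_one_div]
    _ ≤ _ := Finset.sum_le_sum fun a _ => le_coinMeasure_real_sample_eq hkn a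

/-- One of `S` independent samples lies in a set of density at least `1 / S` with probability
bounded from below. -/
theorem le_coinMeasure_real_exists_sample_mem [NeZero k] (hkn : k ≤ n)
    (A : Finset (Fin n → ZMod k)) {S : ℕ} (hS : k ^ n ≤ A.card * S) :
    1 - Real.exp (-(1 / 2)) ≤ coinMeasure.real
      {ω | ∃ j < S, sample n k (fun i => ω (i + j * (n * (2 * n)))) ∈ A} := by
  set L := n * (2 * n) with hL
  set B : Set (ℕ → Bool) := {ω | sample n k ω ∈ (A : Set (Fin n → ZMod k))} with hB
  set q := coinMeasure.real B with hq
  have hkpos : (0 : ℝ) < (k : ℝ) ^ n :=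
    pow_pos (by exact_mod_cast Nat.pos_of_ne_zero (NeZero.ne k)) n
  have hqA : (A.card : ℝ) / (2 * (k : ℝ) ^ n) ≤ q :=
    card_div_le_coinMeasure_real_sample_mem hkn A
  have hdep : DependsOn (· ∈ B) (Set.Iio L) := dependsOn_sample _
  have hdepc : DependsOn (· ∈ Bᶜ) (Set.Iio L) := dependsOn_sample (A : Set (Fin n → ZMod k))ᶜ
  have hq1 : q ≤ 1 := measureReal_le_one
  have hqS : 1 / 2 ≤ S * q := by
    have h1 : (k : ℝ) ^ n ≤ A.card * S := by exact_mod_cast hS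
    have h2 : (1 : ℝ) / 2 ≤ S * ((A.card : ℝ) / (2 * (k : ℝ) ^ n)) := by
      rw [← mul_div_assoc, div_le_div_iff₀ (by norm_num) (by positivity)]
      linarith
    exact h2.trans (mul_le_mul_of_nonneg_left hqA (Nat.cast_nonneg _))
  have hblocks := coinMeasure_real_blocks (fun _ => Bᶜ) (fun _ => hdepc) (Finset.range S)
  have hmeas : MeasurableSet {ω : ℕ → Bool | ∀ j ∈ Finset.range S,
      (fun i => ω (i + j * L)) ∈ Bᶜ} := by
    have : {ω : ℕ → Bool | ∀ j ∈ Finset.range S, (fun i => ω (i + j * L)) ∈ Bᶜ} =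
        ⋂ j ∈ Finset.range S, (fun (ω : ℕ → Bool) (i : ℕ) => ω (i + j * L)) ⁻¹' Bᶜ := by
      ext ω
      simp
    rw [this]
    exact Finset.measurableSet_biInter _ fun j _ =>
      (measurableSet_of_dependsOn hdepc).preimage (by fun_prop)
  have hset : {ω | ∃ j < S, sample n k (fun i => ω (i + j * L)) ∈ A} =
      {ω : ℕ → Bool | ∀ j ∈ Finset.range S, (fun i => ω (i + j * L)) ∈ Bᶜ}ᶜ := by
    ext ω
    simp [hB]
  rw [hset, probReal_compl_eq_one_sub hmeas, hblocks, Finset.prod_const, Finset.card_range,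
    probReal_compl_eq_one_sub (measurableSet_of_dependsOn hdep), ← hq]
  -- All `S` trials fail with probability `(1 - q) ^ S ≤ exp (-(q * S))`, and `q * S ≥ 1 / 2`.
  have h1 : (1 - q) ^ S ≤ Real.exp (-q) ^ S :=
    pow_le_pow_left₀ (by linarith) (Real.one_sub_le_exp_neg q) S
  rw [← Real.exp_nat_mul] at h1
  have h2 : Real.exp (S * -q) ≤ Real.exp (-(1 / 2)) := Real.exp_le_exp.2 (by linarith)
  linarith

end

end RandomizedRAM

/-- Output `1` means Yes, output `0` means No. -/
theorem theorem1 :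
    ∃ (alg : RandomizedRAM.Program) (q : Polynomial ℕ) (ε : ℝ), 0 < ε ∧
      ∀ (n p k s : ℕ) (G : SimpleGraph (Fin n)) [DecidableRel G.Adj] (P : PathDecomposition G p),
        1 ≤ k → 1 ≤ s →
        -- for all coin tosses, the algorithm answers Yes or No within the stated time
        (∀ ω : ℕ → Bool, ∃ z : ℤ, (z = 0 ∨ z = 1) ∧
          RandomizedRAM.OutputsWithin alg (coloringInput G P k s ω) z
            ((G.maxDegree / 2 + 1) ^ P.width * q.eval (n + p + Nat.size k) * s)) ∧
        (G.Colorable k → Nat.card (G.Coloring (Fin k)) ≤ s →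
          ε ≤ RandomizedRAM.coinMeasure.real
            {ω : ℕ → Bool | RandomizedRAM.Outputs alg (coloringInput G P k s ω) 1}) ∧
        (¬ G.Colorable k →
          ∀ ω : ℕ → Bool, RandomizedRAM.Outputs alg (coloringInput G P k s ω) 0) := by
  classical
  refine ⟨RandomizedRAM.coloringAlgorithm, RandomizedRAM.timePolynomial, 1 - Real.exp (-(1 / 2)),
    by simp, ?_⟩
  intro n p k s G _ P hk hs
  have : NeZero k := ⟨by omega⟩
  have hout := RandomizedRAM.outputsWithin_coloringAlgorithm (k := k) P hs
  refine ⟨fun ω => ⟨_, ?_, hout ω⟩, fun hG hcard => ?_, fun hG ω => ?_⟩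
  · split_ifs <;> simp
  -- Together with `hcard`: even the capped number of trials is at least the number of colorings, as
  -- the sampling bound requires.
  · have hle : Nat.card (G.Coloring (Fin k)) ≤ k ^ n := by
      have : Nat.card (G.Coloring (Fin k)) ≤ Nat.card (Fin n → Fin k) :=
        Nat.card_le_card_of_injective (fun c v => c v) DFunLike.coe_injective
      simpa using this
    have hsub : {ω : ℕ → Bool | n ≤ k ∨ ∃ j < min s (k ^ n), demandCoeff
        (RandomizedRAM.sample n k fun i => ω (i + j * (n * (2 * n)))) (edgeList P) 0 ≠ 0} ⊆
        {ω | RandomizedRAM.Outputs RandomizedRAM.coloringAlgorithm (coloringInput G P k s ω) 1} := by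
      intro ω (hω : _ ∨ _)
      obtain ⟨τ, t, he, hz, -⟩ := hout ω
      rw [if_pos hω] at hz
      exact ⟨τ, t, he, hz⟩
    refine le_trans ?_ (MeasureTheory.measureReal_mono hsub)
    by_cases hnk : n ≤ k
    · have hexp : 0 < Real.exp (-(1 / 2)) := Real.exp_pos _
      simp only [hnk, true_or, Set.ofPred_true, MeasureTheory.probReal_univ]
      linarith
    · refine (RandomizedRAM.le_coinMeasure_real_exists_sample_mem (by omega)
        (Finset.univ.filter fun a : Fin n → ZMod k => demandCoeff a (edgeList P) 0 ≠ 0)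
        (S := min s (k ^ n)) ?_).trans (MeasureTheory.measureReal_mono ?_)
      · exact (pow_le_card_mul_card_coloring (listsEdges_edgeList P)
          (lt_of_mem_edgeList P) hG).trans
          (Nat.mul_le_mul_left _ (le_min hcard hle))
      · rintro ω ⟨j, hj, hmem⟩
        exact Or.inr ⟨j, hj, (Finset.mem_filter.1 hmem).2⟩
  -- With at least as many colors as vertices, giving all vertices different colors is proper; so
  -- the shortcut never says Yes wrongly.
  · have hnk : ¬ n ≤ k := fun hnk =>
      hG ⟨SimpleGraph.Coloring.mk (Fin.castLE hnk) fun h heq =>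
        h.ne (Fin.castLE_injective hnk heq)⟩
    obtain ⟨τ, t, he, hz, -⟩ := hout ω
    rw [if_neg] at hz
    · exact ⟨τ, t, he, hz⟩
    · rintro (h | ⟨j, -, hj⟩)
      · exact hnk h
      · exact hj (demandCoeff_eq_zero_of_not_colorable (listsEdges_edgeList P)
          (lt_of_mem_edgeList P) hG _)
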